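/- Let $X$ be a simply connected rationally elliptic space, i.e. a simply connected space with a minimal model $(\Lambda V,d)$ over $\mathbb{Q}$ (a minimal commutative differential graded algebra with $V=V^{\ge 2}$, connected by a chain of quasi-isomorphisms of differential graded algebras to the algebra of rational singular cochains of $X$) for which both $V$ and the cohomology $H^*(\Lambda V,d)\cong H^*(X;\mathbb{Q})$ are finite-dimensional. The degree $i$ part $\pi_i(X)\otimes\mathbb{Q}$ of the rational homotopy is represented by its dual, the space $V^i$ of generators of degree $i$; "$\pi_i(X)\otimes\mathbb{Q}$ is nonzero" means $V^i\neq 0$, and $\dim \pi_i(X)\otimes\mathbb{Q}$ means $\dim V^i$. Put $p=-\sum_i(-1)^i\dim V^i$ and let $\mathrm{fd}(X)$ be the largest degree in which $H^*(X;\mathbb{Q})$ does not vanish. Suppose that $p>0$. Suppose that the smallest degree $d$ in which $\pi_*(X)\otimes\mathbb{Q}$ is nonzero is even, and put $k=\dim \pi_d(X)\otimes\mathbb{Q}$. Suppose further that the second smallest degree in which $\pi_*(X)\otimes\mathbb{Q}$ is nonzero is $2d-1$, put $l=\dim\pi_{2d-1}(X)\otimes\mathbb{Q}$, and suppose that $2d-1<\tfrac{\mathrm{fd}(X)}{2}-1$.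 Write $\dim H^*=\sum_i\dim H^i(X;\mathbb{Q})$. If $\mathrm{fd}(X)$ is even and $\binom{k+1}{2}\ge l$, then $$\dim H^*\ \ge\ 4\left(1+k+\binom{k+1}{2}-l\right).$$ If $\mathrm{fd}(X)$ is even and $\binom{k+1}{2}<l$, then $$\dim H^*\ \ge\ 4\max\left(l-\binom{k+1}{2},\ 1+k\right).$$ If $\mathrm{fd}(X)$ is odd, then in either case $$\dim H^*\ \ge\ 2\left(1+k+\left|\,l-\binom{k+1}{2}\right|\right).$$ -/

import Mathlib

universe u

/-! ### Cochain algebras over the rationals -/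

/-- A cochain algebra (differential graded algebra) over `ℚ`: a `ℚ`-algebra graded by `ℕ`, with a
differential of degree `+1` which squares to zero and satisfies the graded Leibniz rule.  It is not
assumed to be graded commutative. -/
structure CochainAlgebra : Type (u + 1) where
  carrier : Type u
  [ring : Ring carrier]
  [algebra : Algebra ℚ carrier]
  gr : ℕ → Submodule ℚ carrier
  [graded : GradedAlgebra gr]
  d : carrier →ₗ[ℚ] carrier
  d_mem : ∀ (n : ℕ) (a : carrier), a ∈ gr n → d a ∈ gr (n + 1)
  d_d : ∀ a : carrier, d (d a) = 0
  leibniz : ∀ (n : ℕ) (a b : carrier), a ∈ gr n →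
    d (a * b) = d a * b + (-1 : ℚ) ^ n • (a * d b)

attribute [instance] CochainAlgebra.ring CochainAlgebra.algebra CochainAlgebra.graded

namespace CochainAlgebra

/-- The cocycles of degree `n`. -/
def cocycles (A : CochainAlgebra.{u}) (n : ℕ) : Submodule ℚ A.carrier :=
  A.gr n ⊓ LinearMap.ker A.d

/-- The cohomology `Hⁿ(A, d)`: cocycles of degree `n` modulo coboundaries. -/
def cohomology (A : CochainAlgebra.{u}) (n : ℕ) : Type u :=
  A.cocycles n ⧸ (LinearMap.range A.d).submoduleOf (A.cocycles n)

instance (A : CochainAlgebra.{u}) (n : ℕ) : AddCommGroup (A.cohomology n) :=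
  inferInstanceAs (AddCommGroup (A.cocycles n ⧸ (LinearMap.range A.d).submoduleOf (A.cocycles n)))

instance (A : CochainAlgebra.{u}) (n : ℕ) : Module ℚ (A.cohomology n) :=
  inferInstanceAs (Module ℚ (A.cocycles n ⧸ (LinearMap.range A.d).submoduleOf (A.cocycles n)))

/-- The total cohomology `H^* = ⨁ₙ Hⁿ(A, d)`. -/
abbrev totalCohomology (A : CochainAlgebra.{u}) : Type u :=
  DirectSum ℕ A.cohomology

/-- `n` is the formal dimension: the largest degree in which the cohomology does not vanish. -/
def IsFormalDimension (A : CochainAlgebra.{u}) (n : ℕ) : Prop :=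
  IsGreatest {m : ℕ | Nontrivial (A.cohomology m)} n

/-- A quasi-isomorphism: a unital, multiplicative, degree preserving map which commutes with the
differentials and induces an injective and surjective map on cohomology in each degree. -/
structure QuasiIso (A B : CochainAlgebra.{u}) where
  toAlgHom : A.carrier →ₐ[ℚ] B.carrier
  map_gr : ∀ (n : ℕ) (a : A.carrier), a ∈ A.gr n → toAlgHom a ∈ B.gr n
  map_d : ∀ a : A.carrier, toAlgHom (A.d a) = B.d (toAlgHom a)
  injective : ∀ (n : ℕ) (a : A.carrier), a ∈ A.cocycles n →
    toAlgHom a ∈ LinearMap.range B.d → a ∈ LinearMap.range A.d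
  surjective : ∀ (n : ℕ) (b : B.carrier), b ∈ B.cocycles n →
    ∃ a ∈ A.cocycles n, toAlgHom a - b ∈ LinearMap.range B.d

/-- Two cochain algebras are weakly equivalent when a finite chain of quasi-isomorphisms, pointing
in arbitrary directions, connects them. -/
def WeaklyEquivalent : CochainAlgebra.{u} → CochainAlgebra.{u} → Prop :=
  Relation.EqvGen fun A B => Nonempty (QuasiIso A B)

/-- The span of the elements of positive degree. -/
def augmentationIdeal (A : CochainAlgebra.{u}) : Submodule ℚ A.carrier :=
  ⨆ n : ℕ, A.gr (n + 1)

end CochainAlgebra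

/-! ### Minimal Sullivan algebras -/

/-- The product of the powers `x i ^ m i`, taken in increasing order of `i`. -/
def orderedMonomial {A : Type u} [Ring A] {ι : Type u} [LinearOrder ι] (x : ι → A)
    (m : ι →₀ ℕ) : A :=
  ((m.support.sort (· ≤ ·)).map fun i => x i ^ m i).prod

/-- A minimal commutative differential graded algebra `(ΛV, d)` over `ℚ` with `V = V^{≥ 2}`, that is,
with `V⁰ = V¹ = 0`, together with a homogeneous basis `gen` of `V`.

* It is graded commutative.
* It is free as such: `ΛV` is the symmetric algebra on the even part of `V` tensored with the
  exterior algebra on the odd part, i.e. the ordered monomials in the generators in which every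
  generator of odd degree has exponent at most one are a basis.
* It is minimal: `d V ⊆ Λ^{≥ 2} V`, where `Λ^{≥ 2} V = Λ⁺V · Λ⁺V`.  Since `V = V^{≥ 2}`, this makes
  `d` map `Vⁿ` into the subalgebra generated by `V^{< n}`, so the nilpotence condition in the
  definition of a Sullivan algebra is automatic. -/
structure MinimalSullivanAlgebra extends CochainAlgebra.{u} where
  ι : Type u
  [linearOrder : LinearOrder ι]
  deg : ι → ℕ
  two_le_deg : ∀ i, 2 ≤ deg i
  gen : ι → carrier
  gen_mem : ∀ i, gen i ∈ gr (deg i)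
  graded_comm : ∀ (p q : ℕ) (a b : carrier), a ∈ gr p → b ∈ gr q →
    a * b = (-1 : ℚ) ^ (p * q) • (b * a)
  linearIndependent : LinearIndependent ℚ
    fun m : {m : ι →₀ ℕ // ∀ i, Odd (deg i) → m i ≤ 1} => orderedMonomial gen m.1
  span_eq_top : Submodule.span ℚ (Set.range
    fun m : {m : ι →₀ ℕ // ∀ i, Odd (deg i) → m i ≤ 1} => orderedMonomial gen m.1) = ⊤
  minimal : ∀ i, d (gen i) ∈
    toCochainAlgebra.augmentationIdeal * toCochainAlgebra.augmentationIdeal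


/-! ### Singular cochains -/

/-- A singular `n`-simplex of `X`. -/
def SingularSimplex (X : Type u) [TopologicalSpace X] (n : ℕ) : Type u :=
  C(stdSimplex ℝ (Fin (n + 1)), X)

namespace SingularSimplex

variable {X : Type u} [TopologicalSpace X]

/-- The restriction of a singular simplex along the affine map of standard simplices given by `θ` on
vertices. -/
noncomputable def restrict {m n : ℕ} (θ : Fin (m + 1) → Fin (n + 1)) (σ : SingularSimplex X n) :
    SingularSimplex X m :=
  ContinuousMap.comp σ ⟨stdSimplex.map θ, stdSimplex.continuous_map θ⟩

theorem restrict_restrict {m n r : ℕ} (θ : Fin (m + 1) → Fin (n + 1))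
    (φ : Fin (n + 1) → Fin (r + 1)) (σ : SingularSimplex X r) :
    restrict θ (restrict φ σ) = restrict (φ ∘ θ) σ := by
  apply ContinuousMap.ext
  intro x
  exact congrArg _ (stdSimplex.map_comp_apply θ φ x)

theorem restrict_id {n : ℕ} (σ : SingularSimplex X n) : restrict id σ = σ := by
  apply ContinuousMap.ext
  intro x
  exact congrArg _ (stdSimplex.map_id_apply x)

end SingularSimplex

section SingularCochains

open SingularSimplex

/-- The rational singular cochains of degree `n`. -/
abbrev SingularCochain (X : Type u) [TopologicalSpace X] (n : ℕ) : Type u :=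
  SingularSimplex X n → ℚ

namespace SingularCochain

variable {X : Type u} [TopologicalSpace X]

/-- `(δ f)(σ) = ∑ᵢ (-1)ⁱ f(σ restricted to the i-th face)`. -/
noncomputable def coboundary (n : ℕ) : SingularCochain X n →ₗ[ℚ] SingularCochain X (n + 1) where
  toFun f := fun σ => ∑ i : Fin (n + 2), (-1 : ℚ) ^ (i : ℕ) * f (restrict i.succAbove σ)
  map_add' f g := by
    funext σ
    simp only [Pi.add_apply, mul_add, Finset.sum_add_distrib]
  map_smul' c f := by
    funext σ
    simp only [Pi.smul_apply, smul_eq_mul, RingHom.id_apply, Finset.mul_sum]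
    exact Finset.sum_congr rfl fun i _ => by ring

/-- The front `p`-face `[0, …, p]` of `[0, …, p + q]`. -/
def front (p q : ℕ) (i : Fin (p + 1)) : Fin (p + q + 1) := ⟨i, by omega⟩

/-- The back `q`-face `[p, …, p + q]` of `[0, …, p + q]`. -/
def back (p q : ℕ) (i : Fin (q + 1)) : Fin (p + q + 1) := ⟨p + i, by omega⟩

/-- The cup product (Alexander-Whitney formula). -/
noncomputable def cup {p q : ℕ} (f : SingularCochain X p) (g : SingularCochain X q) :
    SingularCochain X (p + q) :=
  fun σ => f (restrict (front p q) σ) * g (restrict (back p q) σ)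

theorem mk_eq {m n : ℕ} (h : m = n) (f : SingularCochain X m) (g : SingularCochain X n)
    (hfg : ∀ σ : SingularSimplex X n,
      f (restrict (Fin.cast (congrArg (· + 1) h)) σ) = g σ) :
    GradedMonoid.mk m f = GradedMonoid.mk n g := by
  subst h
  congr 1
  funext σ
  rw [← hfg σ]
  exact congrArg f (restrict_id σ).symm

theorem one_cup {n : ℕ} (f : SingularCochain X n) :
    GradedMonoid.mk (0 + n) (cup (fun _ : SingularSimplex X 0 => 1) f) = GradedMonoid.mk n f := by
  refine mk_eq (zero_add n) _ _ fun σ => ?_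
  refine (one_mul _).trans (congrArg f ?_)
  rw [restrict_restrict]
  conv_rhs => rw [← restrict_id σ]
  congr 1
  funext i; ext; simp [back]

theorem cup_one {n : ℕ} (f : SingularCochain X n) :
    GradedMonoid.mk (n + 0) (cup f (fun _ : SingularSimplex X 0 => 1)) = GradedMonoid.mk n f := by
  refine mk_eq (add_zero n) _ _ fun σ => ?_
  refine (mul_one _).trans (congrArg f ?_)
  rw [restrict_restrict]
  conv_rhs => rw [← restrict_id σ]
  congr 1

theorem cup_assoc {p q r : ℕ} (f : SingularCochain X p) (g : SingularCochain X q)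
    (h : SingularCochain X r) :
    GradedMonoid.mk (p + q + r) (cup (cup f g) h) =
      GradedMonoid.mk (p + (q + r)) (cup f (cup g h)) := by
  refine mk_eq (add_assoc p q r) _ _ fun σ => ?_
  simp only [cup, restrict_restrict]
  rw [mul_assoc]
  congr 3
  congr 1
  funext i; ext; simp [back]; omega

noncomputable instance : GradedMonoid.GMul (SingularCochain X) where
  mul f g := cup f g

noncomputable instance : GradedMonoid.GOne (SingularCochain X) where
  one := fun _ => 1

noncomputable instance : GradedMonoid.GMonoid (SingularCochain X) where
  one_mul a := one_cup a.2
  mul_one a := cup_one a.2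
  mul_assoc a b c := cup_assoc a.2 b.2 c.2

noncomputable instance : DirectSum.GRing (SingularCochain X) where
  mul_zero f := by funext σ; exact mul_zero _
  zero_mul f := by funext σ; exact zero_mul _
  mul_add f g h := by funext σ; exact mul_add _ _ _
  add_mul f g h := by funext σ; exact add_mul _ _ _
  natCast n := fun _ => n
  natCast_zero := by funext σ; exact Nat.cast_zero
  natCast_succ n := by funext σ; exact Nat.cast_succ n
  intCast n := fun _ => n
  intCast_ofNat n := by funext σ; exact Int.cast_natCast n
  intCast_negSucc_ofNat n := by funext σ; exact Int.cast_negSucc n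

theorem const_cup (c : ℚ) {n : ℕ} (f : SingularCochain X n) :
    GradedMonoid.mk (0 + n) (cup (fun _ : SingularSimplex X 0 => c) f) =
      GradedMonoid.mk n (c • f) := by
  refine mk_eq (zero_add n) _ _ fun σ => ?_
  change c * f _ = c * f _
  rw [restrict_restrict]
  conv_rhs => rw [← restrict_id σ]
  congr 3
  funext i; ext; simp [back]

theorem cup_const (c : ℚ) {n : ℕ} (f : SingularCochain X n) :
    GradedMonoid.mk (n + 0) (cup f (fun _ : SingularSimplex X 0 => c)) =
      GradedMonoid.mk n (c • f) := by
  refine mk_eq (add_zero n) _ _ fun σ => ?_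
  change f _ * c = c * f _
  rw [restrict_restrict, mul_comm]
  conv_rhs => rw [← restrict_id σ]
  congr 1

noncomputable instance : DirectSum.GAlgebra ℚ (SingularCochain X) where
  toFun := { toFun := fun c _ => c, map_zero' := rfl, map_add' := fun _ _ => rfl }
  map_one := rfl
  map_mul r s := (const_cup r (fun _ : SingularSimplex X 0 => s)).symm
  commutes c a := (const_cup c a.2).trans (cup_const c a.2).symm
  smul_def c a := (const_cup c a.2).symm

theorem coboundary_coboundary (n : ℕ) (f : SingularCochain X n) :
    coboundary (n + 1) (coboundary n f) = 0 := by
  funext σ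
  change ∑ i : Fin (n + 3), (-1 : ℚ) ^ (i : ℕ) *
    ∑ j : Fin (n + 2), (-1 : ℚ) ^ (j : ℕ) * f (restrict j.succAbove (restrict i.succAbove σ)) = 0
  simp only [Finset.mul_sum, restrict_restrict]
  rw [← Fintype.sum_prod_type' (f := fun (i : Fin (n + 3)) (j : Fin (n + 2)) =>
    (-1 : ℚ) ^ (i : ℕ) * ((-1 : ℚ) ^ (j : ℕ) * f (restrict (i.succAbove ∘ j.succAbove) σ)))]
  refine Finset.sum_involution (fun x _ => (x.1.succAbove x.2, x.2.predAbove x.1)) ?_ ?_ ?_ ?_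
  · rintro ⟨i, j⟩ -
    have h : (i.succAbove j).succAbove ∘ (j.predAbove i).succAbove =
        i.succAbove ∘ j.succAbove := by
      funext k
      exact Fin.succAbove_succAbove_succAbove_predAbove i j k
    simp only [h]
    rw [← mul_assoc, ← mul_assoc, ← add_mul, ← pow_add, ← pow_add]
    suffices hh : (-1 : ℚ) ^ ((i : ℕ) + j) +
        (-1 : ℚ) ^ ((i.succAbove j : ℕ) + (j.predAbove i : ℕ)) = 0 by rw [hh, zero_mul]
    rcases lt_or_ge j.castSucc i with hij | hij
    · rw [Fin.succAbove_of_castSucc_lt _ _ hij, Fin.predAbove_of_castSucc_lt _ _ hij]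
      obtain ⟨m, hm⟩ : ∃ m, (i : ℕ) = m + 1 :=
        ⟨i - 1, by have : (j : ℕ) < i := hij; omega⟩
      simp only [Fin.val_castSucc, Fin.val_pred, hm, Nat.add_sub_cancel]
      rw [add_comm (j : ℕ) m, show m + 1 + (j : ℕ) = (m + j) + 1 by omega, pow_succ]
      ring
    · rw [Fin.succAbove_of_le_castSucc _ _ hij, Fin.predAbove_of_le_castSucc _ _ hij]
      simp only [Fin.val_succ, Fin.coe_castPred]
      rw [show (j : ℕ) + 1 + i = (i + j) + 1 by omega, pow_succ]
      ring
  · rintro ⟨i, j⟩ - - h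
    exact Fin.succAbove_ne i j (congrArg Prod.fst h)
  · intro _ _; exact Finset.mem_univ _
  · rintro ⟨i, j⟩ -
    exact Prod.ext (Fin.succAbove_succAbove_predAbove i j)
      (Fin.predAbove_predAbove_succAbove i j)

theorem val_succAbove {n : ℕ} (i : Fin (n + 1)) (j : Fin n) :
    (i.succAbove j : ℕ) = if (j : ℕ) < i then (j : ℕ) else j + 1 := by
  unfold Fin.succAbove
  by_cases h : (j : ℕ) < i
  · rw [if_pos h, if_pos (show j.castSucc < i from h)]; rfl
  · rw [if_neg h, if_neg (show ¬ j.castSucc < i from h)]; rfl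

theorem coboundary_cup_apply {p q : ℕ} (f : SingularCochain X p) (g : SingularCochain X q)
    (σ : SingularSimplex X (p + q + 1)) :
    coboundary (p + q) (cup f g) σ =
      cup (coboundary p f) g (restrict (Fin.cast (by omega)) σ) +
      (-1 : ℚ) ^ p * cup f (coboundary q g) σ := by
  change ∑ i : Fin (p + q + 2), (-1 : ℚ) ^ (i : ℕ) * (f (restrict (front p q)
        (restrict i.succAbove σ)) * g (restrict (back p q) (restrict i.succAbove σ))) =
    (∑ i : Fin (p + 2), (-1 : ℚ) ^ (i : ℕ) * f (restrict i.succAbove (restrict (front (p + 1) q)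
        (restrict (Fin.cast (by omega)) σ)))) * g (restrict (back (p + 1) q)
        (restrict (Fin.cast (by omega)) σ)) +
    (-1 : ℚ) ^ p * (f (restrict (front p (q + 1)) σ) * ∑ j : Fin (q + 2), (-1 : ℚ) ^ (j : ℕ) *
      g (restrict j.succAbove (restrict (back p (q + 1)) σ)))
  simp only [restrict_restrict]
  have hN : (p + 1) + (q + 1) = p + q + 2 := by omega
  have hM : p + 1 + q + 1 = p + q + 1 + 1 := by omega
  rw [Fin.sum_univ_castSucc (n := p + 1), Fin.sum_univ_succ (n := q + 1),
    ← (finCongr hN).sum_comp, Fin.sum_univ_add]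
  have e1 : ∀ i : Fin (p + 1), (finCongr hN (Fin.castAdd (q + 1) i)).succAbove ∘ front p q =
      (Fin.cast hM ∘ front (p + 1) q) ∘ i.castSucc.succAbove := by
    intro i; funext k; ext
    simp [val_succAbove, front]
  have e2 : ∀ i : Fin (p + 1), (finCongr hN (Fin.castAdd (q + 1) i)).succAbove ∘ back p q =
      Fin.cast hM ∘ back (p + 1) q := by
    intro i; funext k; ext
    simp only [Function.comp_apply, val_succAbove, back, finCongr_apply, Fin.val_cast,
      Fin.val_castAdd]
    split_ifs <;> omega
  have e3 : ∀ j : Fin (q + 1), (finCongr hN (Fin.natAdd (p + 1) j)).succAbove ∘ front p q =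
      front p (q + 1) := by
    intro i; funext k; ext
    simp only [Function.comp_apply, val_succAbove, front, finCongr_apply, Fin.val_cast,
      Fin.val_natAdd]
    split_ifs <;> omega
  have e4 : ∀ j : Fin (q + 1), (finCongr hN (Fin.natAdd (p + 1) j)).succAbove ∘ back p q =
      back p (q + 1) ∘ j.succ.succAbove := by
    intro j; funext k; ext
    simp only [Function.comp_apply, val_succAbove, back, finCongr_apply, Fin.val_cast,
      Fin.val_natAdd, Fin.val_succ]
    split_ifs <;> omega
  have e5 : (Fin.cast hM ∘ front (p + 1) q) ∘ (Fin.last (p + 1)).succAbove = front p (q + 1) := by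
    funext k; ext
    simp [front]
  have e6 : Fin.cast hM ∘ back (p + 1) q = back p (q + 1) ∘ (0 : Fin (q + 2)).succAbove := by
    funext k; ext
    simp [back]; omega
  simp only [e1, e2, e3, e4, e5]
  simp only [finCongr_apply, Fin.val_cast, Fin.val_castAdd, Fin.val_natAdd,
    Fin.val_castSucc, Fin.val_succ, Fin.val_last, Fin.val_zero]
  rw [add_mul, mul_add, mul_add, Finset.sum_mul, Finset.mul_sum, Finset.mul_sum, ← e6]
  have h1 : ∀ i : Fin (p + 1), (-1 : ℚ) ^ (i : ℕ) *
      (f (restrict ((Fin.cast hM ∘ front (p + 1) q) ∘ i.castSucc.succAbove) σ) *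
        g (restrict (Fin.cast hM ∘ back (p + 1) q) σ)) =
      (-1 : ℚ) ^ (i : ℕ) *
      f (restrict ((Fin.cast hM ∘ front (p + 1) q) ∘ i.castSucc.succAbove) σ) *
        g (restrict (Fin.cast hM ∘ back (p + 1) q) σ) := fun i => (mul_assoc _ _ _).symm
  have h2 : ∀ j : Fin (q + 1), (-1 : ℚ) ^ (p + 1 + (j : ℕ)) * (f (restrict (front p (q + 1)) σ) *
      g (restrict (back p (q + 1) ∘ j.succ.succAbove) σ)) =
      (-1 : ℚ) ^ p * (f (restrict (front p (q + 1)) σ) * ((-1 : ℚ) ^ ((j : ℕ) + 1) *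
      g (restrict (back p (q + 1) ∘ j.succ.succAbove) σ))) := fun j => by ring
  rw [Finset.sum_congr rfl fun i _ => h1 i, Finset.sum_congr rfl fun j _ => h2 j]
  ring

end SingularCochain

open SingularCochain

/-- The cochain algebra `C^*(X; ℚ)` of rational singular cochains with the cup product.  Its
cohomology is the rational singular cohomology `H^*(X; ℚ)`. -/
noncomputable def singularCochainAlgebra (X : Type u) [TopologicalSpace X] :
    CochainAlgebra.{u} where
  carrier := DirectSum ℕ (SingularCochain X)
  gr n := LinearMap.range (DirectSum.lof ℚ ℕ (SingularCochain X) n)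
  graded :=
    { one_mem := ⟨GradedMonoid.GOne.one, rfl⟩
      mul_mem := by
        rintro p q _ _ ⟨f, rfl⟩ ⟨g, rfl⟩
        exact ⟨cup f g, (DirectSum.of_mul_of (A := SingularCochain X) f g).symm⟩
      toDecomposition := DirectSum.Decomposition.ofLinearMap _
        (DirectSum.toModule ℚ ℕ _ fun n =>
          DirectSum.lof ℚ ℕ (fun n => LinearMap.range (DirectSum.lof ℚ ℕ (SingularCochain X) n)) n ∘ₗ
            (DirectSum.lof ℚ ℕ (SingularCochain X) n).rangeRestrict)
        (by
          ext n f : 2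
          simp [DirectSum.toModule_lof])
        (by
          ext n ⟨_, f, rfl⟩ : 2
          simp [DirectSum.toModule_lof]
          rfl) }
  d := DirectSum.toModule ℚ ℕ _ fun n =>
    DirectSum.lof ℚ ℕ (SingularCochain X) (n + 1) ∘ₗ coboundary n
  d_mem := by
    rintro n _ ⟨f, rfl⟩
    exact ⟨coboundary n f, by rw [DirectSum.toModule_lof]; rfl⟩
  d_d := by
    intro a
    induction a using DirectSum.induction_on with
    | zero => simp
    | of n f =>
      change DirectSum.toModule ℚ ℕ _ _ (DirectSum.toModule ℚ ℕ _ _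
        (DirectSum.lof ℚ ℕ (SingularCochain X) n f)) = 0
      rw [DirectSum.toModule_lof, LinearMap.comp_apply, DirectSum.toModule_lof,
        LinearMap.comp_apply, coboundary_coboundary, map_zero]
    | add a b ha hb => rw [map_add, map_add, ha, hb, add_zero]
  leibniz := by
    rintro p _ b ⟨f, rfl⟩
    induction b using DirectSum.induction_on with
    | zero => simp
    | of q g =>
      change DirectSum.toModule ℚ ℕ _ _ (DirectSum.of (SingularCochain X) p f *
        DirectSum.of (SingularCochain X) q g) = DirectSum.toModule ℚ ℕ _ _
          (DirectSum.lof ℚ ℕ (SingularCochain X) p f) * DirectSum.of (SingularCochain X) q g +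
        (-1 : ℚ) ^ p • (DirectSum.of (SingularCochain X) p f *  DirectSum.toModule ℚ ℕ _ _
          (DirectSum.lof ℚ ℕ (SingularCochain X) q g))
      rw [DirectSum.of_mul_of, DirectSum.toModule_lof, DirectSum.toModule_lof]
      change DirectSum.toModule ℚ ℕ _ _ (DirectSum.lof ℚ ℕ (SingularCochain X) (p + q)
        (cup (p := p) (q := q) f g)) =
        DirectSum.of (SingularCochain X) (p + 1) (coboundary p f) *
          DirectSum.of (SingularCochain X) q g +
        (-1 : ℚ) ^ p • (DirectSum.of (SingularCochain X) p f *
          DirectSum.of (SingularCochain X) (q + 1) (coboundary q g))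
      rw [DirectSum.of_mul_of, DirectSum.of_mul_of, DirectSum.toModule_lof]
      have h1 : DirectSum.of (SingularCochain X) (p + 1 + q) (cup (coboundary p f) g) =
          DirectSum.of (SingularCochain X) (p + q + 1) (fun σ => cup (coboundary p f) g
            (restrict (Fin.cast (by omega)) σ)) :=
        DirectSum.of_eq_of_gradedMonoid_eq (mk_eq (by omega) _ _ fun σ => rfl)
      change DirectSum.of (SingularCochain X) (p + q + 1)
        (coboundary (p + q) (cup (p := p) (q := q) f g)) =
        DirectSum.of (SingularCochain X) (p + 1 + q) (cup (coboundary p f) g) +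
        (-1 : ℚ) ^ p • DirectSum.of (SingularCochain X) (p + q + 1)
          (cup (p := p) (q := q + 1) f (coboundary q g))
      rw [h1, ← DirectSum.of_smul, ← map_add]
      congr 1
      funext σ
      exact coboundary_cup_apply f g σ
    | add a b ha hb =>
      rw [mul_add, map_add, map_add, ha, hb, mul_add, mul_add, smul_add]
      abel

end SingularCochains

/-! ### Minimal models and ellipticity -/

namespace MinimalSullivanAlgebra

attribute [instance] linearOrder

/-- The degree `n` part `Vⁿ` of the space `V` of generators (indecomposables). -/
def V (M : MinimalSullivanAlgebra.{u}) (n : ℕ) : Submodule ℚ M.carrier :=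
  Submodule.span ℚ (M.gen '' {i | M.deg i = n})

/-- `(ΛV, d)` is a minimal model of `X`: it is weakly equivalent to the algebra of rational singular
cochains of `X`.  In particular this holds when there is a quasi-isomorphism from `(ΛV, d)` to the
algebra of polynomial forms on `X`, since that algebra is weakly equivalent to the singular
cochains.  For simply connected `X` of finite type, `Vⁿ` is then the dual of `πₙ(X) ⊗ ℚ`. -/
def Models (M : MinimalSullivanAlgebra.{u}) (X : Type u) [TopologicalSpace X] : Prop :=
  M.toCochainAlgebra.WeaklyEquivalent (singularCochainAlgebra X)

/-- Ellipticity: both `V` and `H^*(ΛV, d)` are finite-dimensional. -/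
def IsElliptic (M : MinimalSullivanAlgebra.{u}) : Prop :=
  Finite M.ι ∧ FiniteDimensional ℚ M.totalCohomology

/-- The homotopy Euler characteristic `∑ₙ (-1)ⁿ dim Vⁿ`; for finite-dimensional `V` only finitely
many terms are nonzero. -/
noncomputable def homotopyEulerChar (M : MinimalSullivanAlgebra.{u}) : ℤ :=
  ∑ᶠ n : ℕ, (-1 : ℤ) ^ n * (Module.finrank ℚ (M.V n) : ℤ)

end MinimalSullivanAlgebra

/-! Write `b j` for the dimension of the cohomology in degree `j`. The hypothesis on `d` and `n`
says `4 * d < n`, and the bounds come from three facts.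

Low degrees. Decomposables start in degree `2 * d`, so the generators of degree `d` are cocycles
that survive to cohomology and `b d ≥ k`. As `d` is even, the decomposables of degree `2 * d` are
the symmetric square of `V^d`, of dimension `(k + 1).choose 2`, and they are cocycles. The
differential maps the `l`-dimensional space `V^{2d-1}` into them, so counting ranks gives `b (2d) ≥
(k + 1).choose 2 - l` and `b (2d - 1) ≥ l - (k + 1).choose 2` (`finrank_cohomology_two_mul`).

Poincaré duality. It doubles each of these contributions, and `4 * d < n` keeps the degrees involved
distinct. This settles odd `n`.

Vanishing of the Euler characteristic when odd generators outnumber even ones. Then even and odd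
degrees each carry half of the total, and for even `n` each half is bounded separately
(`sum_betti_bounds`).

Duality is proved by building the algebra from `ℚ`, adjoining generators in order of decreasing
degree. The intermediate algebras are the quotients of `M` by its lowest generators, and the newly
adjoined generator is a cocycle. An odd generator gives a Wang sequence and an even generator `x` a
Gysin sequence; each carries duality one step further (`OddStep.isPoincare`, `EvenStep.isPoincare`).
The even step needs `x` to be nilpotent in the cohomology of the intermediate quotient, which is not
evident from finiteness for `M` alone.

Nilpotence comes from an algebraic form of the mapping theorem for Lusternik-Schnirelmann category.
Above the formal dimension `M` contains an acyclic ideal that absorbs all products of `n + 1`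
elements of the augmentation ideal. The quotient `Q` of `A` by a lowest generator is
quasi-isomorphic to `A` with a further generator `e` adjoined whose differential is the one being
killed, and an explicit multiplicative section `Q → A ⊗ Λe` transports the nilpotence statement from
`A` to `Q` (`EvenStep.hasNilModel`, `OddStep.hasNilModel`). Only parities matter there, hence the
ungraded structure `SuperCDGA`.

For the Euler characteristic, give an even generator its degree as weight and an odd one its degree
plus one. The differential does not lower this weight, and the same induction over generators shows
that the part of weight at least `p` is acyclic for large `p`. So the Euler characteristic is the
signed count of the finitely many monomials of smaller weight. The generating function of the signed
counts is the product of `1 - t ^ w` over the odd generators divided by the same product over the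
even ones. It is a polynomial, and it vanishes at `t = 1` if there are more odd generators
(`ExactAbove.euler_char_eq_zero`). -/

/-! ### Supercommutative differential algebras -/

/-- A supercommutative differential `ℚ`-algebra; the parity is recorded by the involution `ε`, which
is `1` on even and `-1` on odd elements. -/
structure SuperCDGA : Type (u + 1) where
  carrier : Type u
  [ring : Ring carrier]
  [algebra : Algebra ℚ carrier]
  d : carrier →ₗ[ℚ] carrier
  ε : carrier →ₐ[ℚ] carrier
  d_d : ∀ a, d (d a) = 0
  ε_ε : ∀ a, ε (ε a) = a
  d_ε : ∀ a, d (ε a) = -ε (d a)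
  leibniz : ∀ a b, d (a * b) = d a * b + ε a * d b
  even_comm : ∀ a b, ε a = a → a * b = b * a
  odd_comm : ∀ a b, ε a = -a → a * b = ε b * a

namespace SuperCDGA

attribute [instance] SuperCDGA.ring SuperCDGA.algebra
attribute [simp] d_d ε_ε

/-- Algebra maps compatible with the differentials and the parities. -/
structure Hom (A B : SuperCDGA.{u}) where
  toAlgHom : A.carrier →ₐ[ℚ] B.carrier
  map_d : ∀ a, toAlgHom (A.d a) = B.d (toAlgHom a)
  map_ε : ∀ a, toAlgHom (A.ε a) = B.ε (toAlgHom a)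

/-- The mapping cone of `f` is acyclic, i.e. `f` is a quasi-isomorphism. -/
def Hom.ConeAcyclic {A B : SuperCDGA.{u}} (f : Hom A B) : Prop :=
  ∀ c b, A.d c = 0 → f.toAlgHom c = B.d b →
    ∃ c' b', A.d c' = c ∧ f.toAlgHom c' = b + B.d b'

/-- The identity map. -/
def Hom.id (A : SuperCDGA.{u}) : Hom A A := ⟨AlgHom.id ℚ _, fun _ => rfl, fun _ => rfl⟩

/-- The composition of maps. -/
def Hom.comp {A B C : SuperCDGA.{u}} (g : Hom B C) (f : Hom A B) : Hom A C where
  toAlgHom := g.toAlgHom.comp f.toAlgHom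
  map_d a := by simp [f.map_d, g.map_d]
  map_ε a := by simp [f.map_ε, g.map_ε]

theorem Hom.coneAcyclic_id (A : SuperCDGA.{u}) : (Hom.id A).ConeAcyclic := by
  intro c b _ hcb
  exact ⟨b, 0, hcb.symm, by simp [Hom.id]⟩

theorem Hom.ConeAcyclic.comp {A B C : SuperCDGA.{u}} {g : Hom B C} {f : Hom A B}
    (hg : g.ConeAcyclic) (hf : f.ConeAcyclic) : (g.comp f).ConeAcyclic := by
  intro c b hc hcb
  obtain ⟨b₁, b₂, h₁, h₂⟩ := hg (f.toAlgHom c) b (by rw [← f.map_d, hc, map_zero]) hcb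
  obtain ⟨c₁, b₃, h₃, h₄⟩ := hf c b₁ hc h₁.symm
  refine ⟨c₁, b₂ + g.toAlgHom b₃, h₃, ?_⟩
  change g.toAlgHom (f.toAlgHom c₁) = _
  rw [h₄, map_add, h₂, map_add, g.map_d, add_assoc]

/-- The injectivity half of being a quasi-isomorphism. -/
theorem exact_of_map_exact {A B : SuperCDGA.{u}} {f : Hom A B} (hf : f.ConeAcyclic) {a : A.carrier}
    (ha : A.d a = 0) (h : f.toAlgHom a ∈ LinearMap.range B.d) : a ∈ LinearMap.range A.d := by
  obtain ⟨b, hb⟩ := h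
  obtain ⟨c, _, hc, _⟩ := hf a b ha hb.symm
  exact ⟨c, hc⟩

/-! ### Adjoining an even generator -/

section Coefficientwise

open Polynomial

variable {R S : Type u} [Ring R] [Ring S] [Algebra ℚ R] [Algebra ℚ S]

/-- The application of a linear map to the coefficients of a polynomial. -/
noncomputable def coeffMap (f : R →ₗ[ℚ] S) : R[X] →ₗ[ℚ] S[X] where
  toFun P := P.sum fun k b => monomial k (f b)
  map_add' P Q := by
    refine sum_add_index _ _ _ (fun i => by simp) (fun i a b => by simp)
  map_smul' c P := by
    ext k
    rw [sum_def, sum_def]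
    simp only [RingHom.id_apply, coeff_smul, finsetSum_coeff, coeff_monomial]
    simp only [Finset.sum_ite_eq', mem_support_iff, ne_eq, coeff_smul, map_smul]
    split_ifs with h1 h2 h2 <;> simp_all

@[simp]
theorem coeff_coeffMap (f : R →ₗ[ℚ] S) (P : R[X]) (k : ℕ) :
    (coeffMap f P).coeff k = f (P.coeff k) := by
  change (P.sum fun k b => monomial k (f b)).coeff k = _
  rw [sum_def]
  simp only [finsetSum_coeff, coeff_monomial, Finset.sum_ite_eq', mem_support_iff, ne_eq]
  split_ifs with h <;> simp_all

theorem coeff_derivative_smul (P : R[X]) (k : ℕ) :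
    (derivative P).coeff k = ((k : ℚ) + 1) • P.coeff (k + 1) := by
  rw [coeff_derivative, Algebra.smul_def, Algebra.commutes]
  simp

/-- The shape of `H` covers both the `ε`-twisted Leibniz rule of `d` and the ordinary one of the
derivation `θ` below. -/
theorem coeffMap_mul {f g h : R →ₗ[ℚ] S} {i j : R →ₗ[ℚ] S}
    (H : ∀ a b, f (a * b) = g a * h b + i a * j b) (P Q : R[X]) :
    coeffMap f (P * Q) = coeffMap g P * coeffMap h Q + coeffMap i P * coeffMap j Q := by
  ext k
  simp only [coeff_coeffMap, coeff_mul, coeff_add, map_sum, H, Finset.sum_add_distrib]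

theorem coeffMap_id (P : R[X]) : coeffMap LinearMap.id P = P := by
  ext k; simp

end Coefficientwise

section AdjoinEven

open Polynomial

variable (B : SuperCDGA.{u}) (y : B.carrier) (hd : B.d y = 0) (hε : B.ε y = -y)

include hε in
theorem odd_mul_self : y * y = 0 := by
  have h := B.odd_comm y y hε
  rw [hε, neg_mul, eq_neg_iff_add_eq_zero, ← two_smul ℚ (y * y)] at h
  simpa using h

/-- The differential of `B[e]`, where `e` is even and `d e = y`. -/
noncomputable def polyD : B.carrier[X] →ₗ[ℚ] B.carrier[X] :=
  coeffMap B.d +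
    coeffMap (LinearMap.mulRight ℚ y ∘ₗ B.ε.toLinearMap) ∘ₗ (derivative.restrictScalars ℚ)

@[simp]
theorem coeff_polyD (P : B.carrier[X]) (k : ℕ) :
    (polyD B y P).coeff k =
      B.d (P.coeff k) + ((k : ℚ) + 1) • (B.ε (P.coeff (k + 1)) * y) := by
  simp [polyD, coeff_derivative_smul]

-- The mixed terms cancel because `d` anticommutes with `ε`, and the second order term contains `y *
-- y = 0`.
include hd hε in
theorem polyD_polyD (P : B.carrier[X]) : polyD B y (polyD B y P) = 0 := by
  ext k
  simp [B.leibniz, hd, B.d_ε, hε, add_mul, mul_assoc, odd_mul_self B y hε]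

/-- `B[e]` with `e` even and `d e = y`. -/
noncomputable def adjoinEven : SuperCDGA.{u} where
  carrier := B.carrier[X]
  d := polyD B y
  ε := mapAlgHom B.ε
  d_d := polyD_polyD B y hd hε
  ε_ε := by
    intro P
    ext k
    simp
  d_ε := by
    intro P
    ext k
    simp [B.d_ε, hε]
    abel
  leibniz := by
    intro P Q
    have h1 : coeffMap B.d (P * Q) =
        coeffMap B.d P * Q + coeffMap B.ε.toLinearMap P * coeffMap B.d Q := by
      have := coeffMap_mul (f := B.d) (g := B.d) (h := LinearMap.id) (i := B.ε.toLinearMap)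
        (j := B.d) B.leibniz P Q
      rwa [coeffMap_id] at this
    have h2 : ∀ P Q : B.carrier[X], coeffMap (LinearMap.mulRight ℚ y ∘ₗ B.ε.toLinearMap) (P * Q) =
        coeffMap (LinearMap.mulRight ℚ y ∘ₗ B.ε.toLinearMap) P * Q := by
      intro P Q
      ext k
      simp only [coeff_coeffMap, coeff_mul, map_sum]
      refine Finset.sum_congr rfl fun x _ => ?_
      simp [mul_assoc, B.odd_comm y _ hε]
    have h3 : ∀ P Q : B.carrier[X], coeffMap (LinearMap.mulRight ℚ y ∘ₗ B.ε.toLinearMap) (P * Q) =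
        coeffMap B.ε.toLinearMap P *
          coeffMap (LinearMap.mulRight ℚ y ∘ₗ B.ε.toLinearMap) Q := by
      intro P Q
      ext k
      simp only [coeff_coeffMap, coeff_mul, map_sum]
      refine Finset.sum_congr rfl fun x _ => ?_
      simp [mul_assoc]
    have h4 : mapAlgHom B.ε P = coeffMap B.ε.toLinearMap P := by ext k; simp
    rw [h4]
    simp only [polyD, LinearMap.add_apply, LinearMap.comp_apply, LinearMap.restrictScalars_apply,
      derivative_mul, map_add, h1, h2 (derivative P), h3 P, add_mul, mul_add]
    abel
  even_comm := by
    intro P Q h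
    ext k
    have h' : ∀ k, B.ε (P.coeff k) = P.coeff k := fun k => by
      have := congrArg (fun R => R.coeff k) h
      simpa using this
    rw [coeff_mul, coeff_mul, ← Finset.Nat.sum_antidiagonal_swap]
    exact Finset.sum_congr rfl fun x _ => B.even_comm _ _ (h' _)
  odd_comm := by
    intro P Q h
    ext k
    have h' : ∀ k, B.ε (P.coeff k) = -P.coeff k := fun k => by
      have := congrArg (fun R => R.coeff k) h
      simpa using this
    rw [coeff_mul, coeff_mul, ← Finset.Nat.sum_antidiagonal_swap]
    refine Finset.sum_congr rfl fun x _ => ?_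
    simpa using B.odd_comm _ _ (h' _)

/-- The extension of `f : A → B` to `A[e] → B[e]`. -/
noncomputable def Hom.adjoinEven {A B : SuperCDGA.{u}} (f : Hom A B) (y : A.carrier) (hd : A.d y = 0)
    (hε : A.ε y = -y) (hd' : B.d (f.toAlgHom y) = 0)
    (hε' : B.ε (f.toAlgHom y) = -f.toAlgHom y) :
    Hom (A.adjoinEven y hd hε) (B.adjoinEven (f.toAlgHom y) hd' hε') where
  toAlgHom := mapAlgHom f.toAlgHom
  map_d := by
    intro (P : A.carrier[X])
    change Polynomial.mapAlgHom f.toAlgHom (polyD A y P) =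
      polyD B _ (Polynomial.mapAlgHom f.toAlgHom P)
    ext k
    simp [f.map_d, f.map_ε]
  map_ε := by
    intro (P : A.carrier[X])
    change Polynomial.mapAlgHom f.toAlgHom (Polynomial.mapAlgHom A.ε P) =
      Polynomial.mapAlgHom B.ε (Polynomial.mapAlgHom f.toAlgHom P)
    ext k
    simp [f.map_ε]

/-- Induction on the degree in `e`. The part of the differential coming from `d e = y` lowers this
degree, so the leading coefficients of a cone cocycle form a cocycle in the cone of `f`. Bounding it
there and subtracting lowers the degree. -/
theorem Hom.ConeAcyclic.adjoinEven {A B : SuperCDGA.{u}} {f : Hom A B} (hf : f.ConeAcyclic)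
    (y : A.carrier) (hd : A.d y = 0)
    (hε : A.ε y = -y) (hd' : B.d (f.toAlgHom y) = 0)
    (hε' : B.ε (f.toAlgHom y) = -f.toAlgHom y) :
    (f.adjoinEven y hd hε hd' hε').ConeAcyclic := by
  have hcomm : ∀ P : A.carrier[X], Polynomial.mapAlgHom f.toAlgHom (polyD A y P) =
      polyD B (f.toAlgHom y) (Polynomial.mapAlgHom f.toAlgHom P) :=
    (f.adjoinEven y hd hε hd' hε').map_d
  have key : ∀ (n : ℕ) (P : A.carrier[X]) (Q : B.carrier[X]),
      (∀ k, n ≤ k → P.coeff k = 0) → (∀ k, n ≤ k → Q.coeff k = 0) →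
      polyD A y P = 0 → Polynomial.mapAlgHom f.toAlgHom P = polyD B (f.toAlgHom y) Q →
      ∃ (P' : A.carrier[X]) (Q' : B.carrier[X]), polyD A y P' = P ∧
        Polynomial.mapAlgHom f.toAlgHom P' = Q + polyD B (f.toAlgHom y) Q' := by
    intro n
    induction n with
    | zero =>
      intro P Q hP hQ _ _
      have hP0 : P = 0 := Polynomial.ext fun k => hP k (Nat.zero_le k)
      have hQ0 : Q = 0 := Polynomial.ext fun k => hQ k (Nat.zero_le k)
      subst hP0 hQ0
      exact ⟨0, 0, by simp, by simp⟩
    | succ n ih =>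
      intro P Q hP hQ hdP hPQ
      have h1 : A.d (P.coeff n) = 0 := by
        have := congrArg (fun R => R.coeff n) hdP
        simpa [hP (n + 1) le_rfl] using this
      have h2 : f.toAlgHom (P.coeff n) = B.d (Q.coeff n) := by
        have := congrArg (fun R => R.coeff n) hPQ
        simpa [hQ (n + 1) le_rfl] using this
      obtain ⟨a, b, ha, hb⟩ := hf _ _ h1 h2
      obtain ⟨P', Q', hP', hQ'⟩ := ih (P - polyD A y (monomial n a))
        (Q - (Polynomial.mapAlgHom f.toAlgHom (monomial n a) -
          polyD B (f.toAlgHom y) (monomial n b)))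
        (by
          intro k hk
          rw [coeff_sub, coeff_polyD, coeff_monomial, coeff_monomial,
            if_neg (show n ≠ k + 1 by omega)]
          rcases eq_or_lt_of_le hk with rfl | hk
          · simp [ha]
          · simp [hP k hk, hk.ne])
        (by
          intro k hk
          rw [coeff_sub, coeff_sub, coeff_polyD, coeff_monomial, coeff_monomial,
            if_neg (show n ≠ k + 1 by omega), coe_mapAlgHom, coeff_map, coeff_monomial]
          rcases eq_or_lt_of_le hk with rfl | hk
          · simp [hb]
          · simp [hQ k hk, hk.ne])
        (by rw [map_sub, hdP, polyD_polyD A y hd hε, sub_zero])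
        (by
          rw [map_sub, hPQ, hcomm, map_sub, map_sub, polyD_polyD B _ hd' hε', sub_zero])
      refine ⟨P' + monomial n a, Q' + monomial n b, ?_, ?_⟩
      · rw [map_add, hP', sub_add_cancel]
      · rw [map_add, hQ', map_add]
        abel
  intro P Q hdP hPQ
  exact key (max (P : A.carrier[X]).natDegree (Q : B.carrier[X]).natDegree + 1) P Q
    (fun k hk => coeff_eq_zero_of_natDegree_lt (by omega))
    (fun k hk => coeff_eq_zero_of_natDegree_lt (by omega)) hdP hPQ

end AdjoinEven

end SuperCDGA
namespace SuperCDGA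

/-! ### Adjoining an odd generator -/

/-- The underlying space of `B ⊕ Be`, where `e` is odd. -/
structure OddExt (B : SuperCDGA.{u}) : Type u where
  fst : B.carrier
  snd : B.carrier

namespace OddExt

variable {B : SuperCDGA.{u}}

@[ext]
theorem ext' {a b : OddExt B} (h₁ : a.fst = b.fst) (h₂ : a.snd = b.snd) : a = b := by
  cases a; cases b; simp_all

instance : Zero (OddExt B) := ⟨⟨0, 0⟩⟩
instance : One (OddExt B) := ⟨⟨1, 0⟩⟩
instance : Add (OddExt B) := ⟨fun a b => ⟨a.fst + b.fst, a.snd + b.snd⟩⟩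
instance : Neg (OddExt B) := ⟨fun a => ⟨-a.fst, -a.snd⟩⟩
instance : Sub (OddExt B) := ⟨fun a b => ⟨a.fst - b.fst, a.snd - b.snd⟩⟩
instance : SMul ℕ (OddExt B) := ⟨fun c a => ⟨c • a.fst, c • a.snd⟩⟩
instance : SMul ℤ (OddExt B) := ⟨fun c a => ⟨c • a.fst, c • a.snd⟩⟩
instance : SMul ℚ (OddExt B) := ⟨fun c a => ⟨c • a.fst, c • a.snd⟩⟩
-- The pair `⟨a₀, a₁⟩` stands for `a₀ + a₁ e`, with `e * b = ε b * e` and `e * e = 0`.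
instance : Mul (OddExt B) :=
  ⟨fun a b => ⟨a.fst * b.fst, a.fst * b.snd + a.snd * B.ε b.fst⟩⟩

@[simp] theorem fst_zero : (0 : OddExt B).fst = 0 := rfl
@[simp] theorem snd_zero : (0 : OddExt B).snd = 0 := rfl
@[simp] theorem fst_one : (1 : OddExt B).fst = 1 := rfl
@[simp] theorem snd_one : (1 : OddExt B).snd = 0 := rfl
@[simp] theorem fst_add (a b : OddExt B) : (a + b).fst = a.fst + b.fst := rfl
@[simp] theorem snd_add (a b : OddExt B) : (a + b).snd = a.snd + b.snd := rfl
@[simp] theorem fst_neg (a : OddExt B) : (-a).fst = -a.fst := rfl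
@[simp] theorem snd_neg (a : OddExt B) : (-a).snd = -a.snd := rfl
@[simp] theorem fst_sub (a b : OddExt B) : (a - b).fst = a.fst - b.fst := rfl
@[simp] theorem snd_sub (a b : OddExt B) : (a - b).snd = a.snd - b.snd := rfl
@[simp] theorem fst_smul (c : ℚ) (a : OddExt B) : (c • a).fst = c • a.fst := rfl
@[simp] theorem snd_smul (c : ℚ) (a : OddExt B) : (c • a).snd = c • a.snd := rfl
@[simp] theorem fst_mul (a b : OddExt B) : (a * b).fst = a.fst * b.fst := rfl
@[simp] theorem snd_mul (a b : OddExt B) : (a * b).snd = a.fst * b.snd + a.snd * B.ε b.fst := rfl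

/-- The two coordinates. -/
def toProd (a : OddExt B) : B.carrier × B.carrier := (a.fst, a.snd)

theorem toProd_injective : Function.Injective (toProd (B := B)) := by
  intro a b h
  exact ext' (congrArg Prod.fst h) (congrArg Prod.snd h)

instance : AddCommGroup (OddExt B) :=
  toProd_injective.addCommGroup _ rfl (fun _ _ => rfl) (fun _ => rfl) (fun _ _ => rfl)
    (fun _ _ => rfl) (fun _ _ => rfl)

instance : Ring (OddExt B) :=
  { (inferInstance : AddCommGroup (OddExt B)) with
    mul := (· * ·)
    one := 1
    left_distrib := fun a b c => by ext <;> simp [mul_add]; abel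
    right_distrib := fun a b c => by ext <;> simp [add_mul]; abel
    zero_mul := fun a => by ext <;> simp
    mul_zero := fun a => by ext <;> simp
    mul_assoc := fun a b c => by ext <;> simp [mul_add, add_mul, mul_assoc, add_assoc]
    one_mul := fun a => by ext <;> simp
    mul_one := fun a => by ext <;> simp }

instance : Module ℚ (OddExt B) :=
  toProd_injective.module ℚ ⟨⟨toProd, rfl⟩, fun _ _ => rfl⟩ (fun _ _ => rfl)

instance : Algebra ℚ (OddExt B) :=
  Algebra.ofModule (fun r a b => by ext <;> simp) (fun r a b => by ext <;> simp)

end OddExt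

variable (B : SuperCDGA.{u}) (x : B.carrier) (hd : B.d x = 0) (hε : B.ε x = x)

/-- `B ⊕ Be` with `e` odd and `d e = x`. -/
def adjoinOdd : SuperCDGA.{u} where
  carrier := OddExt B
  d :=
    -- The coefficient stands to the left of `e`, so `d (a₁ e) = d a₁ e + ε a₁ * x`.
    { toFun := fun a => ⟨B.d a.fst + B.ε a.snd * x, B.d a.snd⟩
      map_add' := fun a b => by ext <;> simp [add_mul]; abel
      map_smul' := fun c a => by ext <;> simp }
  ε := AlgHom.ofLinearMap
    { toFun := fun a => ⟨B.ε a.fst, -B.ε a.snd⟩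
      map_add' := fun a b => by ext <;> simp; abel
      map_smul' := fun c a => by ext <;> simp }
    (by ext <;> simp) (fun a b => by ext <;> simp; abel)
  d_d a := by ext <;> simp [B.leibniz, hd, B.d_ε]
  ε_ε a := by ext <;> simp
  d_ε a := by
    ext
    · simp [B.d_ε, hε]; abel
    · simp [B.d_ε]
  leibniz a b := by
    have hx : ∀ c, x * c = c * x := fun c => B.even_comm x c hε
    ext
    · simp [B.leibniz, add_mul, mul_add, mul_assoc, hx]
      abel
    · simp [B.leibniz, add_mul, mul_add, B.d_ε, mul_assoc, hx, hε]
      abel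
  even_comm a b h := by
    have h1 : B.ε a.fst = a.fst := congrArg OddExt.fst h
    have h2 : B.ε a.snd = -a.snd := by
      have : -B.ε a.snd = a.snd := congrArg OddExt.snd h
      rw [← this, map_neg, B.ε_ε, this]
    ext
    · exact B.even_comm _ _ h1
    · simp only [OddExt.snd_mul, h1, B.odd_comm _ _ h2, B.ε_ε, B.even_comm _ _ h1]
      abel
  odd_comm a b h := by
    have h1 : B.ε a.fst = -a.fst := congrArg OddExt.fst h
    have h2 : B.ε a.snd = a.snd := by
      have : -B.ε a.snd = -a.snd := congrArg OddExt.snd h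
      exact neg_injective this
    ext
    · exact B.odd_comm _ _ h1
    · simp [h1, B.odd_comm _ _ h1, B.even_comm _ _ h2]
      abel

variable {B x hd hε}

@[simp] theorem adjoinOdd_d_fst (a : OddExt B) :
    ((adjoinOdd B x hd hε).d a : OddExt B).fst = B.d a.fst + B.ε a.snd * x := rfl
@[simp] theorem adjoinOdd_d_snd (a : OddExt B) :
    ((adjoinOdd B x hd hε).d a : OddExt B).snd = B.d a.snd := rfl
@[simp] theorem adjoinOdd_ε_fst (a : OddExt B) :
    ((adjoinOdd B x hd hε).ε a : OddExt B).fst = B.ε a.fst := rfl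
@[simp] theorem adjoinOdd_ε_snd (a : OddExt B) :
    ((adjoinOdd B x hd hε).ε a : OddExt B).snd = -B.ε a.snd := rfl

/-- The application of `f` to both coordinates. -/
def OddExt.map {A B : SuperCDGA.{u}} (f : Hom A B) : OddExt A →ₐ[ℚ] OddExt B :=
  AlgHom.ofLinearMap
    { toFun := fun a => ⟨f.toAlgHom a.fst, f.toAlgHom a.snd⟩
      map_add' := fun a b => by ext <;> simp
      map_smul' := fun c a => by ext <;> simp }
    (by ext <;> simp) (fun a b => by ext <;> simp [f.map_ε])

/-- The extension of `f : A → B` to `A ⊕ Ae → B ⊕ Be`. -/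
def Hom.adjoinOdd {A B : SuperCDGA.{u}} (f : Hom A B) (x : A.carrier) (hd : A.d x = 0)
    (hε : A.ε x = x) (hd' : B.d (f.toAlgHom x) = 0) (hε' : B.ε (f.toAlgHom x) = f.toAlgHom x) :
    Hom (A.adjoinOdd x hd hε) (B.adjoinOdd (f.toAlgHom x) hd' hε') where
  toAlgHom := OddExt.map f
  map_d a := by
    refine OddExt.ext' ?_ (f.map_d _)
    change f.toAlgHom (A.d _ + A.ε _ * x) = B.d (f.toAlgHom _) + B.ε (f.toAlgHom _) * _
    simp [f.map_d, f.map_ε]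
  map_ε a := by
    refine OddExt.ext' (f.map_ε _) ?_
    change f.toAlgHom (-A.ε _) = -B.ε (f.toAlgHom _)
    rw [map_neg, f.map_ε]

/-- The same argument with a filtration of length two: the coefficients of `e` are bounded first,
and their contribution through `d e = x` is subtracted before the constant terms are treated. -/
theorem Hom.ConeAcyclic.adjoinOdd {A B : SuperCDGA.{u}} {f : Hom A B} (hf : f.ConeAcyclic)
    (x : A.carrier) (hd : A.d x = 0) (hε : A.ε x = x) (hd' : B.d (f.toAlgHom x) = 0)
    (hε' : B.ε (f.toAlgHom x) = f.toAlgHom x) :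
    (f.adjoinOdd x hd hε hd' hε').ConeAcyclic := by
  rintro ⟨c₀, c₁⟩ ⟨b₀, b₁⟩ hc hcb
  have hc0 : A.d c₀ + A.ε c₁ * x = 0 := congrArg OddExt.fst hc
  have hc1 : A.d c₁ = 0 := congrArg OddExt.snd hc
  have hcb0 : f.toAlgHom c₀ = B.d b₀ + B.ε b₁ * f.toAlgHom x := congrArg OddExt.fst hcb
  have hcb1 : f.toAlgHom c₁ = B.d b₁ := congrArg OddExt.snd hcb
  obtain ⟨a₁, β₁, h1, h2⟩ := hf c₁ b₁ hc1 hcb1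
  obtain ⟨a₀, β₀, h3, h4⟩ := hf (c₀ - A.ε a₁ * x) (b₀ + B.ε β₁ * f.toAlgHom x)
    (by
      simp only [map_sub, A.leibniz, A.d_ε, hd, mul_zero, add_zero, h1, neg_mul, sub_neg_eq_add]
      exact hc0)
    (by
      simp only [map_sub, map_mul, B.leibniz, B.d_ε, hd', f.map_ε, h2, hcb0, map_add, add_mul,
        mul_zero, add_zero, neg_mul]
      abel)
  refine ⟨(⟨a₀, a₁⟩ : OddExt A), (⟨β₀, β₁⟩ : OddExt B), ?_, ?_⟩
  · refine OddExt.ext' ?_ h1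
    change A.d a₀ + A.ε a₁ * x = c₀
    rw [h3]; abel
  · refine OddExt.ext' ?_ h2
    change f.toAlgHom a₀ = b₀ + (B.d β₀ + B.ε β₁ * f.toAlgHom x)
    rw [h4]; abel

end SuperCDGA
namespace SuperCDGA

/-! ### Killing the lowest generator -/

/-- `A = Q[x]` as an algebra, where `x` is an even cocycle and `A → Q` is the quotient by `x`. -/
structure EvenStep (A Q : SuperCDGA.{u}) where
  -- The section `σ` is multiplicative but need not commute with the differentials. `γ` divides the
  -- part divisible by `x` by `x`.
  σ : Q.carrier →ₐ[ℚ] A.carrier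
  ρ : Hom A Q
  x : A.carrier
  γ : A.carrier →ₗ[ℚ] A.carrier
  d_x : A.d x = 0
  ε_x : A.ε x = x
  ρ_σ : ∀ q, ρ.toAlgHom (σ q) = q
  ρ_x : ρ.toAlgHom x = 0
  σ_ε : ∀ q, σ (Q.ε q) = A.ε (σ q)
  γ_σ : ∀ q, γ (σ q) = 0
  γ_x : ∀ a, γ (x * a) = a
  decomp : ∀ a, σ (ρ.toAlgHom a) + x * γ a = a

/-- `A = Q ⊕ yQ` as an algebra, where `y` is an odd cocycle and `A → Q` is the quotient by `y`. -/
structure OddStep (A Q : SuperCDGA.{u}) where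
  σ : Q.carrier →ₐ[ℚ] A.carrier
  ρ : Hom A Q
  y : A.carrier
  γ : A.carrier →ₗ[ℚ] Q.carrier
  d_y : A.d y = 0
  ε_y : A.ε y = -y
  ρ_σ : ∀ q, ρ.toAlgHom (σ q) = q
  ρ_y : ρ.toAlgHom y = 0
  σ_ε : ∀ q, σ (Q.ε q) = A.ε (σ q)
  γ_σ : ∀ q, γ (σ q) = 0
  γ_y : ∀ q, γ (y * σ q) = q
  decomp : ∀ a, σ (ρ.toAlgHom a) + y * σ (γ a) = a

/-! ### Even generators: the multiplicative section into `A ⊕ Ae` -/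

namespace EvenStep

variable {A Q : SuperCDGA.{u}} (S : EvenStep A Q)

theorem mul_x (a : A.carrier) : a * S.x = S.x * a := (A.even_comm _ _ S.ε_x).symm

theorem x_injective {a b : A.carrier} (h : S.x * a = S.x * b) : a = b := by
  rw [← S.γ_x a, h, S.γ_x]

theorem exists_of_ρ_eq_zero {a : A.carrier} (h : S.ρ.toAlgHom a = 0) : a = S.x * S.γ a := by
  have := S.decomp a
  rw [h, map_zero, zero_add] at this
  exact this.symm

/-- The part of the differential divisible by `x`. -/
def κ : Q.carrier →ₗ[ℚ] A.carrier := S.γ ∘ₗ A.d ∘ₗ S.σ.toLinearMap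

theorem d_σ (q : Q.carrier) : A.d (S.σ q) = S.σ (Q.d q) + S.x * S.κ q := by
  conv_lhs => rw [← S.decomp (A.d (S.σ q)), S.ρ.map_d, S.ρ_σ]
  rfl

theorem d_x_mul (a : A.carrier) : A.d (S.x * a) = S.x * A.d a := by
  rw [A.leibniz, S.d_x, zero_mul, zero_add, S.ε_x]

theorem σ_add_x_inj {q q' : Q.carrier} {a a' : A.carrier}
    (h : S.σ q + S.x * a = S.σ q' + S.x * a') : q = q' ∧ a = a' := by
  have h1 := congrArg S.γ h
  have h2 := congrArg S.ρ.toAlgHom h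
  simp only [map_add, S.γ_σ, S.γ_x, zero_add] at h1
  simp only [map_add, map_mul, S.ρ_σ, S.ρ_x, zero_mul, add_zero] at h2
  exact ⟨h2, h1⟩

/-- The identities for `κ` here and below are the `x`-coefficients of `d ∘ d = 0`, of `d ∘ ε = -ε ∘
d` and of the Leibniz rule on the image of `σ`; `x` can be cancelled. -/
theorem d_κ (q : Q.carrier) : A.d (S.κ q) = -S.κ (Q.d q) := by
  have h : A.d (A.d (S.σ q)) = 0 := A.d_d _
  rw [S.d_σ, map_add, S.d_σ, S.d_x_mul, Q.d_d, map_zero, zero_add, ← mul_add] at h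
  rw [← mul_zero S.x] at h
  exact eq_neg_of_add_eq_zero_right (S.x_injective h)

theorem κ_ε (q : Q.carrier) : S.κ (Q.ε q) = -A.ε (S.κ q) := by
  have h : A.d (S.σ (Q.ε q)) = -A.ε (A.d (S.σ q)) := by rw [S.σ_ε, A.d_ε]
  rw [S.d_σ, S.d_σ] at h
  refine (S.σ_add_x_inj (q' := Q.d (Q.ε q)) (h.trans ?_)).2
  simp only [Q.d_ε, map_add, map_mul, S.ε_x, S.σ_ε, map_neg, mul_neg, neg_add]

theorem κ_mul (q q' : Q.carrier) :
    S.κ (q * q') = S.κ q * S.σ q' + S.σ (Q.ε q) * S.κ q' := by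
  have h : A.d (S.σ (q * q')) = A.d (S.σ q) * S.σ q' + A.ε (S.σ q) * A.d (S.σ q') := by
    rw [map_mul, A.leibniz]
  rw [S.d_σ, S.d_σ, S.d_σ, Q.leibniz, add_mul, mul_add, ← S.σ_ε, mul_assoc,
    ← mul_assoc (S.σ (Q.ε q)), S.mul_x, mul_assoc] at h
  refine (S.σ_add_x_inj (q' := Q.d q * q' + Q.ε q * Q.d q') (h.trans ?_)).2
  simp only [map_add, map_mul, mul_add]
  abel

/-- The multiplicative section of the quasi-isomorphism `A ⊕ Ae → Q`. -/
def sec : Hom Q (A.adjoinOdd S.x S.d_x S.ε_x) where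
  toAlgHom := AlgHom.ofLinearMap
    -- The coefficient of `e` is forced: its contribution `-κ q * x` to the differential cancels the
    -- defect `x * κ q` of `σ`.
    { toFun := fun q => (⟨S.σ q, -A.ε (S.κ q)⟩ : OddExt A)
      map_add' := fun a b => by
        refine OddExt.ext' (map_add _ _ _) ?_
        change -A.ε (S.κ (a + b)) = -A.ε (S.κ a) + -A.ε (S.κ b)
        rw [map_add, map_add, neg_add]
      map_smul' := fun c a => by
        refine OddExt.ext' (map_smul _ _ _) ?_
        change -A.ε (S.κ (c • a)) = c • -A.ε (S.κ a)
        rw [map_smul, map_smul, smul_neg] }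
    (by
      have h : S.κ 1 = 0 := by
        have := S.κ_mul 1 1
        simpa using this
      refine OddExt.ext' (map_one _) ?_
      change -A.ε (S.κ 1) = 0
      rw [h, map_zero, neg_zero])
    (fun a b => by
      refine OddExt.ext' (map_mul _ _ _) ?_
      change -A.ε (S.κ (a * b)) = S.σ a * -A.ε (S.κ b) + -A.ε (S.κ a) * A.ε (S.σ b)
      rw [S.κ_mul, map_add, map_mul, map_mul, S.σ_ε, A.ε_ε, neg_add, mul_neg, neg_mul, add_comm])
  map_d q := by
    refine OddExt.ext' ?_ ?_
    · change S.σ (Q.d q) = A.d (S.σ q) + A.ε (-A.ε (S.κ q)) * S.x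
      rw [map_neg, A.ε_ε, S.d_σ, neg_mul, S.mul_x, add_neg_cancel_right]
    · change -A.ε (S.κ (Q.d q)) = A.d (-A.ε (S.κ q))
      rw [map_neg, A.d_ε, S.d_κ, map_neg, neg_neg]
  map_ε q := by
    refine OddExt.ext' (S.σ_ε q) ?_
    change -A.ε (S.κ (Q.ε q)) = -A.ε (-A.ε (S.κ q))
    rw [S.κ_ε]

/-- Reducing the cocycle condition modulo `x` shows that `p = ρ a` bounds `q`. Its `x`-coefficient
then determines `c`, so `sec p` and `⟨a, c⟩` differ by the boundary of a multiple of `e`, which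
absorbs the part `x * γ a` of `a`. -/
theorem sec_coneAcyclic : S.sec.ConeAcyclic := by
  rintro q ⟨a, c⟩ hq hac
  have h0 : S.σ q = A.d a + A.ε c * S.x := congrArg OddExt.fst hac
  have h1 : -A.ε (S.κ q) = A.d c := congrArg OddExt.snd hac
  set p := S.ρ.toAlgHom a with hp
  have hdp : Q.d p = q := by
    rw [← S.ρ_σ q, h0, map_add, map_mul, S.ρ_x, mul_zero, add_zero, S.ρ.map_d]
  have ha : a = S.σ p + S.x * S.γ a := (S.decomp a).symm
  have h2 : A.ε c = -(S.κ p + A.d (S.γ a)) := by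
    have h3 := h0
    rw [ha, map_add, S.d_σ, S.d_x_mul, hdp, S.mul_x, add_assoc, add_assoc, left_eq_add,
      ← mul_add, ← mul_add, ← mul_zero S.x] at h3
    have h4 := S.x_injective h3
    rw [← add_assoc] at h4
    exact eq_neg_of_add_eq_zero_right h4
  refine ⟨p, (⟨0, -A.ε (S.γ a)⟩ : OddExt A), hdp, ?_⟩
  refine OddExt.ext' ?_ ?_
  · change S.σ p = a + (A.d 0 + A.ε (-A.ε (S.γ a)) * S.x)
    rw [map_neg, A.ε_ε, map_zero, zero_add, neg_mul, S.mul_x]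
    exact eq_add_neg_of_add_eq (S.decomp a)
  · change -A.ε (S.κ p) = c + A.d (-A.ε (S.γ a))
    rw [← A.ε_ε c, h2, map_neg A.d, A.d_ε, neg_neg, ← map_add, ← map_neg]
    congr 1
    abel

end EvenStep

/-! ### Odd generators: the multiplicative section `exp (-eθ)` into `A[e]` -/

namespace OddStep

open Polynomial

variable {A Q : SuperCDGA.{u}} (S : OddStep A Q)

theorem y_mul (a : A.carrier) : S.y * a = A.ε a * S.y := A.odd_comm _ _ S.ε_y

theorem y_y : S.y * S.y = 0 := odd_mul_self A S.y S.ε_y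

/-- The derivation `θ` of `Q` with `d = d_Q + yθ` on `Q ⊆ A`. -/
def θ : Q.carrier →ₗ[ℚ] Q.carrier := S.γ ∘ₗ A.d ∘ₗ S.σ.toLinearMap

theorem d_σ (q : Q.carrier) : A.d (S.σ q) = S.σ (Q.d q) + S.y * S.σ (S.θ q) := by
  conv_lhs => rw [← S.decomp (A.d (S.σ q)), S.ρ.map_d, S.ρ_σ]
  rfl

theorem d_y_mul (a : A.carrier) : A.d (S.y * a) = -(S.y * A.d a) := by
  rw [A.leibniz, S.d_y, zero_mul, zero_add, S.ε_y, neg_mul]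

theorem σ_add_y_inj {q q' p p' : Q.carrier}
    (h : S.σ q + S.y * S.σ p = S.σ q' + S.y * S.σ p') : q = q' ∧ p = p' := by
  have h1 := congrArg S.γ h
  have h2 := congrArg S.ρ.toAlgHom h
  simp only [map_add, S.γ_σ, S.γ_y, zero_add] at h1
  simp only [map_add, map_mul, S.ρ_σ, S.ρ_y, zero_mul, add_zero] at h2
  exact ⟨h2, h1⟩

theorem d_y_σ (q : Q.carrier) : A.d (S.y * S.σ q) = -(S.y * S.σ (Q.d q)) := by
  rw [S.d_y_mul, S.d_σ, mul_add, ← mul_assoc S.y S.y, S.y_y, zero_mul, add_zero]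

/-- Again a comparison of coefficients, now of `y`. Since `y` is odd, moving it to the front absorbs
the signs, and `θ` is an ordinary derivation commuting with `d` and `ε`. -/
theorem θ_d (q : Q.carrier) : S.θ (Q.d q) = Q.d (S.θ q) := by
  have h : A.d (A.d (S.σ q)) = 0 := A.d_d _
  rw [S.d_σ, map_add, S.d_σ, S.d_y_σ, Q.d_d, ← mul_neg, ← map_neg, add_assoc, ← mul_add,
    ← map_add, show (0 : A.carrier) = S.σ 0 + S.y * S.σ 0 by simp] at h
  have := (S.σ_add_y_inj h).2
  rwa [add_neg_eq_zero] at this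

theorem θ_ε (q : Q.carrier) : S.θ (Q.ε q) = Q.ε (S.θ q) := by
  have h : A.d (S.σ (Q.ε q)) = -A.ε (A.d (S.σ q)) := by rw [S.σ_ε, A.d_ε]
  rw [S.d_σ, S.d_σ] at h
  refine (S.σ_add_y_inj (q' := Q.d (Q.ε q)) (h.trans ?_)).2
  simp only [Q.d_ε, map_add, map_mul, S.ε_y, S.σ_ε, map_neg, neg_mul, neg_neg, neg_add]

theorem θ_mul (q q' : Q.carrier) : S.θ (q * q') = S.θ q * q' + q * S.θ q' := by
  have h : A.d (S.σ (q * q')) = A.d (S.σ q) * S.σ q' + A.ε (S.σ q) * A.d (S.σ q') := by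
    rw [map_mul, A.leibniz]
  rw [S.d_σ, S.d_σ, S.d_σ, Q.leibniz, add_mul, mul_add, ← mul_assoc (A.ε (S.σ q)), ← S.y_mul,
    mul_assoc, mul_assoc, ← S.σ_ε] at h
  refine (S.σ_add_y_inj (q' := Q.d q * q' + Q.ε q * Q.d q') (h.trans ?_)).2
  simp only [map_add, map_mul, mul_add]
  abel

/-- The derivation `∂/∂e + θ` of `Q[e]`. -/
noncomputable def nabla : Q.carrier[X] →ₗ[ℚ] Q.carrier[X] :=
  derivative.restrictScalars ℚ + coeffMap S.θ

@[simp]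
theorem coeff_nabla (P : Q.carrier[X]) (k : ℕ) :
    (S.nabla P).coeff k = ((k : ℚ) + 1) • P.coeff (k + 1) + S.θ (P.coeff k) := by
  simp [nabla, coeff_derivative_smul]

theorem nabla_mul (P P' : Q.carrier[X]) :
    S.nabla (P * P') = S.nabla P * P' + P * S.nabla P' := by
  have h := coeffMap_mul (f := S.θ) (g := S.θ) (h := LinearMap.id) (i := LinearMap.id) (j := S.θ)
    S.θ_mul P P'
  rw [coeffMap_id, coeffMap_id] at h
  simp only [nabla, LinearMap.add_apply, LinearMap.restrictScalars_apply, derivative_mul, h,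
    add_mul, mul_add]
  abel

theorem coeff_succ_eq {P U : Q.carrier[X]} (h : S.nabla U = P) (k : ℕ) :
    U.coeff (k + 1) = ((k : ℚ) + 1)⁻¹ • (P.coeff k - S.θ (U.coeff k)) := by
  rw [← h, coeff_nabla, add_sub_cancel_right, inv_smul_smul₀]
  positivity

theorem nabla_unique {U U' : Q.carrier[X]} (h : S.nabla U = S.nabla U')
    (h0 : U.coeff 0 = U'.coeff 0) : U = U' := by
  ext k
  induction k with
  | zero => exact h0
  | succ k ih => rw [S.coeff_succ_eq h, S.coeff_succ_eq rfl, ih]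

/-- The coefficients of a solution are determined recursively, dividing by `k + 1`. Beyond the
degree of `P` the recursion only applies multiples of `θ`, so local nilpotence makes the formal
solution a polynomial. -/
theorem nabla_exists (hθ : ∀ q, ∃ N, (S.θ ^ N) q = 0) (P : Q.carrier[X]) (q : Q.carrier) :
    ∃ U, S.nabla U = P ∧ U.coeff 0 = q := by
  let u : ℕ → Q.carrier := fun k =>
    Nat.rec q (fun k v => ((k : ℚ) + 1)⁻¹ • (P.coeff k - S.θ v)) k
  have hu : ∀ k, u (k + 1) = ((k : ℚ) + 1)⁻¹ • (P.coeff k - S.θ (u k)) := fun k => rfl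
  obtain ⟨N, hN⟩ := hθ (u (P.natDegree + 1))
  have hz : ∀ j, ∃ c : ℚ, u (P.natDegree + 1 + j) = c • (S.θ ^ j) (u (P.natDegree + 1)) := by
    intro j
    induction j with
    | zero => exact ⟨1, by simp⟩
    | succ j ih =>
      obtain ⟨c, hc⟩ := ih
      rw [← add_assoc, hu, coeff_eq_zero_of_natDegree_lt (by omega), hc, map_smul, zero_sub,
        ← Module.End.mul_apply, ← pow_succ', smul_neg, ← neg_smul, smul_smul]
      exact ⟨_, rfl⟩
  have hzero : ∀ k, P.natDegree + 1 + N ≤ k → u k = 0 := by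
    intro k hk
    obtain ⟨j, rfl⟩ := Nat.exists_eq_add_of_le hk
    obtain ⟨c, hc⟩ := hz (N + j)
    rw [add_assoc, hc, add_comm N j, pow_add, Module.End.mul_apply, hN, map_zero, smul_zero]
  let U : Q.carrier[X] := ∑ k ∈ Finset.range (P.natDegree + 1 + N), monomial k (u k)
  have hU : ∀ k, U.coeff k = u k := by
    intro k
    simp only [U, finsetSum_coeff, coeff_monomial, Finset.sum_ite_eq', Finset.mem_range]
    split_ifs with h
    · rfl
    · exact (hzero k (by omega)).symm
  refine ⟨U, ?_, hU 0⟩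
  ext k
  rw [coeff_nabla, hU, hU, hu, smul_inv_smul₀ (by positivity), sub_add_cancel]

variable (hθ : ∀ q, ∃ N, (S.θ ^ N) q = 0)

/-- The solution `exp (-eθ) q` of `(∂/∂e + θ) U = 0`, `U(0) = q`. -/
noncomputable def expθ (q : Q.carrier) : Q.carrier[X] := (S.nabla_exists hθ 0 q).choose

@[simp]
theorem nabla_expθ (q : Q.carrier) : S.nabla (S.expθ hθ q) = 0 :=
  (S.nabla_exists hθ 0 q).choose_spec.1

@[simp]
theorem coeff_zero_expθ (q : Q.carrier) : (S.expθ hθ q).coeff 0 = q :=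
  (S.nabla_exists hθ 0 q).choose_spec.2

theorem eq_expθ {U : Q.carrier[X]} (h : S.nabla U = 0) : U = S.expθ hθ (U.coeff 0) :=
  S.nabla_unique (by simp [h]) (by simp)

theorem nabla_coeffMap {f : Q.carrier →ₗ[ℚ] Q.carrier} (hf : ∀ q, S.θ (f q) = f (S.θ q))
    (P : Q.carrier[X]) : S.nabla (coeffMap f P) = coeffMap f (S.nabla P) := by
  ext k
  simp [hf]

theorem coeffMap_expθ {f : Q.carrier →ₗ[ℚ] Q.carrier} (hf : ∀ q, S.θ (f q) = f (S.θ q))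
    (q : Q.carrier) : coeffMap f (S.expθ hθ q) = S.expθ hθ (f q) := by
  rw [S.eq_expθ hθ (U := coeffMap f (S.expθ hθ q)) (by rw [S.nabla_coeffMap hf]; simp)]
  simp

/-- The coefficients are rational multiples of the iterates of `θ` on `q`. This keeps the section
inside the extension of the augmentation ideal. -/
theorem coeff_expθ_mem {W : Submodule ℚ Q.carrier} (hW : ∀ q ∈ W, S.θ q ∈ W) {q : Q.carrier}
    (hq : q ∈ W) (k : ℕ) : (S.expθ hθ q).coeff k ∈ W := by
  induction k with
  | zero => simpa using hq
  | succ k ih =>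
    rw [S.coeff_succ_eq (S.nabla_expθ hθ q), coeff_zero, zero_sub]
    exact W.smul_mem _ (W.neg_mem (hW _ ih))

/-- `exp (-eθ)` as an algebra map `Q → Q[e]`. -/
noncomputable def expθHom : Q.carrier →ₐ[ℚ] Q.carrier[X] :=
  AlgHom.ofLinearMap
    { toFun := S.expθ hθ
      map_add' := fun a b => S.nabla_unique (by simp) (by simp)
      map_smul' := fun c a => S.nabla_unique (by simp) (by simp) }
    (by
      have h1 : S.θ 1 = 0 := by
        have := S.θ_mul 1 1
        simpa using this
      refine S.nabla_unique ?_ (by simp)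
      ext k
      simp only [LinearMap.coe_mk, AddHom.coe_mk, nabla_expθ, coeff_zero, coeff_nabla, coeff_one]
      rcases k with _ | k <;> simp [h1])
    -- Since `nabla` is a derivation, the product of two solutions is the solution with the product
    -- of the constant terms.
    (fun a b => S.nabla_unique (by simp [nabla_mul]) (by simp [mul_coeff_zero]))

/-- On `Q[e]` inside `A[e]` the differential is `d + y ∇`. Hence the kernel of `∇`, a copy of `Q`,
is a subcomplex. -/
theorem polyD_map_σ (P : Q.carrier[X]) :
    polyD A S.y (mapAlgHom S.σ P) =
      mapAlgHom S.σ (coeffMap Q.d P) + coeffMap (LinearMap.mulLeft ℚ S.y)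
        (mapAlgHom S.σ (S.nabla P)) := by
  ext k
  simp only [coeff_polyD, coe_mapAlgHom, coeff_map, coeff_add, coeff_coeffMap, coeff_nabla,
    LinearMap.mulLeft_apply]
  simp only [RingHom.coe_coe, S.d_σ, map_add, map_smul, ← S.y_mul, mul_add, mul_smul_comm]
  abel

/-- The multiplicative section of the quasi-isomorphism `A[e] → Q`. -/
noncomputable def sec : Hom Q (A.adjoinEven S.y S.d_y S.ε_y) where
  toAlgHom := (mapAlgHom S.σ).comp (S.expθHom hθ)
  map_d q := by
    change mapAlgHom S.σ (S.expθ hθ (Q.d q)) = polyD A S.y (mapAlgHom S.σ (S.expθ hθ q))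
    rw [polyD_map_σ, nabla_expθ, map_zero, map_zero, add_zero, S.coeffMap_expθ hθ S.θ_d]
  map_ε q := by
    change mapAlgHom S.σ (S.expθ hθ (Q.ε q)) = mapAlgHom A.ε (mapAlgHom S.σ (S.expθ hθ q))
    have h := S.coeffMap_expθ hθ (f := Q.ε.toLinearMap) S.θ_ε q
    change _ = S.expθ hθ (Q.ε q) at h
    rw [← h]
    ext k
    simp [S.σ_ε]

/-- In `A[e] = Q[e] ⊕ y Q[e]` the operator `∇` is onto with kernel `Q`, so the component `y ∇` of
the differential cancels everything but that kernel. -/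
theorem sec_coneAcyclic : (S.sec hθ).ConeAcyclic := by
  intro q P hq hqP
  change A.carrier[X] at P
  change mapAlgHom S.σ (S.expθ hθ q) = polyD A S.y P at hqP
  let P₀ := mapAlgHom S.ρ.toAlgHom P
  let P₁ := coeffMap S.γ P
  have hP : P = mapAlgHom S.σ P₀ + coeffMap (LinearMap.mulLeft ℚ S.y) (mapAlgHom S.σ P₁) := by
    ext k
    simpa [P₀, P₁] using (S.decomp (P.coeff k)).symm
  have hinj : ∀ {F G F' G' : Q.carrier[X]},
      mapAlgHom S.σ F + coeffMap (LinearMap.mulLeft ℚ S.y) (mapAlgHom S.σ G) =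
        mapAlgHom S.σ F' + coeffMap (LinearMap.mulLeft ℚ S.y) (mapAlgHom S.σ G') →
      F = F' ∧ G = G' := by
    intro F G F' G' h
    have h' := fun k => S.σ_add_y_inj (q := F.coeff k) (q' := F'.coeff k) (p := G.coeff k)
      (p' := G'.coeff k) (by simpa using congrArg (fun R => R.coeff k) h)
    exact ⟨Polynomial.ext fun k => (h' k).1, Polynomial.ext fun k => (h' k).2⟩
  have hdy : ∀ F : Q.carrier[X],
      polyD A S.y (coeffMap (LinearMap.mulLeft ℚ S.y) (mapAlgHom S.σ F)) =
        coeffMap (LinearMap.mulLeft ℚ S.y) (mapAlgHom S.σ (-coeffMap Q.d F)) := by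
    intro F
    ext k
    have hyy : ∀ a, S.y * (S.y * a) = 0 := fun a => by rw [← mul_assoc, S.y_y, zero_mul]
    simp [S.d_y_σ, S.ε_y, mul_assoc, ← S.y_mul, hyy]
  -- Subtracting the boundary of `σ U` removes the `y`-part `P₁` and leaves `P₀ - d U` in the kernel
  -- of `∇`. As `U` has constant term zero, that element is determined by the constant term of `P₀`.
  obtain ⟨U, hU, hU0⟩ := S.nabla_exists hθ P₁ 0
  have hPd : mapAlgHom S.σ (S.expθ hθ q) + coeffMap (LinearMap.mulLeft ℚ S.y) (mapAlgHom S.σ 0) =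
      mapAlgHom S.σ (coeffMap Q.d P₀) + coeffMap (LinearMap.mulLeft ℚ S.y)
        (mapAlgHom S.σ (S.nabla P₀ - coeffMap Q.d P₁)) := by
    rw [map_zero, map_zero, add_zero, hqP, hP, map_add, polyD_map_σ, hdy, add_assoc, ← map_add,
      ← map_add, sub_eq_add_neg]
  obtain ⟨h1, h2⟩ := hinj hPd
  have h3 : S.nabla (P₀ - coeffMap Q.d U) = 0 := by
    rw [map_sub, S.nabla_coeffMap S.θ_d, hU, ← h2]
  have h4 : P₀ - coeffMap Q.d U = S.expθ hθ (P₀.coeff 0) := by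
    have := S.eq_expθ hθ h3
    simpa [hU0] using this
  refine ⟨P₀.coeff 0, -mapAlgHom S.σ U, ?_, ?_⟩
  · have := congrArg (fun R => R.coeff 0) h1
    simpa using this.symm
  · change mapAlgHom S.σ (S.expθ hθ (P₀.coeff 0)) = P + polyD A S.y (-mapAlgHom S.σ U)
    rw [← h4, map_neg, polyD_map_σ, hU, hP, map_sub]
    abel

end OddStep

end SuperCDGA
namespace SuperCDGA

/-! ### Nilpotence of the augmentation ideal up to acyclic ideals -/

/-- `A` is quasi-isomorphic to an algebra in which the image of `W ⊆ A` spans an ideal whose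
`(m + 1)`-st power lies in an acyclic ideal. -/
def HasNilModel (A : SuperCDGA.{u}) (W : Submodule ℚ A.carrier) (m : ℕ) : Prop :=
  ∃ (B : SuperCDGA.{u}) (s : Hom A B) (J I : Submodule ℚ B.carrier), s.ConeAcyclic ∧
    (∀ a ∈ W, s.toAlgHom a ∈ J) ∧ (∀ j ∈ J, B.ε j ∈ J) ∧ J ^ (m + 1) ≤ I ∧
    (∀ i ∈ I, B.ε i ∈ I) ∧ (∀ i ∈ I, B.d i ∈ I) ∧ (∀ i ∈ I, ∀ b, i * b ∈ I) ∧
    ∀ i ∈ I, B.d i = 0 → ∃ i' ∈ I, B.d i' = i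

/-- The power is sent into the acyclic ideal, where it is a boundary, and a quasi-isomorphism
reflects exactness. -/
theorem HasNilModel.pow_exact {A : SuperCDGA.{u}} {W : Submodule ℚ A.carrier} {m : ℕ}
    (h : A.HasNilModel W m) {a : A.carrier} (ha : a ∈ W) (hd : A.d (a ^ (m + 1)) = 0) :
    a ^ (m + 1) ∈ LinearMap.range A.d := by
  obtain ⟨B, s, J, I, hs, hW, -, hJ, -, -, -, hI⟩ := h
  refine exact_of_map_exact hs hd ?_
  have h1 : s.toAlgHom (a ^ (m + 1)) ∈ I := by
    rw [map_pow]
    exact hJ (Submodule.pow_mem_pow _ (hW a ha) _)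
  obtain ⟨i, -, hi⟩ := hI _ h1 (by rw [← s.map_d, hd, map_zero])
  exact ⟨i, hi⟩

namespace EvenStep

variable {A Q : SuperCDGA.{u}} (S : EvenStep A Q)

/-- The mapping theorem for an even generator. The section `Q → A ⊕ Ae` followed by the extension of
`s` to `B ⊕ Be` is a quasi-isomorphism, and `J` and `I` are extended coordinatewise. Powers of `J ⊕
Je` stay under control because `J` is stable under `ε`, and `I ⊕ Ie` is acyclic by the two-step
argument. The hypothesis on `κ` places the `e`-coefficient of the section in `J`. -/
theorem hasNilModel {W : Submodule ℚ A.carrier} {V : Submodule ℚ Q.carrier} {m : ℕ}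
    (h : A.HasNilModel W m) (hσ : ∀ q ∈ V, S.σ q ∈ W) (hκ : ∀ q ∈ V, S.κ q ∈ W) :
    Q.HasNilModel V m := by
  obtain ⟨B, s, J, I, hs, hW, hJε, hJ, hIε, hId, hIm, hI⟩ := h
  have hd' : B.d (s.toAlgHom S.x) = 0 := by rw [← s.map_d, S.d_x, map_zero]
  have hε' : B.ε (s.toAlgHom S.x) = s.toAlgHom S.x := by rw [← s.map_ε, S.ε_x]
  let ext (T : Submodule ℚ B.carrier) : Submodule ℚ (OddExt B) :=
    { carrier := {a | a.fst ∈ T ∧ a.snd ∈ T}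
      add_mem' := fun ha hb => ⟨T.add_mem ha.1 hb.1, T.add_mem ha.2 hb.2⟩
      zero_mem' := ⟨T.zero_mem, T.zero_mem⟩
      smul_mem' := fun c _ ha => ⟨T.smul_mem c ha.1, T.smul_mem c ha.2⟩ }
  have hpow : ∀ n, ext J ^ n ≤ ext (J ^ n) := by
    intro n
    induction n with
    | zero =>
      rw [pow_zero, pow_zero, Submodule.one_le]
      exact ⟨Submodule.one_le.1 le_rfl, Submodule.zero_mem _⟩
    | succ n ih =>
      rw [pow_succ, pow_succ, Submodule.mul_le]
      intro a ha b hb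
      have ha' := ih ha
      exact ⟨Submodule.mul_mem_mul ha'.1 hb.1, Submodule.add_mem _
        (Submodule.mul_mem_mul ha'.1 hb.2) (Submodule.mul_mem_mul ha'.2 (hJε _ hb.1))⟩
  refine ⟨B.adjoinOdd _ hd' hε', (s.adjoinOdd S.x S.d_x S.ε_x hd' hε').comp S.sec, ext J, ext I,
    (hs.adjoinOdd S.x S.d_x S.ε_x hd' hε').comp S.sec_coneAcyclic, ?_, ?_, ?_, ?_, ?_, ?_, ?_⟩
  · intro q hq
    refine ⟨hW _ (hσ q hq), ?_⟩
    change s.toAlgHom (-A.ε (S.κ q)) ∈ J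
    rw [map_neg, s.map_ε]
    exact J.neg_mem (hJε _ (hW _ (hκ q hq)))
  · intro j hj
    exact ⟨hJε _ hj.1, J.neg_mem (hJε _ hj.2)⟩
  · exact (hpow (m + 1)).trans fun a ha => ⟨hJ ha.1, hJ ha.2⟩
  · intro j hj
    exact ⟨hIε _ hj.1, I.neg_mem (hIε _ hj.2)⟩
  · intro j hj
    exact ⟨I.add_mem (hId _ hj.1) (hIm _ (hIε _ hj.2) _), hId _ hj.2⟩
  · intro j hj b
    exact ⟨hIm _ hj.1 _, I.add_mem (hIm _ hj.1 _) (hIm _ hj.2 _)⟩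
  · rintro ⟨i₀, i₁⟩ hi hd
    have h0 : B.d i₀ + B.ε i₁ * s.toAlgHom S.x = 0 := congrArg OddExt.fst hd
    have h1 : B.d i₁ = 0 := congrArg OddExt.snd hd
    obtain ⟨c₁, hc₁, h2⟩ := hI i₁ hi.2 h1
    obtain ⟨c₀, hc₀, h3⟩ := hI (i₀ - B.ε c₁ * s.toAlgHom S.x)
      (I.sub_mem hi.1 (hIm _ (hIε _ hc₁) _))
      (by
        rw [map_sub, B.leibniz, B.d_ε, hd', mul_zero, add_zero, h2, neg_mul, sub_neg_eq_add]
        exact h0)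
    refine ⟨(⟨c₀, c₁⟩ : OddExt B), ⟨hc₀, hc₁⟩, ?_⟩
    refine OddExt.ext' ?_ h2
    change B.d c₀ + B.ε c₁ * s.toAlgHom S.x = i₀
    rw [h3, sub_add_cancel]

end EvenStep

namespace OddStep

open Polynomial

variable {A Q : SuperCDGA.{u}} (S : OddStep A Q)

/-- The mapping theorem for an odd generator, with `A[e]`, `B[e]` and coefficientwise extensions of
`J` and `I`. Stability of `V` under `θ` puts all coefficients of `exp (-eθ) q` into `J`. -/
theorem hasNilModel (hθ : ∀ q, ∃ N, (S.θ ^ N) q = 0)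
    {W : Submodule ℚ A.carrier} {V : Submodule ℚ Q.carrier} {m : ℕ}
    (h : A.HasNilModel W m) (hσ : ∀ q ∈ V, S.σ q ∈ W) (hθV : ∀ q ∈ V, S.θ q ∈ V) :
    Q.HasNilModel V m := by
  obtain ⟨B, s, J, I, hs, hW, hJε, hJ, hIε, hId, hIm, hI⟩ := h
  have hd' : B.d (s.toAlgHom S.y) = 0 := by rw [← s.map_d, S.d_y, map_zero]
  have hε' : B.ε (s.toAlgHom S.y) = -s.toAlgHom S.y := by rw [← s.map_ε, S.ε_y, map_neg]
  let ext (T : Submodule ℚ B.carrier) : Submodule ℚ B.carrier[X] :=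
    { carrier := {P | ∀ k, P.coeff k ∈ T}
      add_mem' := fun ha hb k => by rw [coeff_add]; exact T.add_mem (ha k) (hb k)
      zero_mem' := fun k => by rw [coeff_zero]; exact T.zero_mem
      smul_mem' := fun c _ ha k => by rw [coeff_smul]; exact T.smul_mem c (ha k) }
  have hpow : ∀ n, ext J ^ n ≤ ext (J ^ n) := by
    intro n
    induction n with
    | zero =>
      rw [pow_zero, pow_zero, Submodule.one_le]
      intro k
      rw [coeff_one]
      split_ifs
      · exact Submodule.one_le.1 le_rfl
      · exact Submodule.zero_mem _
    | succ n ih =>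
      rw [pow_succ, pow_succ, Submodule.mul_le]
      intro a ha b hb k
      rw [coeff_mul]
      exact Submodule.sum_mem _ fun x _ => Submodule.mul_mem_mul (ih ha _) (hb _)
  refine ⟨B.adjoinEven _ hd' hε', (s.adjoinEven S.y S.d_y S.ε_y hd' hε').comp (S.sec hθ),
    ext J, ext I, (hs.adjoinEven S.y S.d_y S.ε_y hd' hε').comp (S.sec_coneAcyclic hθ),
    ?_, ?_, ?_, ?_, ?_, ?_, ?_⟩
  · intro q hq k
    change (mapAlgHom s.toAlgHom (mapAlgHom S.σ (S.expθ hθ q))).coeff k ∈ J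
    rw [coe_mapAlgHom, coeff_map, coe_mapAlgHom, coeff_map]
    exact hW _ (hσ _ (S.coeff_expθ_mem hθ hθV hq k))
  · intro (j : B.carrier[X]) hj k
    change (mapAlgHom B.ε j).coeff k ∈ J
    rw [coe_mapAlgHom, coeff_map]
    exact hJε _ (hj k)
  · exact (hpow (m + 1)).trans fun a ha k => hJ (ha k)
  · intro (j : B.carrier[X]) hj k
    change (mapAlgHom B.ε j).coeff k ∈ I
    rw [coe_mapAlgHom, coeff_map]
    exact hIε _ (hj k)
  · intro (j : B.carrier[X]) hj k
    change (polyD B _ j).coeff k ∈ I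
    rw [coeff_polyD]
    exact I.add_mem (hId _ (hj k)) (I.smul_mem _ (hIm _ (hIε _ (hj _)) _))
  · intro (j : B.carrier[X]) hj (b : B.carrier[X]) k
    change (j * b).coeff k ∈ I
    rw [coeff_mul]
    exact Submodule.sum_mem _ fun x _ => hIm _ (hj _) _
  -- Acyclicity of `I[e]` by induction on the degree in `e`: the leading coefficient of a cocycle is
  -- a cocycle of `I`.
  · have key : ∀ (n : ℕ) (P : B.carrier[X]), P ∈ ext I → (∀ k, n ≤ k → P.coeff k = 0) →
        polyD B (s.toAlgHom S.y) P = 0 →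
        ∃ R ∈ ext I, polyD B (s.toAlgHom S.y) R = P := by
      intro n
      induction n with
      | zero =>
        intro P _ hP _
        have hP0 : P = 0 := Polynomial.ext fun k => hP k (Nat.zero_le k)
        exact ⟨0, Submodule.zero_mem _, by rw [hP0, map_zero]⟩
      | succ n ih =>
        intro P hPI hP hdP
        have h1 : B.d (P.coeff n) = 0 := by
          have := congrArg (fun R => R.coeff n) hdP
          simpa [hP (n + 1) le_rfl] using this
        obtain ⟨c, hc, hdc⟩ := hI _ (hPI n) h1
        have hm : (monomial n c : B.carrier[X]) ∈ ext I := by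
          intro k
          rw [coeff_monomial]
          split_ifs
          · exact hc
          · exact I.zero_mem
        have hdm : polyD B (s.toAlgHom S.y) (monomial n c) ∈ ext I := by
          intro k
          rw [coeff_polyD]
          exact I.add_mem (hId _ (hm k)) (I.smul_mem _ (hIm _ (hIε _ (hm _)) _))
        obtain ⟨R, hR, hR'⟩ := ih (P - polyD B (s.toAlgHom S.y) (monomial n c))
          (Submodule.sub_mem _ hPI hdm)
          (by
            intro k hk
            rw [coeff_sub, coeff_polyD, coeff_monomial, coeff_monomial,
              if_neg (show n ≠ k + 1 by omega)]
            rcases eq_or_lt_of_le hk with rfl | hk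
            · simp [hdc]
            · simp [hP k hk, hk.ne])
          (by rw [map_sub, hdP, polyD_polyD B _ hd' hε', sub_zero])
        exact ⟨R + monomial n c, Submodule.add_mem _ hR hm, by rw [map_add, hR', sub_add_cancel]⟩
    intro P hP hdP
    exact key ((P : B.carrier[X]).natDegree + 1) P hP
      (fun k hk => coeff_eq_zero_of_natDegree_lt (by omega)) hdP

end OddStep

end SuperCDGA
namespace SuperCDGA

/-! ### Acyclicity of a filtration in high filtration degrees -/

/-- The terms `F p` with `p ≥ p₀` are acyclic. -/
def AcyclicFrom (A : SuperCDGA.{u}) (F : ℕ → Submodule ℚ A.carrier) (p₀ : ℕ) : Prop :=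
  ∀ p, p₀ ≤ p → ∀ z ∈ F p, A.d z = 0 → ∃ u ∈ F p, A.d u = z

/-- If `x * z = d u`, then `ρ u` is a cocycle of `Q`, hence bounds within its filtration level; so
`u` may be changed by a boundary to be divisible by `x`, and the quotient bounds `z`. Starting from
`x ^ N * z = d (w * z)`, the factors `x` are cancelled one at a time. Each cancellation lowers the
weight by exactly `a`, so the bound `p₀` does not change. -/
theorem EvenStep.acyclicFrom {A Q : SuperCDGA.{u}} (S : EvenStep A Q)
    {F : ℕ → Submodule ℚ A.carrier} {G : ℕ → Submodule ℚ Q.carrier} {a N p₀ : ℕ}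
    (hσ : ∀ p, ∀ q ∈ G p, S.σ q ∈ F p) (hρ : ∀ p, ∀ u ∈ F p, S.ρ.toAlgHom u ∈ G p)
    (hd : ∀ p, ∀ u ∈ F p, A.d u ∈ F p)
    (hx : ∀ p, ∀ u ∈ F p, S.x * u ∈ F (p + a)) (hγ : ∀ p, ∀ u ∈ F (p + a), S.γ u ∈ F p)
    (hmul : ∀ p, ∀ r, ∀ u ∈ F p, ∀ v ∈ F r, u * v ∈ F (p + r))
    (hN : ∃ w ∈ F (N * a), A.d w = S.x ^ N) (hG : Q.AcyclicFrom G p₀) : A.AcyclicFrom F p₀ := by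
  have step : ∀ p, p₀ ≤ p → ∀ z ∈ F p, (∃ u ∈ F (p + a), A.d u = S.x * z) →
      ∃ u ∈ F p, A.d u = z := by
    rintro p hp z - ⟨u, hu, hdu⟩
    obtain ⟨t, ht, hdt⟩ := hG (p + a) (by omega) _ (hρ _ u hu)
      (by rw [← S.ρ.map_d, hdu, map_mul, S.ρ_x, zero_mul])
    have h1 : S.ρ.toAlgHom (u - A.d (S.σ t)) = 0 := by
      rw [map_sub, S.ρ.map_d, S.ρ_σ, hdt, sub_self]
    refine ⟨S.γ u - S.κ t, ?_, ?_⟩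
    · have h2 : S.γ u - S.κ t = S.γ (u - A.d (S.σ t)) := by rw [map_sub]; rfl
      rw [h2]
      exact hγ p _ (Submodule.sub_mem _ hu (hd _ _ (hσ _ t ht)))
    · apply S.x_injective
      have h2 := S.exists_of_ρ_eq_zero h1
      rw [← S.d_x_mul, ← hdu]
      have h3 : S.γ (u - A.d (S.σ t)) = S.γ u - S.κ t := by rw [map_sub]; rfl
      rw [← h3, ← h2, map_sub, A.d_d, sub_zero]
  have step' : ∀ k p, p₀ ≤ p → ∀ z ∈ F p, A.d z = 0 →
      (∃ u ∈ F (p + k * a), A.d u = S.x ^ k * z) → ∃ u ∈ F p, A.d u = z := by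
    intro k
    induction k with
    | zero => intro p _ z _ _ h; simpa using h
    | succ k ih =>
      rintro p hp z hz hdz ⟨u, hu, hdu⟩
      refine step p hp z hz (ih (p + a) (by omega) _ (hx p z hz) (by rw [S.d_x_mul, hdz, mul_zero])
        ⟨u, ?_, ?_⟩)
      · rwa [show p + a + k * a = p + (k + 1) * a by ring]
      · rw [hdu, pow_succ, mul_assoc]
  intro p hp z hz hdz
  obtain ⟨w, hw, hdw⟩ := hN
  refine step' N p hp z hz hdz ⟨w * z, ?_, ?_⟩
  · rw [add_comm]
    exact hmul _ _ w hw z hz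
  · rw [A.leibniz, hdw, hdz, mul_zero, add_zero]

/-- A cocycle can be corrected by a boundary to the form `y * σ q`, with `q` a cocycle of `Q` whose
weight is smaller by `b`. This is why the bound moves to `p₀ + b`. -/
theorem OddStep.acyclicFrom {A Q : SuperCDGA.{u}} (S : OddStep A Q)
    {F : ℕ → Submodule ℚ A.carrier} {G : ℕ → Submodule ℚ Q.carrier} {b p₀ : ℕ}
    (hσ : ∀ p, ∀ q ∈ G p, S.σ q ∈ F p) (hρ : ∀ p, ∀ u ∈ F p, S.ρ.toAlgHom u ∈ G p)
    (hd : ∀ p, ∀ u ∈ F p, A.d u ∈ F p)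
    (hy : ∀ p, ∀ q ∈ G p, S.y * S.σ q ∈ F (p + b)) (hγ : ∀ p, ∀ u ∈ F (p + b), S.γ u ∈ G p)
    (hG : Q.AcyclicFrom G p₀) : A.AcyclicFrom F (p₀ + b) := by
  intro p hp z hz hdz
  obtain ⟨r, rfl⟩ : ∃ r, p = r + b := ⟨p - b, by omega⟩
  obtain ⟨t, ht, hdt⟩ := hG (r + b) (by omega) _ (hρ _ z hz) (by rw [← S.ρ.map_d, hdz, map_zero])
  set z' := z - A.d (S.σ t) with hz'
  have hz'F : z' ∈ F (r + b) := Submodule.sub_mem _ hz (hd _ _ (hσ _ t ht))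
  have h1 : S.ρ.toAlgHom z' = 0 := by
    rw [hz', map_sub, S.ρ.map_d, S.ρ_σ, hdt, sub_self]
  have h2 : z' = S.y * S.σ (S.γ z') := by
    have := S.decomp z'
    rw [h1, map_zero, zero_add] at this
    exact this.symm
  have h3 : Q.d (S.γ z') = 0 := by
    have h4 : A.d z' = 0 := by rw [hz', map_sub, hdz, A.d_d, sub_zero]
    rw [h2, S.d_y_σ, ← map_zero A.d, ← neg_zero, ← mul_zero S.y] at h4
    have h5 := congrArg S.γ h4
    simpa [S.γ_y] using h5
  obtain ⟨v, hv, hdv⟩ := hG r (by omega) _ (hγ r z' hz'F) h3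
  refine ⟨S.σ t - S.y * S.σ v, Submodule.sub_mem _ (hσ _ t ht) (hy r v hv), ?_⟩
  rw [map_sub, S.d_y_σ, hdv, sub_neg_eq_add, ← h2, hz']
  abel

end SuperCDGA

/-! ### Poincaré duality -/

section LinearAlgebra

open Module

variable {H K : Type u} [AddCommGroup H] [Module ℚ H] [FiniteDimensional ℚ H]
  [AddCommGroup K] [Module ℚ K] [FiniteDimensional ℚ K]

theorem finrank_orthogonal_add_le {Φ : K →ₗ[ℚ] Dual ℚ K} (hΦ : Function.Injective Φ)
    (L : Submodule ℚ K) :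
    finrank ℚ (L.dualAnnihilator.comap Φ) + finrank ℚ L ≤ finrank ℚ K := by
  have h1 := Subspace.finrank_add_finrank_dualAnnihilator_eq L
  have h2 : finrank ℚ (L.dualAnnihilator.comap Φ) ≤ finrank ℚ L.dualAnnihilator :=
    LinearMap.finrank_le_finrank_of_injective (f := Φ.restrict fun _ h => h)
      (fun a b hab => Subtype.ext (hΦ (congrArg Subtype.val hab)))
  omega

/-- The sequence makes the range of `ρ` its own annihilator under `Ψ`. If `h` pairs to zero with
everything and `x h = 0`, then `h = δ k` with `k` in that annihilator, so `k` lies in the range of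
`ρ` and `δ k = 0`. Nilpotence of the self-adjoint map `x` reduces the general case to this one. -/
theorem injective_of_gysin {Φ : H →ₗ[ℚ] Dual ℚ H} {Ψ : K →ₗ[ℚ] Dual ℚ K}
    (hΨ : Function.Injective Ψ) {x : H →ₗ[ℚ] H} {ρ : H →ₗ[ℚ] K} {δ : K →ₗ[ℚ] H}
    (hρ : LinearMap.ker ρ ≤ LinearMap.range x) (hδ : LinearMap.ker δ ≤ LinearMap.range ρ)
    (hδρ : ∀ h, δ (ρ h) = 0) (hxδ : ∀ k, x (δ k) = 0) (hx : LinearMap.ker x ≤ LinearMap.range δ)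
    (hnil : IsNilpotent x) (h₁ : ∀ k h, Φ (δ k) h = Ψ k (ρ h))
    (h₂ : ∀ h h', Φ (x h) h' = Φ h (x h')) : Function.Injective Φ := by
  have hL : (LinearMap.range ρ).dualAnnihilator.comap Ψ = LinearMap.range ρ := by
    symm
    apply Submodule.eq_of_le_of_finrank_le
    · rintro _ ⟨h, rfl⟩
      rw [Submodule.mem_comap, Submodule.mem_dualAnnihilator]
      rintro _ ⟨h', rfl⟩
      rw [← h₁, hδρ, map_zero, LinearMap.zero_apply]
    -- The kernel and cokernel of the endomorphism `x` of a finite-dimensional space have equal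
    -- dimension, so the range of `ρ` fills at least half of `K`.
    · have e1 := finrank_orthogonal_add_le hΨ (LinearMap.range ρ)
      have e2 := LinearMap.finrank_range_add_finrank_ker δ
      have e3 := LinearMap.finrank_range_add_finrank_ker ρ
      have e4 := LinearMap.finrank_range_add_finrank_ker x
      have e5 := Submodule.finrank_mono hδ
      have e6 := Submodule.finrank_mono hρ
      have e7 : finrank ℚ (LinearMap.range δ) ≤ finrank ℚ (LinearMap.ker x) :=
        Submodule.finrank_mono (by rintro _ ⟨k, rfl⟩; exact hxδ k)
      omega
  have key : ∀ h, x h = 0 → Φ h = 0 → h = 0 := by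
    intro h hxh hΦh
    obtain ⟨k, rfl⟩ := hx hxh
    have hk : k ∈ (LinearMap.range ρ).dualAnnihilator.comap Ψ := by
      rw [Submodule.mem_comap, Submodule.mem_dualAnnihilator]
      rintro _ ⟨h', rfl⟩
      rw [← h₁, hΦh, LinearMap.zero_apply]
    rw [hL] at hk
    obtain ⟨h', rfl⟩ := hk
    exact hδρ h'
  have hpow : ∀ n h, (x ^ n) h = 0 → Φ h = 0 → h = 0 := by
    intro n
    induction n with
    | zero => intro h hh _; simpa using hh
    | succ n ih =>
      intro h hh hΦh
      have h3 : x h = 0 := by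
        refine ih (x h) ?_ ?_
        · rw [← Module.End.mul_apply, ← pow_succ, hh]
        · ext h'
          rw [h₂, hΦh]; rfl
      exact key h h3 hΦh
  rw [← LinearMap.ker_eq_bot, LinearMap.ker_eq_bot']
  intro h hh
  obtain ⟨n, hn⟩ := hnil
  exact hpow n h (by rw [hn]; rfl) hh

/-- Here the annihilator of the range of `ρ` is the range of `θ`, by dimension. An `h` pairing to
zero has `ρ h = 0`, so `h = j k` with `k` in this annihilator, and `j ∘ θ = 0`. The hypothesis `h₂`
replaces symmetry of the pairing, which is not assumed. -/
theorem injective_of_wang {Φ : H →ₗ[ℚ] Dual ℚ H} {Ψ : K →ₗ[ℚ] Dual ℚ K}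
    (hΨ : Function.Injective Ψ) {j : K →ₗ[ℚ] H} {ρ : H →ₗ[ℚ] K} {θ : K →ₗ[ℚ] K}
    (hρ : LinearMap.ker ρ ≤ LinearMap.range j) (hθ : LinearMap.ker θ ≤ LinearMap.range ρ)
    (hjθ : ∀ k, j (θ k) = 0) (h₁ : ∀ k h, Φ (j k) h = Ψ k (ρ h))
    (h₂ : ∀ h, (∀ k, Φ h (j k) = 0) → ρ h = 0) : Function.Injective Φ := by
  have hL : (LinearMap.range ρ).dualAnnihilator.comap Ψ = LinearMap.range θ := by
    symm
    apply Submodule.eq_of_le_of_finrank_le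
    · rintro _ ⟨k, rfl⟩
      rw [Submodule.mem_comap, Submodule.mem_dualAnnihilator]
      rintro _ ⟨h', rfl⟩
      rw [← h₁, hjθ, map_zero, LinearMap.zero_apply]
    · have e1 := finrank_orthogonal_add_le hΨ (LinearMap.range ρ)
      have e2 := LinearMap.finrank_range_add_finrank_ker θ
      have e3 := Submodule.finrank_mono hθ
      omega
  rw [← LinearMap.ker_eq_bot, LinearMap.ker_eq_bot']
  intro h hh
  have h3 : ρ h = 0 := h₂ h fun k => by rw [hh]; rfl
  obtain ⟨k, rfl⟩ := hρ h3
  have hk : k ∈ (LinearMap.range ρ).dualAnnihilator.comap Ψ := by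
    rw [Submodule.mem_comap, Submodule.mem_dualAnnihilator]
    rintro _ ⟨h', rfl⟩
    rw [← h₁, hh, LinearMap.zero_apply]
  rw [hL] at hk
  obtain ⟨k', rfl⟩ := hk
  exact hjθ k'

end LinearAlgebra

/-! ### The pairing on cohomology defined by a functional -/

namespace SuperCDGA

/-- The total cohomology of `A`. -/
abbrev H (A : SuperCDGA.{u}) : Type u :=
  LinearMap.ker A.d ⧸ (LinearMap.range A.d).submoduleOf (LinearMap.ker A.d)

/-- The class of a cocycle. -/
def cls {A : SuperCDGA.{u}} (a : A.carrier) (ha : A.d a = 0) : A.H :=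
  Submodule.Quotient.mk ⟨a, ha⟩

theorem cls_eq_zero {A : SuperCDGA.{u}} {a : A.carrier} {ha : A.d a = 0} :
    cls a ha = 0 ↔ a ∈ LinearMap.range A.d :=
  Submodule.Quotient.mk_eq_zero _

theorem exists_cls {A : SuperCDGA.{u}} (h : A.H) : ∃ a ha, h = cls a ha := by
  obtain ⟨⟨a, ha⟩, rfl⟩ := Submodule.Quotient.mk_surjective _ h
  exact ⟨a, ha, rfl⟩

/-- The map on cohomology induced by a linear map preserving cocycles and coboundaries. -/
def mapH {A Q : SuperCDGA.{u}} (f : A.carrier →ₗ[ℚ] Q.carrier)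
    (hf : ∀ a, A.d a = 0 → Q.d (f a) = 0) (hf' : ∀ a, f (A.d a) ∈ LinearMap.range Q.d) :
    A.H →ₗ[ℚ] Q.H :=
  Submodule.mapQ _ _ (f.restrict hf) (by
    rintro ⟨_, _⟩ ⟨a, rfl⟩
    exact hf' a)

/-- The functional `b ↦ ω (a b)` on cohomology. -/
def pairingLeft (A : SuperCDGA.{u}) (ω : A.carrier →ₗ[ℚ] ℚ) (hω : ∀ a, ω (A.d a) = 0)
    (a : LinearMap.ker A.d) : A.H →ₗ[ℚ] ℚ :=
  Submodule.liftQ _ (ω ∘ₗ LinearMap.mulLeft ℚ a.1 ∘ₗ (LinearMap.ker A.d).subtype) (by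
    rintro ⟨_, _⟩ ⟨b, rfl⟩
    obtain ⟨a, ha⟩ := a
    change ω (a * A.d b) = 0
    have h := A.leibniz (A.ε a) b
    rw [A.d_ε, LinearMap.mem_ker.1 ha, map_zero, neg_zero, zero_mul, zero_add, A.ε_ε] at h
    rw [← h, hω])

/-- The pairing `(a, b) ↦ ω (a b)` on cohomology. -/
def pairing (A : SuperCDGA.{u}) (ω : A.carrier →ₗ[ℚ] ℚ) (hω : ∀ a, ω (A.d a) = 0) :
    A.H →ₗ[ℚ] Module.Dual ℚ A.H :=
  Submodule.liftQ _
    { toFun := A.pairingLeft ω hω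
      map_add' := fun a a' => by
        refine LinearMap.ext fun h => ?_
        obtain ⟨b, rfl⟩ := Submodule.Quotient.mk_surjective _ h
        simp [pairingLeft, add_mul]
      map_smul' := fun c a => by
        refine LinearMap.ext fun h => ?_
        obtain ⟨b, rfl⟩ := Submodule.Quotient.mk_surjective _ h
        simp [pairingLeft] }
    (by
      rintro ⟨_, _⟩ ⟨a, rfl⟩
      refine LinearMap.ext fun h => ?_
      obtain ⟨⟨b, hb⟩, rfl⟩ := Submodule.Quotient.mk_surjective _ h
      change ω (A.d a * b) = 0
      have h := A.leibniz a b
      rw [LinearMap.mem_ker.1 hb, mul_zero, add_zero] at h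
      rw [← h, hω])

theorem pairing_cls {A : SuperCDGA.{u}} {ω : A.carrier →ₗ[ℚ] ℚ} (hω : ∀ a, ω (A.d a) = 0)
    (a b : A.carrier) (ha : A.d a = 0) (hb : A.d b = 0) :
    A.pairing ω hω (cls a ha) (cls b hb) = ω (a * b) := rfl

/-- Cocycles orthogonal to all cocycles are coboundaries. -/
def Nondegenerate (A : SuperCDGA.{u}) (ω : A.carrier →ₗ[ℚ] ℚ) : Prop :=
  ∀ a, A.d a = 0 → (∀ b, A.d b = 0 → ω (a * b) = 0) → a ∈ LinearMap.range A.d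

theorem nondegenerate_iff {A : SuperCDGA.{u}} {ω : A.carrier →ₗ[ℚ] ℚ} (hω : ∀ a, ω (A.d a) = 0) :
    A.Nondegenerate ω ↔ Function.Injective (A.pairing ω hω) := by
  rw [← LinearMap.ker_eq_bot, LinearMap.ker_eq_bot']
  constructor
  · intro h c hc
    obtain ⟨a, ha, rfl⟩ := exists_cls c
    refine cls_eq_zero.2 (h a ha fun b hb => ?_)
    rw [← pairing_cls hω a b ha hb, hc]
    rfl
  · intro h a ha hab
    refine cls_eq_zero.1 (h (cls a ha) (LinearMap.ext fun c => ?_))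
    obtain ⟨b, hb, rfl⟩ := exists_cls c
    exact hab b hb

/-- A grading compatible with the products and the differential, given by its projections. -/
structure Grading (A : SuperCDGA.{u}) where
  pr : ℕ → A.carrier →ₗ[ℚ] A.carrier
  pr_pr : ∀ i a, pr i (pr i a) = pr i a
  pr_d : ∀ i a, pr (i + 1) (A.d a) = A.d (pr i a)
  pr_zero_d : ∀ a, pr 0 (A.d a) = 0
  pr_mul : ∀ i j a b, pr i a = a → pr (i + j) (a * b) = a * pr j b
  pr_mul_lt : ∀ i j a b, pr i a = a → j < i → pr j (a * b) = 0

/-- Poincaré duality in formal dimension `n`. -/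
def IsPoincare (A : SuperCDGA.{u}) (G : A.Grading) (n : ℕ) : Prop :=
  ∃ ω : A.carrier →ₗ[ℚ] ℚ, (∀ a, ω (A.d a) = 0) ∧ (∀ a, ω (G.pr n a) = ω a) ∧ A.Nondegenerate ω

variable {A Q : SuperCDGA.{u}}

theorem Grading.d_pr_eq_zero (G : A.Grading) {a : A.carrier} (ha : A.d a = 0) (i : ℕ) :
    A.d (G.pr i a) = 0 := by rw [← G.pr_d, ha, map_zero]

theorem Grading.exists_homogeneous (G : A.Grading) {i : ℕ} {a b : A.carrier} (ha : G.pr i a = a)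
    (h : A.d b = a) (ha0 : a ≠ 0) : ∃ j c, i = j + 1 ∧ G.pr j c = c ∧ A.d c = a := by
  rcases i with _ | i
  · exact absurd (by rw [← ha, ← h, G.pr_zero_d]) ha0
  · exact ⟨i, G.pr i b, rfl, G.pr_pr _ _, by rw [← G.pr_d, h, ha]⟩

/-- The functional only sees degree `n`, which a product with a factor of larger degree does not
reach. -/
theorem exact_of_degree_gt {G : A.Grading} {n : ℕ} (h : A.IsPoincare G n) {i : ℕ} (hi : n < i)
    {a : A.carrier} (ha : G.pr i a = a) (hd : A.d a = 0) : a ∈ LinearMap.range A.d := by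
  obtain ⟨ω, -, hωn, hω⟩ := h
  refine hω a hd fun b _ => ?_
  rw [← hωn, G.pr_mul_lt i n a b ha hi, map_zero]

/-- A functional on cocycles which is compatible with a linear map extends along it. -/
theorem exists_functional {f : Q.carrier →ₗ[ℚ] A.carrier} {ω : Q.carrier →ₗ[ℚ] ℚ}
    (h : ∀ q, Q.d q = 0 → f q ∈ LinearMap.range A.d → ω q = 0) :
    ∃ ω' : A.carrier →ₗ[ℚ] ℚ, (∀ a, ω' (A.d a) = 0) ∧ ∀ q, Q.d q = 0 → ω' (f q) = ω q := by
  let g : LinearMap.ker Q.d →ₗ[ℚ] A.carrier ⧸ LinearMap.range A.d :=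
    (LinearMap.range A.d).mkQ ∘ₗ f ∘ₗ (LinearMap.ker Q.d).subtype
  have hg : LinearMap.ker g ≤ LinearMap.ker (ω ∘ₗ (LinearMap.ker Q.d).subtype) := by
    rintro ⟨q, hq⟩ hgq
    refine h q hq ?_
    exact (Submodule.Quotient.mk_eq_zero _).1 hgq
  obtain ⟨e, he⟩ := LinearMap.exists_extend (p := LinearMap.range g)
    (((LinearMap.ker g).liftQ _ hg) ∘ₗ g.quotKerEquivRange.symm.toLinearMap)
  refine ⟨e ∘ₗ (LinearMap.range A.d).mkQ, fun a => ?_, fun q hq => ?_⟩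
  · have : (LinearMap.range A.d).mkQ (A.d a) = 0 :=
      (Submodule.Quotient.mk_eq_zero _).2 ⟨a, rfl⟩
    rw [LinearMap.comp_apply, this, map_zero]
  · have h1 := LinearMap.congr_fun he ⟨g ⟨q, hq⟩, ⟨_, rfl⟩⟩
    have h2 : g.quotKerEquivRange.symm ⟨g ⟨q, hq⟩, ⟨_, rfl⟩⟩ = Submodule.Quotient.mk ⟨q, hq⟩ := by
      rw [LinearEquiv.symm_apply_eq]; rfl
    simp only [LinearMap.comp_apply, LinearEquiv.coe_coe, h2] at h1
    exact h1

end SuperCDGA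
namespace SuperCDGA

variable {A Q : SuperCDGA.{u}}

theorem cls_eq_cls {a b : A.carrier} {ha : A.d a = 0} {hb : A.d b = 0} :
    cls a ha = cls b hb ↔ a - b ∈ LinearMap.range A.d := by
  rw [← cls_eq_zero (ha := by rw [map_sub, ha, hb, sub_zero]), ← sub_eq_zero]
  rfl

theorem exact_mul {a b : A.carrier} (ha : a ∈ LinearMap.range A.d) (hb : A.d b = 0) :
    a * b ∈ LinearMap.range A.d := by
  obtain ⟨c, rfl⟩ := ha
  exact ⟨c * b, by rw [A.leibniz, hb, mul_zero, add_zero]⟩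

theorem Grading.functional_pr_d (G : A.Grading) {ω : A.carrier →ₗ[ℚ] ℚ}
    (hω : ∀ a, ω (A.d a) = 0) (n : ℕ) (a : A.carrier) : ω (G.pr n (A.d a)) = 0 := by
  rcases n with _ | n
  · rw [G.pr_zero_d, map_zero]
  · rw [G.pr_d, hω]

/-- The map on cohomology induced by a map of algebras. -/
def Hom.onH (f : Hom A Q) : A.H →ₗ[ℚ] Q.H :=
  mapH f.toAlgHom.toLinearMap
    (fun a ha => by
      change Q.d (f.toAlgHom a) = 0
      rw [← f.map_d, ha, map_zero])
    (fun a => ⟨f.toAlgHom a, (f.map_d a).symm⟩)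

/-! ### The Gysin sequence of an even generator -/

namespace EvenStep

variable (S : EvenStep A Q)

/-- Multiplication by `x` on cohomology. -/
def xH : A.H →ₗ[ℚ] A.H :=
  mapH (LinearMap.mulLeft ℚ S.x)
    (fun a ha => by rw [LinearMap.mulLeft_apply, S.d_x_mul, ha, mul_zero])
    (fun a => ⟨S.x * a, S.d_x_mul a⟩)

/-- The connecting map of the Gysin sequence. -/
def κH : Q.H →ₗ[ℚ] A.H :=
  mapH S.κ (fun a ha => by rw [S.d_κ, ha, map_zero, neg_zero])
    (fun a => ⟨-S.κ a, by rw [map_neg, S.d_κ, neg_neg]⟩)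

theorem lift_exact {u : A.carrier} (hu : S.ρ.toAlgHom u ∈ LinearMap.range Q.d) :
    ∃ t v, u = A.d (S.σ t) + S.x * v := by
  obtain ⟨t, ht⟩ := hu
  refine ⟨t, S.γ (u - A.d (S.σ t)), ?_⟩
  rw [← S.exists_of_ρ_eq_zero, add_sub_cancel]
  rw [map_sub, S.ρ.map_d, S.ρ_σ, ht, sub_self]

/-- If `x * z` bounds, it bounds an element of degree `i + a - 1 > n`. Its image in `Q` is a cocycle
above the formal dimension, hence exact, and `x` can be cancelled as in the filtered argument. -/
theorem exact_of_x_pow_mul {G : A.Grading} {K : Q.Grading} {a n : ℕ}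
    (hx : ∀ j u, G.pr (j + a) (S.x * u) = S.x * G.pr j u)
    (hρ : ∀ j u, S.ρ.toAlgHom (G.pr j u) = K.pr j (S.ρ.toAlgHom u))
    (hQ : Q.IsPoincare K n) (k : ℕ) : ∀ (i : ℕ), n + 2 ≤ i + a → ∀ z, G.pr i z = z → A.d z = 0 →
      S.x ^ k * z ∈ LinearMap.range A.d → z ∈ LinearMap.range A.d := by
  induction k with
  | zero => intro i _ z _ _ h; simpa using h
  | succ k ih =>
    intro i hi z hz hdz h
    rw [pow_succ, mul_assoc] at h
    have hxz : G.pr (i + a) (S.x * z) = S.x * z := by rw [hx, hz]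
    obtain ⟨u, hu⟩ := ih (i + a) (by omega) _ hxz (by rw [S.d_x_mul, hdz, mul_zero]) h
    by_cases h0 : S.x * z = 0
    · rw [← mul_zero S.x] at h0
      rw [S.x_injective h0]
      exact Submodule.zero_mem _
    obtain ⟨j, c, hj, hc, hdc⟩ := G.exists_homogeneous hxz hu h0
    have h1 : S.ρ.toAlgHom c ∈ LinearMap.range Q.d :=
      exact_of_degree_gt hQ (i := j) (by omega) (by rw [← hρ, hc])
        (by rw [← S.ρ.map_d, hdc, map_mul, S.ρ_x, zero_mul])
    obtain ⟨t, v, hv⟩ := S.lift_exact h1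
    refine ⟨v, S.x_injective ?_⟩
    rw [← S.d_x_mul, ← hdc, hv, map_add, A.d_d, zero_add]

theorem xH_pow (k : ℕ) (z : A.carrier) (hz : A.d z = 0) :
    (S.xH ^ k) (cls z hz) = cls (S.x ^ k * z) (by
      rw [A.leibniz, hz, mul_zero, add_zero]
      induction k with
      | zero =>
        have := A.leibniz 1 1
        simp at this
        simp [this]
      | succ k ih => rw [pow_succ', S.d_x_mul, mul_assoc, ih, mul_zero]) := by
  induction k with
  | zero => simp
  | succ k ih =>
    rw [pow_succ', Module.End.mul_apply, ih]
    simp only [pow_succ', mul_assoc]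
    rfl

/-- The connecting map `κ` lowers degrees by `a - 1`, so the new formal dimension is `n + 1 - a`.
The functional of `Q` is transported along `κ`, and `injective_of_gysin` applies since `x` is
nilpotent. -/
theorem isPoincare [FiniteDimensional ℚ A.H] [FiniteDimensional ℚ Q.H] [Nontrivial A.carrier]
    {G : A.Grading} {K : Q.Grading} {a n N : ℕ} (ha : 2 ≤ a) (h1 : G.pr 0 1 = 1)
    (hx : ∀ j u, G.pr (j + a) (S.x * u) = S.x * G.pr j u)
    (hσ : ∀ j q, G.pr j (S.σ q) = S.σ (K.pr j q))
    (hρ : ∀ j u, S.ρ.toAlgHom (G.pr j u) = K.pr j (S.ρ.toAlgHom u))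
    (hγ : ∀ j u, G.pr j (S.γ u) = S.γ (G.pr (j + a) u))
    (hN : S.x ^ N ∈ LinearMap.range A.d) (hQ : Q.IsPoincare K n) : ∃ m, A.IsPoincare G m := by
  have hvan : ∀ i, n + 2 ≤ i + a → ∀ z, G.pr i z = z → A.d z = 0 → z ∈ LinearMap.range A.d :=
    fun i hi z hz hdz => S.exact_of_x_pow_mul hx hρ hQ N i hi z hz hdz (exact_mul hN hdz)
  -- Otherwise `1` would be exact. The inequality makes `n + 1 - a` a genuine difference.
  have hna : a ≤ n + 1 := by
    by_contra hlt
    have hd1 : A.d 1 = 0 := by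
      have := A.leibniz 1 1
      simpa using this
    obtain ⟨u, hu⟩ := hvan 0 (by omega) 1 h1 hd1
    obtain ⟨j, c, hj, -⟩ := G.exists_homogeneous h1 hu one_ne_zero
    omega
  have hκpr : ∀ j q, G.pr j (S.κ q) = S.κ (K.pr (j + a - 1) q) := by
    intro j q
    change G.pr j (S.γ (A.d (S.σ q))) = S.γ (A.d (S.σ _))
    rw [hγ, show j + a = j + a - 1 + 1 by omega, G.pr_d, hσ]
    rfl
  obtain ⟨ω, hω, hωn, hωnd⟩ := hQ
  -- If `κ q` is exact, then `q` lifts to a cocycle of `A`. The degree `n` part of the lift is exact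
  -- because `a ≥ 2`, so `ω q = 0`.
  obtain ⟨ω', hω', hω'κ⟩ := exists_functional (A := A) (f := S.κ) (ω := ω) (by
    rintro q hq ⟨u, hu⟩
    have hc : A.d (S.σ q - S.x * u) = 0 := by
      rw [map_sub, S.d_σ, hq, map_zero, zero_add, S.d_x_mul, hu, sub_self]
    obtain ⟨v, hv⟩ := hvan n (by omega) (G.pr n (S.σ q - S.x * u)) (G.pr_pr _ _)
      (G.d_pr_eq_zero hc n)
    have hq' : S.ρ.toAlgHom (S.σ q - S.x * u) = q := by
      rw [map_sub, map_mul, S.ρ_x, zero_mul, S.ρ_σ, sub_zero]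
    rw [← hωn, ← hq', ← hρ, ← hv, S.ρ.map_d, hω])
  -- The extended functional need not be homogeneous, hence the projection.
  let ψ : A.carrier →ₗ[ℚ] ℚ := ω' ∘ₗ G.pr (n + 1 - a)
  have hψ : ∀ u, ψ (A.d u) = 0 := G.functional_pr_d hω' _
  have hψκ : ∀ q, Q.d q = 0 → ψ (S.κ q) = ω q := by
    intro q hq
    change ω' (G.pr (n + 1 - a) (S.κ q)) = _
    rw [hκpr, show n + 1 - a + a - 1 = n by omega, hω'κ _ (K.d_pr_eq_zero hq n), hωn]
  refine ⟨n + 1 - a, ψ, hψ, fun u => ?_, ?_⟩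
  · change ω' (G.pr _ (G.pr _ u)) = ω' _
    rw [G.pr_pr]
  rw [nondegenerate_iff hω] at hωnd
  rw [nondegenerate_iff hψ]
  refine injective_of_gysin hωnd (x := S.xH) (ρ := S.ρ.onH) (δ := S.κH) ?_ ?_ ?_ ?_ ?_
    ⟨N, ?_⟩ ?_ ?_
  · intro h hh
    obtain ⟨z, hz, rfl⟩ := exists_cls h
    obtain ⟨t, v, htv⟩ := S.lift_exact (u := z) (cls_eq_zero.1 hh)
    have hdv : A.d v = 0 := by
      apply S.x_injective
      rw [mul_zero, ← S.d_x_mul, ← hz, htv, map_add, A.d_d, zero_add]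
    refine ⟨cls v hdv, cls_eq_cls.2 ⟨-S.σ t, ?_⟩⟩
    change A.d (-S.σ t) = S.x * v - z
    rw [htv, map_neg]
    abel
  · intro h hh
    obtain ⟨q, hq, rfl⟩ := exists_cls h
    obtain ⟨u, hu⟩ := cls_eq_zero.1 hh
    change A.d u = S.κ q at hu
    have hc : A.d (S.σ q - S.x * u) = 0 := by
      rw [map_sub, S.d_σ, hq, map_zero, zero_add, S.d_x_mul, hu, sub_self]
    refine ⟨cls _ hc, cls_eq_cls.2 ?_⟩
    change S.ρ.toAlgHom (S.σ q - S.x * u) - q ∈ _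
    rw [map_sub, map_mul, S.ρ_x, zero_mul, S.ρ_σ, sub_zero, sub_self]
    exact Submodule.zero_mem _
  · intro h
    obtain ⟨z, hz, rfl⟩ := exists_cls h
    refine cls_eq_zero.2 ⟨-S.γ z, S.x_injective ?_⟩
    have h2 := S.decomp z
    have h3 : A.d (S.σ (S.ρ.toAlgHom z)) = S.x * S.κ (S.ρ.toAlgHom z) := by
      rw [S.d_σ, ← S.ρ.map_d, hz, map_zero, map_zero, zero_add]
    rw [← S.d_x_mul, mul_neg, map_neg, neg_eq_iff_add_eq_zero, add_comm]
    change S.x * S.κ (S.ρ.toAlgHom z) + _ = 0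
    rw [← h3, ← map_add, h2, hz]
  · intro h
    obtain ⟨q, hq, rfl⟩ := exists_cls h
    refine cls_eq_zero.2 ⟨S.σ q, ?_⟩
    rw [S.d_σ, hq, map_zero, zero_add]
    rfl
  · intro h hh
    obtain ⟨z, hz, rfl⟩ := exists_cls h
    obtain ⟨u, hu⟩ := cls_eq_zero.1 hh
    change A.d u = S.x * z at hu
    have hρu : Q.d (S.ρ.toAlgHom u) = 0 := by
      rw [← S.ρ.map_d, hu, map_mul, S.ρ_x, zero_mul]
    refine ⟨cls _ hρu, cls_eq_cls.2 ⟨-S.γ u, S.x_injective ?_⟩⟩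
    have h3 : A.d (S.σ (S.ρ.toAlgHom u)) = S.x * S.κ (S.ρ.toAlgHom u) := by
      rw [S.d_σ, hρu, map_zero, zero_add]
    have h4 : A.d u = A.d (S.σ (S.ρ.toAlgHom u)) + S.x * A.d (S.γ u) := by
      conv_lhs => rw [← S.decomp u, map_add, S.d_x_mul]
    change S.x * A.d (-S.γ u) = S.x * (S.κ (S.ρ.toAlgHom u) - z)
    rw [mul_sub, ← h3, ← hu, h4, map_neg, mul_neg]
    abel
  · refine LinearMap.ext fun h => ?_
    obtain ⟨z, hz, rfl⟩ := exists_cls h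
    rw [S.xH_pow]
    exact cls_eq_zero.2 (exact_mul hN hz)
  · intro k h
    obtain ⟨q, hq, rfl⟩ := exists_cls k
    obtain ⟨z, hz, rfl⟩ := exists_cls h
    change ψ (S.κ q * z) = ω (q * S.ρ.toAlgHom z)
    have hρz : Q.d (S.ρ.toAlgHom z) = 0 := by rw [← S.ρ.map_d, hz, map_zero]
    have hqz : Q.d (q * S.ρ.toAlgHom z) = 0 := by
      rw [Q.leibniz, hq, hρz, zero_mul, mul_zero, add_zero]
    rw [← hψκ _ hqz]
    -- The projection formula `δ (q · ρ z) = δ q · z`, with an explicit boundary.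
    have h4 : S.κ (q * S.ρ.toAlgHom z) = S.κ q * z - A.d (S.σ q * S.γ z) := by
      apply S.x_injective
      have h5 : A.d (S.σ q) = S.x * S.κ q := by rw [S.d_σ, hq, map_zero, zero_add]
      have h6 : A.d (S.σ (q * S.ρ.toAlgHom z)) = S.x * S.κ (q * S.ρ.toAlgHom z) := by
        rw [S.d_σ, hqz, map_zero, zero_add]
      rw [← h6, map_mul, eq_sub_of_add_eq (S.decomp z), mul_sub, map_sub, A.leibniz, hz, mul_zero,
        add_zero, h5, ← mul_assoc (S.σ q), S.mul_x, mul_assoc, mul_assoc, S.d_x_mul, mul_sub]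
    rw [h4, map_sub, hψ, sub_zero]
  · intro h h'
    obtain ⟨z, hz, rfl⟩ := exists_cls h
    obtain ⟨w, hw, rfl⟩ := exists_cls h'
    change ψ (S.x * z * w) = ψ (z * (S.x * w))
    rw [← S.mul_x, mul_assoc]

end EvenStep

/-! ### The Wang sequence of an odd generator -/

namespace OddStep

variable (S : OddStep A Q)

/-- The map of the Wang sequence induced by multiplication by `y`. -/
def yH : Q.H →ₗ[ℚ] A.H :=
  mapH (LinearMap.mulLeft ℚ S.y ∘ₗ S.σ.toLinearMap)
    (fun q hq => by
      change A.d (S.y * S.σ q) = 0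
      rw [S.d_y_σ, hq, map_zero, mul_zero, neg_zero])
    (fun q => ⟨-(S.y * S.σ q), by rw [map_neg, S.d_y_σ, neg_neg]; rfl⟩)

/-- The derivation of the Wang sequence. -/
def θH : Q.H →ₗ[ℚ] Q.H :=
  mapH S.θ (fun q hq => by rw [← S.θ_d, hq, map_zero]) (fun q => ⟨S.θ q, (S.θ_d q).symm⟩)

theorem y_σ_mul (q : Q.carrier) (z : A.carrier) :
    S.y * S.σ q * z = S.y * S.σ (q * S.ρ.toAlgHom z) := by
  conv_lhs => rw [← S.decomp z]
  have h : S.y * S.σ q * S.y = 0 := by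
    rw [S.y_mul, mul_assoc, S.y_y, mul_zero]
  rw [mul_add, ← mul_assoc _ S.y, h, zero_mul, add_zero, map_mul, mul_assoc]

/-- The functional of `Q` is transported along multiplication by `y`, so the new formal dimension is
`n + b`, and `injective_of_wang` applies. -/
theorem isPoincare [FiniteDimensional ℚ A.H] [FiniteDimensional ℚ Q.H]
    {G : A.Grading} {K : Q.Grading} {b n : ℕ} (hb : 2 ≤ b)
    (hy : ∀ j q, G.pr (j + b) (S.y * S.σ q) = S.y * S.σ (K.pr j q))
    (hσ : ∀ j q, G.pr j (S.σ q) = S.σ (K.pr j q))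
    (hγ : ∀ j u, K.pr j (S.γ u) = S.γ (G.pr (j + b) u))
    (hQ : Q.IsPoincare K n) : ∃ m, A.IsPoincare G m := by
  have hθpr : ∀ j q, K.pr j (S.θ q) = S.θ (K.pr (j + b - 1) q) := by
    intro j q
    change K.pr j (S.γ (A.d (S.σ q))) = S.γ (A.d (S.σ _))
    rw [hγ, show j + b = j + b - 1 + 1 by omega, G.pr_d, hσ]
    rfl
  have hQ' := hQ
  obtain ⟨ω, hω, hωn, hωnd⟩ := hQ
  -- If `y * σ q` is exact, then `q` is `θ` of a cocycle up to a boundary. The degree `n` part comes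
  -- from degree `n + b - 1 > n`, where cocycles of `Q` are exact, so `ω q = 0`.
  obtain ⟨ω', hω', hω'y⟩ := exists_functional (A := A)
    (f := LinearMap.mulLeft ℚ S.y ∘ₗ S.σ.toLinearMap) (ω := ω) (by
    rintro q hq ⟨v, hv⟩
    change A.d v = S.y * S.σ q at hv
    rw [← S.decomp v, map_add, S.d_σ, S.d_y_σ] at hv
    have h1 : S.σ (Q.d (S.ρ.toAlgHom v)) +
        S.y * S.σ (S.θ (S.ρ.toAlgHom v) - Q.d (S.γ v)) = S.σ 0 + S.y * S.σ q := by
      rw [map_sub, map_zero, zero_add, ← hv, mul_sub]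
      abel
    obtain ⟨h2, h3⟩ := S.σ_add_y_inj h1
    obtain ⟨t, ht⟩ := exact_of_degree_gt hQ' (i := n + b - 1) (by omega) (K.pr_pr _ _)
      (K.d_pr_eq_zero h2 _)
    rw [← h3, map_sub, hω, sub_zero, ← hωn, hθpr, ← ht, S.θ_d, hω])
  let ψ : A.carrier →ₗ[ℚ] ℚ := ω' ∘ₗ G.pr (n + b)
  have hψ : ∀ u, ψ (A.d u) = 0 := G.functional_pr_d hω' _
  have hψy : ∀ q, Q.d q = 0 → ψ (S.y * S.σ q) = ω q := by
    intro q hq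
    change ω' (G.pr (n + b) (S.y * S.σ q)) = _
    rw [hy, ← hωn, ← hω'y _ (K.d_pr_eq_zero hq n)]
    rfl
  refine ⟨n + b, ψ, hψ, fun u => ?_, ?_⟩
  · change ω' (G.pr _ (G.pr _ u)) = ω' _
    rw [G.pr_pr]
  have hωnd' := hωnd
  rw [nondegenerate_iff hω] at hωnd
  rw [nondegenerate_iff hψ]
  have hmul : ∀ q z, Q.d q = 0 → A.d z = 0 →
      ψ (S.y * S.σ q * z) = ω (q * S.ρ.toAlgHom z) := by
    intro q z hq hz
    rw [S.y_σ_mul, hψy]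
    rw [Q.leibniz, hq, ← S.ρ.map_d, hz, map_zero, zero_mul, mul_zero, add_zero]
  refine injective_of_wang hωnd (j := S.yH) (ρ := S.ρ.onH) (θ := S.θH) ?_ ?_ ?_ ?_ ?_
  · intro h hh
    obtain ⟨z, hz, rfl⟩ := exists_cls h
    obtain ⟨t, ht⟩ := cls_eq_zero.1 hh
    change Q.d t = S.ρ.toAlgHom z at ht
    set w := z - A.d (S.σ t)
    have hw : w = S.y * S.σ (S.γ w) := by
      have h1 := S.decomp w
      have h2 : S.ρ.toAlgHom w = 0 := by rw [map_sub, S.ρ.map_d, S.ρ_σ, ht, sub_self]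
      rw [h2, map_zero, zero_add] at h1
      exact h1.symm
    have hdw : A.d w = 0 := by rw [map_sub, hz, A.d_d, sub_zero]
    have hdγ : Q.d (S.γ w) = 0 := by
      have h3 := congrArg S.γ (hw ▸ hdw : A.d (S.y * S.σ (S.γ w)) = 0)
      rw [S.d_y_σ, map_neg, S.γ_y, map_zero, neg_eq_zero] at h3
      exact h3
    refine ⟨cls _ hdγ, cls_eq_cls.2 ⟨-S.σ t, ?_⟩⟩
    change A.d (-S.σ t) = S.y * S.σ (S.γ w) - z
    rw [← hw, map_neg]
    simp only [w]
    abel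
  · intro h hh
    obtain ⟨q, hq, rfl⟩ := exists_cls h
    obtain ⟨u, hu⟩ := cls_eq_zero.1 hh
    change Q.d u = S.θ q at hu
    have hc : A.d (S.σ q + S.y * S.σ u) = 0 := by
      rw [map_add, S.d_σ, S.d_y_σ, hq, hu, map_zero, zero_add, add_neg_cancel]
    refine ⟨cls _ hc, cls_eq_cls.2 ?_⟩
    change S.ρ.toAlgHom (S.σ q + S.y * S.σ u) - q ∈ _
    rw [map_add, map_mul, S.ρ_y, zero_mul, add_zero, S.ρ_σ, sub_self]
    exact Submodule.zero_mem _
  · intro h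
    obtain ⟨q, hq, rfl⟩ := exists_cls h
    refine cls_eq_zero.2 ⟨S.σ q, ?_⟩
    rw [S.d_σ, hq, map_zero, zero_add]
    rfl
  · intro k h
    obtain ⟨q, hq, rfl⟩ := exists_cls k
    obtain ⟨z, hz, rfl⟩ := exists_cls h
    exact hmul q z hq hz
  · intro h hh
    obtain ⟨z, hz, rfl⟩ := exists_cls h
    have hεz : A.d (A.ε z) = 0 := by rw [A.d_ε, hz, map_zero, neg_zero]
    -- Nondegeneracy is applied to `ε z` rather than `z`, because moving `z` past the odd element
    -- `y` applies `ε`.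
    have h1 : S.ρ.toAlgHom (A.ε z) ∈ LinearMap.range Q.d := by
      refine hωnd' _ (by rw [← S.ρ.map_d, hεz, map_zero]) fun q hq => ?_
      have hyq : A.d (S.y * S.σ q) = 0 := by rw [S.d_y_σ, hq, map_zero, mul_zero, neg_zero]
      have h2 : ψ (z * (S.y * S.σ q)) = 0 := hh (cls q hq)
      have h3 : z * (S.y * S.σ q) = S.y * S.σ (S.ρ.toAlgHom (A.ε z) * q) := by
        have h4 := S.y_σ_mul 1 (A.ε z * S.σ q)
        rw [map_one, mul_one, one_mul, map_mul, S.ρ_σ, ← mul_assoc, S.y_mul, A.ε_ε,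
          mul_assoc] at h4
        exact h4
      rw [h3, hψy] at h2
      · exact h2
      · rw [Q.leibniz, hq, ← S.ρ.map_d, hεz, map_zero, zero_mul, mul_zero, add_zero]
    obtain ⟨u, hu⟩ := h1
    refine cls_eq_zero.2 ⟨-Q.ε u, ?_⟩
    rw [map_neg, Q.d_ε, neg_neg, hu, S.ρ.map_ε, Q.ε_ε]
    rfl

end OddStep

end SuperCDGA

/-! ### Monomials in a minimal Sullivan algebra -/

namespace MinimalSullivanAlgebra

open Finsupp

variable (M : MinimalSullivanAlgebra.{u})

/-- The product of a list of generators. -/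
def genProd (l : List M.ι) : M.carrier := (l.map M.gen).prod

/-- The ordered monomial with exponents `m`. -/
def mono (m : M.ι →₀ ℕ) : M.carrier := orderedMonomial M.gen m

/-- Generators of odd degree occur at most once. -/
def Valid (m : M.ι →₀ ℕ) : Prop := ∀ i, Odd (M.deg i) → m i ≤ 1

theorem gen_mul_gen (i j : M.ι) :
    ∃ c : ℚ, c ≠ 0 ∧ M.gen i * M.gen j = c • (M.gen j * M.gen i) :=
  ⟨_, pow_ne_zero _ (by norm_num), M.graded_comm _ _ _ _ (M.gen_mem i) (M.gen_mem j)⟩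

theorem gen_mul_self {i : M.ι} (h : Odd (M.deg i)) : M.gen i * M.gen i = 0 := by
  have h1 := M.graded_comm _ _ _ _ (M.gen_mem i) (M.gen_mem i)
  rw [(h.mul h).neg_one_pow, neg_one_smul, eq_neg_iff_add_eq_zero, ← two_smul ℚ] at h1
  simpa using h1

/-- Signs of reorderings are never computed. Only their nonvanishing matters, since the later
arguments concern spans of monomials. -/
theorem genProd_perm {l l' : List M.ι} (h : l.Perm l') :
    ∃ c : ℚ, c ≠ 0 ∧ M.genProd l = c • M.genProd l' := by
  induction h with
  | nil => exact ⟨1, one_ne_zero, by simp⟩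
  | cons i _ ih =>
    obtain ⟨c, hc, h⟩ := ih
    refine ⟨c, hc, ?_⟩
    simp only [genProd, List.map_cons, List.prod_cons] at h ⊢
    rw [h, mul_smul_comm]
  | swap i j l =>
    obtain ⟨c, hc, h⟩ := M.gen_mul_gen j i
    refine ⟨c, hc, ?_⟩
    simp only [genProd, List.map_cons, List.prod_cons]
    rw [← mul_assoc, h, smul_mul_assoc, mul_assoc]
  | trans _ _ ih₁ ih₂ =>
    obtain ⟨c, hc, h⟩ := ih₁
    obtain ⟨c', hc', h'⟩ := ih₂
    exact ⟨c * c', mul_ne_zero hc hc', by rw [h, h', smul_smul]⟩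

theorem exists_mono_eq_genProd (m : M.ι →₀ ℕ) :
    ∃ l : List M.ι, (l : Multiset M.ι) = Finsupp.toMultiset m ∧ M.mono m = M.genProd l := by
  refine ⟨(m.support.sort (· ≤ ·)).flatMap fun i => List.replicate (m i) i, ?_, ?_⟩
  · rw [← Multiset.coe_bind, Finset.sort_eq, Finsupp.toMultiset_apply, Finsupp.sum,
      Multiset.bind]
    change (Multiset.map (fun i => (List.replicate (m i) i : Multiset M.ι)) _).sum = _
    rw [Finset.sum]
    congr 1
    refine Multiset.map_congr rfl fun i _ => ?_
    rw [Multiset.nsmul_singleton]; rfl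
  · rw [mono, orderedMonomial, genProd]
    induction m.support.sort (· ≤ ·) with
    | nil => simp
    | cons i l ih => simp [ih]

theorem genProd_eq (l : List M.ι) : ∃ c : ℚ, c ≠ 0 ∧
    M.genProd l = c • M.mono (Multiset.toFinsupp (l : Multiset M.ι)) := by
  obtain ⟨l', hl', h⟩ := M.exists_mono_eq_genProd (Multiset.toFinsupp (l : Multiset M.ι))
  rw [Multiset.toFinsupp_toMultiset, Multiset.coe_eq_coe] at hl'
  rw [h]
  exact M.genProd_perm hl'.symm

theorem genProd_append (l l' : List M.ι) : M.genProd (l ++ l') = M.genProd l * M.genProd l' := by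
  simp [genProd]

theorem mono_mul_mono (m m' : M.ι →₀ ℕ) :
    ∃ c : ℚ, c ≠ 0 ∧ M.mono m * M.mono m' = c • M.mono (m + m') := by
  obtain ⟨l, hl, h⟩ := M.exists_mono_eq_genProd m
  obtain ⟨l', hl', h'⟩ := M.exists_mono_eq_genProd m'
  obtain ⟨c, hc, hcl⟩ := M.genProd_eq (l ++ l')
  refine ⟨c, hc, ?_⟩
  rw [h, h', ← genProd_append, hcl, ← Multiset.coe_add, hl, hl', ← map_add,
    Finsupp.toMultiset_toFinsupp]

theorem mono_zero : M.mono 0 = 1 := by simp [mono, orderedMonomial]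

theorem mono_single (i : M.ι) : M.mono (single i 1) = M.gen i := by
  rw [mono, orderedMonomial, Finsupp.support_single _ one_ne_zero]
  simp

theorem mono_of_not_valid {m : M.ι →₀ ℕ} (h : ¬M.Valid m) : M.mono m = 0 := by
  simp only [Valid, not_forall, not_le] at h
  obtain ⟨i, hi, hm⟩ := h
  rw [mono, orderedMonomial]
  refine List.prod_eq_zero ?_
  rw [List.mem_map]
  refine ⟨i, ?_, ?_⟩
  · rw [Finset.mem_sort, Finsupp.mem_support_iff]
    omega
  · obtain ⟨k, hk⟩ := Nat.exists_eq_add_of_le hm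
    rw [hk, pow_add, pow_two, M.gen_mul_self hi, zero_mul]

/-- The basis of monomials. -/
noncomputable def basis : Module.Basis {m : M.ι →₀ ℕ // M.Valid m} ℚ M.carrier :=
  Module.Basis.mk (v := fun m => M.mono m.1) M.linearIndependent M.span_eq_top.ge

@[simp]
theorem basis_apply (m : {m : M.ι →₀ ℕ // M.Valid m}) : M.basis m = M.mono m.1 := by
  exact Module.Basis.mk_apply _ _ _

theorem mono_induction {p : M.carrier → Prop} (hm : ∀ m, M.Valid m → p (M.mono m)) (h0 : p 0)
    (hadd : ∀ a b, p a → p b → p (a + b)) (hsmul : ∀ (c : ℚ) a, p a → p (c • a))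
    (a : M.carrier) : p a := by
  have : a ∈ Submodule.span ℚ (Set.range M.basis) := by rw [M.basis.span_eq]; trivial
  induction this using Submodule.span_induction with
  | mem x hx =>
    obtain ⟨m, rfl⟩ := hx
    rw [basis_apply]
    exact hm _ m.2
  | zero => exact h0
  | add x y _ _ hx hy => exact hadd _ _ hx hy
  | smul c x _ hx => exact hsmul _ _ hx

theorem linearMap_ext {N : Type*} [AddCommGroup N] [Module ℚ N] {f g : M.carrier →ₗ[ℚ] N}
    (h : ∀ m, M.Valid m → f (M.mono m) = g (M.mono m)) : f = g :=
  M.basis.ext fun m => by rw [basis_apply]; exact h _ m.2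

open Classical in
/-- The projection onto the span of the monomials satisfying `T`. -/
noncomputable def proj (T : (M.ι →₀ ℕ) → Prop) : M.carrier →ₗ[ℚ] M.carrier :=
  M.basis.constr ℚ fun m => if T m.1 then M.mono m.1 else 0

open Classical in
theorem proj_mono (T : (M.ι →₀ ℕ) → Prop) (m : M.ι →₀ ℕ) :
    M.proj T (M.mono m) = if T m then M.mono m else 0 := by
  by_cases h : M.Valid m
  · have := M.basis.constr_basis ℚ (fun m => if T m.1 then M.mono m.1 else 0) ⟨m, h⟩
    rwa [basis_apply] at this
  · rw [M.mono_of_not_valid h, map_zero, ite_self]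

theorem proj_mono_of {T : (M.ι →₀ ℕ) → Prop} {m : M.ι →₀ ℕ} (h : T m) :
    M.proj T (M.mono m) = M.mono m := by rw [proj_mono, if_pos h]

theorem proj_mono_of_not {T : (M.ι →₀ ℕ) → Prop} {m : M.ι →₀ ℕ} (h : ¬T m) :
    M.proj T (M.mono m) = 0 := by rw [proj_mono, if_neg h]

theorem proj_proj (T T' : (M.ι →₀ ℕ) → Prop) (a : M.carrier) :
    M.proj T (M.proj T' a) = M.proj (fun m => T m ∧ T' m) a := by
  refine LinearMap.congr_fun (f := M.proj T ∘ₗ M.proj T') (M.linearMap_ext fun m _ => ?_) a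
  rw [LinearMap.comp_apply]
  by_cases h' : T' m
  · by_cases h : T m
    · rw [M.proj_mono_of h', M.proj_mono_of h, M.proj_mono_of ⟨h, h'⟩]
    · rw [M.proj_mono_of h', M.proj_mono_of_not h, M.proj_mono_of_not (fun h2 => h h2.1)]
  · rw [M.proj_mono_of_not h', map_zero, M.proj_mono_of_not (fun h2 => h' h2.2)]

/-- The span of the monomials satisfying `T`. -/
def coordSpan (T : (M.ι →₀ ℕ) → Prop) : Submodule ℚ M.carrier :=
  Submodule.span ℚ (M.mono '' {m | T m})

variable {M}

theorem mono_mem {T : (M.ι →₀ ℕ) → Prop} {m : M.ι →₀ ℕ} (h : T m) : M.mono m ∈ M.coordSpan T :=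
  Submodule.subset_span ⟨m, h, rfl⟩

theorem proj_mem (T : (M.ι →₀ ℕ) → Prop) (a : M.carrier) : M.proj T a ∈ M.coordSpan T := by
  induction a using M.mono_induction with
  | hm m _ =>
    by_cases h : T m
    · rw [M.proj_mono_of h]; exact mono_mem h
    · rw [M.proj_mono_of_not h]; exact Submodule.zero_mem _
  | h0 => rw [map_zero]; exact Submodule.zero_mem _
  | hadd a b ha hb => rw [map_add]; exact Submodule.add_mem _ ha hb
  | hsmul c a ha => rw [map_smul]; exact Submodule.smul_mem _ _ ha

theorem coordSpan_le {T : (M.ι →₀ ℕ) → Prop} {S : Submodule ℚ M.carrier}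
    (h : ∀ m, T m → M.mono m ∈ S) : M.coordSpan T ≤ S := by
  rw [coordSpan, Submodule.span_le]
  rintro _ ⟨m, hm, rfl⟩
  exact h m hm

theorem mem_coordSpan_iff {T : (M.ι →₀ ℕ) → Prop} {a : M.carrier} :
    a ∈ M.coordSpan T ↔ M.proj T a = a := by
  refine ⟨fun h => ?_, fun h => h ▸ proj_mem T a⟩
  have : M.coordSpan T ≤ LinearMap.eqLocus (M.proj T) LinearMap.id :=
    coordSpan_le fun m hm => M.proj_mono_of hm
  exact this h

theorem coordSpan_mono {T T' : (M.ι →₀ ℕ) → Prop} (h : ∀ m, T m → T' m) :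
    M.coordSpan T ≤ M.coordSpan T' := coordSpan_le fun m hm => mono_mem (h m hm)

theorem mem_coordSpan_and {T T' : (M.ι →₀ ℕ) → Prop} {a : M.carrier} (h : a ∈ M.coordSpan T)
    (h' : a ∈ M.coordSpan T') : a ∈ M.coordSpan fun m => T m ∧ T' m := by
  rw [mem_coordSpan_iff] at *
  rw [← proj_proj, h', h]

theorem proj_mem_of_mem {T T' : (M.ι →₀ ℕ) → Prop} {a : M.carrier} (h : a ∈ M.coordSpan T) :
    M.proj T' a ∈ M.coordSpan fun m => T' m ∧ T m := by
  rw [mem_coordSpan_iff] at h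
  rw [← h, proj_proj]
  exact proj_mem _ _

theorem proj_eq_zero_iff {T : (M.ι →₀ ℕ) → Prop} {a : M.carrier} :
    M.proj T a = 0 ↔ a ∈ M.coordSpan fun m => ¬T m := by
  constructor
  · intro h
    have h2 : M.proj T a + M.proj (fun m => ¬T m) a = a := by
      refine LinearMap.congr_fun (f := M.proj T + M.proj fun m => ¬T m) (g := LinearMap.id)
        (M.linearMap_ext fun m _ => ?_) a
      rw [LinearMap.add_apply, proj_mono, proj_mono]
      split_ifs <;> simp
    rw [h, zero_add] at h2
    exact mem_coordSpan_iff.2 h2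
  · intro h
    have : M.coordSpan (fun m => ¬T m) ≤ LinearMap.ker (M.proj T) :=
      coordSpan_le fun m hm => M.proj_mono_of_not hm
    exact this h

theorem mul_mem_coordSpan {T T' T'' : (M.ι →₀ ℕ) → Prop} (h : ∀ m m', T m → T' m' → T'' (m + m'))
    {a b : M.carrier} (ha : a ∈ M.coordSpan T) (hb : b ∈ M.coordSpan T') :
    a * b ∈ M.coordSpan T'' := by
  have : M.coordSpan T * M.coordSpan T' ≤ M.coordSpan T'' := by
    rw [coordSpan, coordSpan, Submodule.span_mul_span, Submodule.span_le]
    rintro _ ⟨_, ⟨m, hm, rfl⟩, _, ⟨m', hm', rfl⟩, rfl⟩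
    obtain ⟨c, -, hc⟩ := M.mono_mul_mono m m'
    change M.mono m * M.mono m' ∈ _
    rw [hc]
    exact Submodule.smul_mem _ _ (mono_mem (h m m' hm hm'))
  exact this (Submodule.mul_mem_mul ha hb)

theorem one_mem_coordSpan {T : (M.ι →₀ ℕ) → Prop} (h : T 0) : (1 : M.carrier) ∈ M.coordSpan T := by
  rw [← mono_zero]; exact mono_mem h

theorem gen_mem_coordSpan {T : (M.ι →₀ ℕ) → Prop} {i : M.ι} (h : T (single i 1)) :
    M.gen i ∈ M.coordSpan T := by
  rw [← mono_single]; exact mono_mem h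

/-! ### Weights -/

/-- The weight `∑ m i * w i` of the exponent vector `m`. -/
def wt {ι : Type u} (w : ι → ℕ) (m : ι →₀ ℕ) : ℕ := m.sum fun i k => k * w i

@[simp] theorem wt_zero {ι : Type u} (w : ι → ℕ) : wt w 0 = 0 := Finsupp.sum_zero_index

@[simp] theorem wt_add {ι : Type u} (w : ι → ℕ) (m m' : ι →₀ ℕ) :
    wt w (m + m') = wt w m + wt w m' :=
  Finsupp.sum_add_index' (fun _ => by simp) (fun _ _ _ => by ring)

@[simp] theorem wt_single {ι : Type u} (w : ι → ℕ) (i : ι) (k : ℕ) :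
    wt w (single i k) = k * w i := Finsupp.sum_single_index (by simp)

theorem wt_mono {ι : Type u} {w w' : ι → ℕ} (h : ∀ i, w i ≤ w' i) (m : ι →₀ ℕ) :
    wt w m ≤ wt w' m := Finset.sum_le_sum fun i _ => Nat.mul_le_mul_left _ (h i)

theorem le_wt {ι : Type u} (w : ι → ℕ) {m : ι →₀ ℕ} {i : ι} (h : m i ≠ 0) : w i ≤ wt w m := by
  have h1 : m i * w i ≤ wt w m :=
    Finset.single_le_sum (f := fun i => m i * w i) (fun _ _ => Nat.zero_le _)
      (Finsupp.mem_support_iff.2 h)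
  exact (Nat.le_mul_of_pos_left _ (Nat.pos_of_ne_zero h)).trans h1

variable (M)

/-- The degree of a monomial. -/
abbrev dg (m : M.ι →₀ ℕ) : ℕ := wt M.deg m

theorem genProd_mem_gr (l : List M.ι) :
    M.genProd l ∈ M.gr (M.dg (Multiset.toFinsupp (l : Multiset M.ι))) := by
  induction l with
  | nil =>
    have : M.dg (Multiset.toFinsupp (([] : List M.ι) : Multiset M.ι)) = 0 := by simp [dg]
    rw [this]
    exact SetLike.GradedOne.one_mem
  | cons i l ih =>
    have : M.dg (Multiset.toFinsupp ((i :: l : List M.ι) : Multiset M.ι)) =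
        M.deg i + M.dg (Multiset.toFinsupp (l : Multiset M.ι)) := by
      rw [← Multiset.cons_coe, ← Multiset.singleton_add, map_add, dg, wt_add,
        Multiset.toFinsupp_singleton, wt_single, one_mul]
    rw [this]
    exact SetLike.GradedMul.mul_mem (M.gen_mem i) ih

theorem mono_mem_gr (m : M.ι →₀ ℕ) : M.mono m ∈ M.gr (M.dg m) := by
  obtain ⟨l, hl, h⟩ := M.exists_mono_eq_genProd m
  have := M.genProd_mem_gr l
  rwa [hl, Finsupp.toMultiset_toFinsupp, ← h] at this

/-- The projection onto degree `n` given by the abstract grading and the coordinate projection agree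
on the monomial basis. -/
theorem gr_eq (n : ℕ) : M.gr n = M.coordSpan fun m => M.dg m = n := by
  apply le_antisymm
  · intro a ha
    let P : M.carrier →ₗ[ℚ] M.carrier := (M.gr n).subtype ∘ₗ
      DirectSum.component ℚ ℕ (fun i => M.gr i) n ∘ₗ (DirectSum.decomposeLinearEquiv M.gr).toLinearMap
    have hP : ∀ b, P b = DirectSum.decompose M.gr b n := fun b => rfl
    have h1 : P = M.proj fun m => M.dg m = n := by
      refine M.linearMap_ext fun m _ => ?_
      rw [hP]
      by_cases h : M.dg m = n
      · subst h
        rw [DirectSum.decompose_of_mem_same _ (M.mono_mem_gr m),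
          M.proj_mono_of (T := fun m' => M.dg m' = M.dg m) rfl]
      · rw [M.proj_mono_of_not h, DirectSum.decompose_of_mem_ne _ (M.mono_mem_gr m) h]
    rw [mem_coordSpan_iff, ← h1, hP, DirectSum.decompose_of_mem_same _ ha]
  · exact coordSpan_le fun m hm => hm ▸ M.mono_mem_gr m

theorem d_gen_mem (i : M.ι) :
    M.d (M.gen i) ∈ M.coordSpan fun m => M.dg m = M.deg i + 1 ∧ 2 ≤ wt (fun _ => 1) m := by
  refine mem_coordSpan_and ?_ ?_
  · rw [← gr_eq]
    exact M.d_mem _ _ (M.gen_mem i)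
  · have h1 : M.augmentationIdeal ≤ M.coordSpan fun m => 1 ≤ wt (fun _ => 1) m := by
      refine iSup_le fun n => ?_
      rw [gr_eq]
      refine coordSpan_mono fun m hm => ?_
      have : m ≠ 0 := by rintro rfl; simp [dg] at hm
      obtain ⟨j, hj⟩ := Finsupp.ne_iff.1 this
      exact le_wt (fun _ => 1) hj
    have h2 : M.augmentationIdeal * M.augmentationIdeal ≤
        M.coordSpan fun m => 2 ≤ wt (fun _ => 1) m :=
      Submodule.mul_le.2 fun a ha b hb => mul_mem_coordSpan
        (fun m m' hm hm' => by rw [wt_add]; omega) (h1 ha) (h1 hb)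
    exact h2 (M.minimal i)

theorem d_genProd_cons (i : M.ι) (l : List M.ι) :
    M.d (M.genProd (i :: l)) = M.d (M.gen i) * M.genProd l +
      (-1 : ℚ) ^ M.deg i • (M.gen i * M.d (M.genProd l)) := by
  rw [genProd, List.map_cons, List.prod_cons, M.leibniz _ _ _ (M.gen_mem i)]
  rfl

theorem d_one : M.d 1 = 0 := by
  have := M.leibniz 0 1 1 SetLike.GradedOne.one_mem
  simpa using this

/-- By the Leibniz rule a weight increase by `c` on generators persists on products. The cases used
are `c = 0` for the even weight and `c = 1` for the word length. -/
theorem d_mono_mem {w : M.ι → ℕ} {c : ℕ}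
    (h : ∀ i, M.d (M.gen i) ∈ M.coordSpan fun m => w i + c ≤ wt w m) (m : M.ι →₀ ℕ) :
    M.d (M.mono m) ∈ M.coordSpan fun m' => wt w m + c ≤ wt w m' := by
  have key : ∀ l : List M.ι, M.d (M.genProd l) ∈ M.coordSpan fun m' =>
      wt w (Multiset.toFinsupp (l : Multiset M.ι)) + c ≤ wt w m' := by
    intro l
    induction l with
    | nil => simp [genProd, d_one]
    | cons i l ih =>
      have h1 : wt w (Multiset.toFinsupp ((i :: l : List M.ι) : Multiset M.ι)) =
          w i + wt w (Multiset.toFinsupp (l : Multiset M.ι)) := by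
        rw [← Multiset.cons_coe, ← Multiset.singleton_add, map_add, wt_add,
          Multiset.toFinsupp_singleton, wt_single, one_mul]
      obtain ⟨e, -, hl⟩ := M.genProd_eq l
      rw [d_genProd_cons, h1]
      refine Submodule.add_mem _ ?_ (Submodule.smul_mem _ _ ?_)
      · rw [hl, mul_smul_comm]
        refine Submodule.smul_mem _ _ (mul_mem_coordSpan ?_ (h i)
          (mono_mem (T := fun m' => m' = Multiset.toFinsupp (l : Multiset M.ι)) rfl))
        rintro a b ha rfl
        rw [wt_add]; omega
      · refine mul_mem_coordSpan ?_
          (gen_mem_coordSpan (T := fun m' => m' = single i 1) rfl) ih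
        rintro a b rfl hb
        rw [wt_add, wt_single]; omega
  obtain ⟨l, hl, hm⟩ := M.exists_mono_eq_genProd m
  have := key l
  rwa [hl, Finsupp.toMultiset_toFinsupp, ← hm] at this

/-- The even weight: the degree plus the number of odd factors. -/
def ew (i : M.ι) : ℕ := if Even (M.deg i) then M.deg i else M.deg i + 1

theorem deg_le_ew (i : M.ι) : M.deg i ≤ M.ew i := by
  rw [ew]; split_ifs <;> omega

theorem even_wt_ew (m : M.ι →₀ ℕ) : Even (wt M.ew m) := by
  refine Finset.even_sum _ fun i _ => Even.mul_left ?_ _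
  rw [ew]
  split_ifs with h
  · exact h
  · exact (Nat.not_even_iff_odd.1 h).add_one

/-- The differential of a generator has degree `deg i + 1`, which is at least the weight of the
generator, and the weight of a monomial is at least its degree. -/
theorem d_mono_mem_ew (m : M.ι →₀ ℕ) :
    M.d (M.mono m) ∈ M.coordSpan fun m' => wt M.ew m ≤ wt M.ew m' := by
  refine M.d_mono_mem (c := 0) (fun i => coordSpan_mono ?_ (M.d_gen_mem i)) m
  rintro m' ⟨h, -⟩
  have h1 : M.dg m' ≤ wt M.ew m' := wt_mono M.deg_le_ew m'
  have h2 : M.ew i ≤ M.deg i + 1 := by rw [ew]; split_ifs <;> omega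
  omega

theorem d_mono_mem_length (m : M.ι →₀ ℕ) :
    M.d (M.mono m) ∈ M.coordSpan fun m' => wt (fun _ => 1) m + 1 ≤ wt (fun _ => 1) m' := by
  refine M.d_mono_mem (c := 1) (fun i => coordSpan_mono ?_ (M.d_gen_mem i)) m
  rintro m' ⟨-, h⟩
  exact h

theorem gen_mul_mono (i : M.ι) (m : M.ι →₀ ℕ) :
    ∃ c : ℚ, c ≠ 0 ∧ M.gen i * M.mono m = c • M.mono (m + single i 1) := by
  obtain ⟨c, hc, h⟩ := M.mono_mul_mono (single i 1) m
  rw [mono_single, add_comm] at h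
  exact ⟨c, hc, h⟩

/-- The coefficient of the generator `v`: the linear map with `v * m ↦ m` which kills the monomials
not containing `v`. -/
noncomputable def coeffGen (v : M.ι) : M.carrier →ₗ[ℚ] M.carrier :=
  M.basis.constr ℚ fun m => if m.1 v = 0 then 0 else
    ((M.gen_mul_mono v (m.1 - single v 1)).choose)⁻¹ • M.mono (m.1 - single v 1)

theorem coeffGen_mono_of_eq_zero {v : M.ι} {m : M.ι →₀ ℕ} (h : m v = 0) :
    M.coeffGen v (M.mono m) = 0 := by
  by_cases hm : M.Valid m
  · have := M.basis.constr_basis ℚ (fun m => if m.1 v = 0 then 0 else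
      ((M.gen_mul_mono v (m.1 - single v 1)).choose)⁻¹ • M.mono (m.1 - single v 1)) ⟨m, hm⟩
    rw [basis_apply, if_pos h] at this
    exact this
  · rw [M.mono_of_not_valid hm, map_zero]

/-- For odd `v` the square of the generator vanishes, so it must not already occur in `m`. -/
theorem coeffGen_gen_mul_mono {v : M.ι} {m : M.ι →₀ ℕ} (h : Even (M.deg v) ∨ m v = 0) :
    M.coeffGen v (M.gen v * M.mono m) = M.mono m := by
  by_cases hm : M.Valid m
  · have hm' : M.Valid (m + single v 1) := by
      intro i hi
      rw [Finsupp.add_apply]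
      by_cases hiv : i = v
      · subst hiv
        have : m i = 0 := h.resolve_left (Nat.not_even_iff_odd.2 hi)
        simp [this]
      · rw [Finsupp.single_apply, if_neg (Ne.symm hiv)]
        exact hm i hi
    have h1 := M.basis.constr_basis ℚ (fun m => if m.1 v = 0 then 0 else
      ((M.gen_mul_mono v (m.1 - single v 1)).choose)⁻¹ • M.mono (m.1 - single v 1))
      ⟨m + single v 1, hm'⟩
    rw [basis_apply, if_neg (by simp)] at h1
    change M.coeffGen v (M.mono (m + single v 1)) = _ at h1
    have hs := (M.gen_mul_mono v m).choose_spec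
    rw [hs.2, map_smul, h1]
    simp only [add_tsub_cancel_right]
    rw [smul_inv_smul₀ hs.1]
  · rw [M.mono_of_not_valid hm, mul_zero, map_zero]

theorem exists_gen_mul {v : M.ι} {m : M.ι →₀ ℕ} (h : m v ≠ 0) :
    ∃ c : ℚ, c ≠ 0 ∧ M.mono m = c • (M.gen v * M.mono (m - single v 1)) := by
  obtain ⟨c, hc, hcm⟩ := M.gen_mul_mono v (m - single v 1)
  refine ⟨c⁻¹, inv_ne_zero hc, ?_⟩
  rw [hcm, inv_smul_smul₀ hc, tsub_add_cancel_of_le]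
  rw [Finsupp.single_le_iff]
  omega

theorem coeffGen_mono_mem (v : M.ι) (m : M.ι →₀ ℕ) :
    M.coeffGen v (M.mono m) ∈ M.coordSpan fun m' => m' + single v 1 = m := by
  by_cases h : m v = 0
  · rw [M.coeffGen_mono_of_eq_zero h]; exact Submodule.zero_mem _
  by_cases hm : M.Valid m
  · obtain ⟨c, -, hc⟩ := M.exists_gen_mul h
    rw [hc, map_smul, coeffGen_gen_mul_mono]
    · refine Submodule.smul_mem _ _ (mono_mem (tsub_add_cancel_of_le ?_))
      rw [Finsupp.single_le_iff]; omega
    · rcases Nat.even_or_odd (M.deg v) with he | ho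
      · exact Or.inl he
      · right
        have := hm v ho
        simp only [Finsupp.coe_tsub, Pi.sub_apply, Finsupp.single_eq_same]
        omega
  · rw [M.mono_of_not_valid hm, map_zero]; exact Submodule.zero_mem _

end MinimalSullivanAlgebra

/-! ### The quotients of a minimal Sullivan algebra by the generators of low degree -/

namespace MinimalSullivanAlgebra

open Finsupp

variable (M : MinimalSullivanAlgebra.{u})

theorem map_mul_of_mono {f : M.carrier →ₗ[ℚ] M.carrier}
    (h : ∀ m m', f (M.mono m * M.mono m') = f (M.mono m) * f (M.mono m')) (a b : M.carrier) :
    f (a * b) = f a * f b := by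
  induction a using M.mono_induction with
  | hm m _ =>
    induction b using M.mono_induction with
    | hm m' _ => exact h m m'
    | h0 => simp
    | hadd a b ha hb => rw [mul_add, map_add, ha, hb, map_add, mul_add]
    | hsmul c a ha => rw [mul_smul_comm, map_smul, ha, map_smul, mul_smul_comm]
  | h0 => simp
  | hadd a b ha hb => rw [add_mul, map_add, ha, hb, map_add, add_mul]
  | hsmul c a ha => rw [smul_mul_assoc, map_smul, ha, map_smul, smul_mul_assoc]

/-- The parity involution as a linear map. -/
noncomputable def parLin : M.carrier →ₗ[ℚ] M.carrier :=
  M.basis.constr ℚ fun m => (-1 : ℚ) ^ M.dg m.1 • M.mono m.1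

theorem parLin_mono (m : M.ι →₀ ℕ) : M.parLin (M.mono m) = (-1 : ℚ) ^ M.dg m • M.mono m := by
  by_cases h : M.Valid m
  · have := M.basis.constr_basis ℚ (fun m => (-1 : ℚ) ^ M.dg m.1 • M.mono m.1) ⟨m, h⟩
    rwa [basis_apply] at this
  · rw [M.mono_of_not_valid h, map_zero, smul_zero]

/-- The parity involution. -/
noncomputable def par : M.carrier →ₐ[ℚ] M.carrier :=
  AlgHom.ofLinearMap M.parLin (by rw [← mono_zero, parLin_mono]; simp) <| by
    refine M.map_mul_of_mono fun m m' => ?_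
    obtain ⟨c, -, hc⟩ := M.mono_mul_mono m m'
    rw [hc, map_smul, parLin_mono, parLin_mono, parLin_mono, smul_mul_smul_comm, hc, dg, wt_add,
      pow_add, smul_comm]

theorem dg_add (m m' : M.ι →₀ ℕ) : M.dg (m + m') = M.dg m + M.dg m' := wt_add _ _ _

theorem par_mono (m : M.ι →₀ ℕ) : M.par (M.mono m) = (-1 : ℚ) ^ M.dg m • M.mono m :=
  M.parLin_mono m

theorem par_mem {T : (M.ι →₀ ℕ) → Prop} {a : M.carrier} (h : a ∈ M.coordSpan T) :
    M.par a ∈ M.coordSpan T := by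
  have : M.coordSpan T ≤ (M.coordSpan T).comap M.par.toLinearMap := coordSpan_le fun m hm => by
    rw [Submodule.mem_comap, AlgHom.toLinearMap_apply, par_mono]
    exact Submodule.smul_mem _ _ (mono_mem hm)
  exact this h

theorem par_of_mem_gr {n : ℕ} {a : M.carrier} (h : a ∈ M.coordSpan fun m => M.dg m = n) :
    M.par a = (-1 : ℚ) ^ n • a := by
  have : M.coordSpan (fun m => M.dg m = n) ≤
      LinearMap.eqLocus M.par.toLinearMap ((-1 : ℚ) ^ n • LinearMap.id) :=
    coordSpan_le fun m hm => by subst hm; exact M.par_mono m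
  exact this h

theorem par_par (a : M.carrier) : M.par (M.par a) = a := by
  refine LinearMap.congr_fun (f := M.par.toLinearMap ∘ₗ M.par.toLinearMap) (g := LinearMap.id)
    (M.linearMap_ext fun m _ => ?_) a
  simp only [LinearMap.comp_apply, AlgHom.toLinearMap_apply, LinearMap.id_apply]
  rw [par_mono, map_smul, par_mono, smul_smul, ← pow_add, Even.neg_one_pow ⟨_, rfl⟩, one_smul]

theorem d_mono_mem_gr (m : M.ι →₀ ℕ) :
    M.d (M.mono m) ∈ M.coordSpan fun m' => M.dg m' = M.dg m + 1 := by
  rw [← gr_eq]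
  exact M.d_mem _ _ (M.mono_mem_gr m)

theorem d_par (a : M.carrier) : M.d (M.par a) = -M.par (M.d a) := by
  refine LinearMap.congr_fun (f := M.d ∘ₗ M.par.toLinearMap) (g := -(M.par.toLinearMap ∘ₗ M.d))
    (M.linearMap_ext fun m _ => ?_) a
  simp only [LinearMap.comp_apply, AlgHom.toLinearMap_apply, LinearMap.neg_apply]
  rw [par_mono, map_smul, M.par_of_mem_gr (M.d_mono_mem_gr m), pow_succ, mul_neg_one, neg_smul,
    neg_neg]

theorem leibniz_par (a b : M.carrier) : M.d (a * b) = M.d a * b + M.par a * M.d b := by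
  induction a using M.mono_induction with
  | hm m _ => rw [M.leibniz _ _ _ (M.mono_mem_gr m), par_mono, smul_mul_assoc]
  | h0 => simp
  | hadd a b ha hb => rw [add_mul, map_add, ha, hb, map_add, map_add]; noncomm_ring
  | hsmul c a ha => simp only [smul_mul_assoc, map_smul, ha, smul_add]

theorem proj_add_proj_not (T : (M.ι →₀ ℕ) → Prop) (a : M.carrier) :
    M.proj T a + M.proj (fun m => ¬T m) a = a := by
  refine LinearMap.congr_fun (f := M.proj T + M.proj fun m => ¬T m) (g := LinearMap.id)
    (M.linearMap_ext fun m _ => ?_) a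
  rw [LinearMap.add_apply, proj_mono, proj_mono]
  split_ifs <;> simp

theorem par_eq (a : M.carrier) :
    M.par a = M.proj (fun m => Even (M.dg m)) a - M.proj (fun m => ¬Even (M.dg m)) a := by
  refine LinearMap.congr_fun (f := M.par.toLinearMap) (g := M.proj (fun m => Even (M.dg m)) -
    M.proj fun m => ¬Even (M.dg m)) (M.linearMap_ext fun m _ => ?_) a
  rw [LinearMap.sub_apply, AlgHom.toLinearMap_apply, par_mono, proj_mono, proj_mono]
  by_cases h : Even (M.dg m)
  · simp [h]
  · simp [h, (Nat.not_even_iff_odd.1 h).neg_one_pow]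

theorem even_mul_comm {a : M.carrier} (h : M.par a = a) (b : M.carrier) : a * b = b * a := by
  have h1 := M.par_eq a
  have h2 := M.proj_add_proj_not (fun m => Even (M.dg m)) a
  rw [h, ← sub_eq_zero] at h1
  have h3 : (2 : ℚ) • M.proj (fun m => ¬Even (M.dg m)) a = 0 := by
    rw [two_smul, ← h1]
    nth_rw 3 [← h2]
    abel
  have h4 := proj_eq_zero_iff.1 ((smul_eq_zero.1 h3).resolve_left two_ne_zero)
  have h5 : M.coordSpan (fun m => ¬¬Even (M.dg m)) ≤
      LinearMap.eqLocus (LinearMap.mulRight ℚ b) (LinearMap.mulLeft ℚ b) :=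
    coordSpan_le fun m hm => by
      rw [LinearMap.mem_eqLocus, LinearMap.mulRight_apply, LinearMap.mulLeft_apply]
      induction b using M.mono_induction with
      | hm m' _ =>
        rw [M.graded_comm _ _ _ _ (M.mono_mem_gr m) (M.mono_mem_gr m'),
          ((not_not.1 hm).mul_right _).neg_one_pow, one_smul]
      | h0 => simp
      | hadd a b ha hb => rw [mul_add, ha, hb, add_mul]
      | hsmul c a ha => rw [mul_smul_comm, ha, smul_mul_assoc]
  exact h5 h4

theorem odd_mul_comm {a : M.carrier} (h : M.par a = -a) (b : M.carrier) :
    a * b = M.par b * a := by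
  have h1 := M.par_eq a
  have h2 := M.proj_add_proj_not (fun m => Even (M.dg m)) a
  rw [h, ← sub_eq_zero] at h1
  have h3 : (2 : ℚ) • M.proj (fun m => Even (M.dg m)) a = 0 := by
    rw [two_smul, ← neg_eq_zero, ← h1]
    nth_rw 3 [← h2]
    abel
  have h4 := proj_eq_zero_iff.1 ((smul_eq_zero.1 h3).resolve_left two_ne_zero)
  have h5 : M.coordSpan (fun m => ¬Even (M.dg m)) ≤
      LinearMap.eqLocus (LinearMap.mulRight ℚ b) (LinearMap.mulLeft ℚ (M.par b)) :=
    coordSpan_le fun m hm => by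
      rw [LinearMap.mem_eqLocus, LinearMap.mulRight_apply, LinearMap.mulLeft_apply]
      induction b using M.mono_induction with
      | hm m' _ =>
        rw [M.graded_comm _ _ _ _ (M.mono_mem_gr m) (M.mono_mem_gr m'), par_mono, pow_mul,
          (Nat.not_even_iff_odd.1 hm).neg_one_pow, smul_mul_assoc]
      | h0 => simp
      | hadd a b ha hb => rw [mul_add, ha, hb, map_add, add_mul]
      | hsmul c a ha => rw [mul_smul_comm, ha, map_smul, smul_mul_assoc]
  exact h5 h4

/-- The monomials in the generators from `U`. -/
abbrev In (U : Set M.ι) (m : M.ι →₀ ℕ) : Prop := ∀ i, m i ≠ 0 → i ∈ U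

theorem in_add {U : Set M.ι} {m m' : M.ι →₀ ℕ} : M.In U (m + m') ↔ M.In U m ∧ M.In U m' := by
  constructor
  · intro h
    exact ⟨fun i hi => h i (by rw [Finsupp.add_apply]; omega),
      fun i hi => h i (by rw [Finsupp.add_apply]; omega)⟩
  · rintro ⟨h, h'⟩ i hi
    rw [Finsupp.add_apply] at hi
    by_cases h0 : m i = 0
    · exact h' i (by omega)
    · exact h i h0

theorem proj_in_mul (U : Set M.ι) (a b : M.carrier) :
    M.proj (M.In U) (a * b) = M.proj (M.In U) a * M.proj (M.In U) b := by
  refine M.map_mul_of_mono (fun m m' => ?_) a b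
  obtain ⟨c, -, hc⟩ := M.mono_mul_mono m m'
  rw [hc, map_smul]
  by_cases h : M.In U m
  · by_cases h' : M.In U m'
    · rw [M.proj_mono_of h, M.proj_mono_of h', M.proj_mono_of (M.in_add.2 ⟨h, h'⟩), hc]
    · rw [M.proj_mono_of_not h', M.proj_mono_of_not (fun h2 => h' (M.in_add.1 h2).2), smul_zero,
        mul_zero]
  · rw [M.proj_mono_of_not h, M.proj_mono_of_not (fun h2 => h (M.in_add.1 h2).1), smul_zero,
      zero_mul]

/-- The subalgebra generated by the generators from `U`. -/
def sub (U : Set M.ι) : Subalgebra ℚ M.carrier where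
  __ := M.coordSpan (M.In U)
  mul_mem' ha hb := mul_mem_coordSpan (fun _ _ h h' => M.in_add.2 ⟨h, h'⟩) ha hb
  one_mem' := one_mem_coordSpan fun _ h => absurd rfl h
  algebraMap_mem' c := by
    rw [Algebra.algebraMap_eq_smul_one]
    exact Submodule.smul_mem _ _ (one_mem_coordSpan fun _ h => absurd rfl h)

variable {M}

theorem mem_sub {U : Set M.ι} {a : M.carrier} : a ∈ M.sub U ↔ a ∈ M.coordSpan (M.In U) := Iff.rfl

theorem proj_of_mem_sub {U : Set M.ι} {a : M.carrier} (h : a ∈ M.sub U) :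
    M.proj (M.In U) a = a := mem_coordSpan_iff.1 h

theorem sub_mono {U U' : Set M.ι} (h : U ⊆ U') : M.sub U ≤ M.sub U' :=
  fun _ ha => coordSpan_mono (fun _ hm i hi => h (hm i hi)) ha

theorem proj_mem_sub {U : Set M.ι} (T : (M.ι →₀ ℕ) → Prop) {a : M.carrier} (h : a ∈ M.sub U) :
    M.proj T a ∈ M.sub U := coordSpan_mono (fun _ hm => hm.2) (proj_mem_of_mem h)

variable (M)

/-- The algebra map killing the generators outside `U`. -/
noncomputable def ret (U : Set M.ι) : M.carrier →ₐ[ℚ] M.sub U :=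
  AlgHom.codRestrict (AlgHom.ofLinearMap (M.proj (M.In U))
    (mem_coordSpan_iff.1 (one_mem_coordSpan fun _ h => absurd rfl h)) (M.proj_in_mul U))
    (M.sub U) (proj_mem _)

/-- `U` contains with a generator all generators of larger degree. -/
def UpClosed (U : Set M.ι) : Prop := ∀ i j, i ∈ U → M.deg i < M.deg j → j ∈ U

variable {M}

/-- A monomial in the differential has at least two factors, and the factors other than `j`
contribute degree at least two to the total `deg i + 1`. -/
theorem deg_lt_of_d_gen {i j : M.ι} {m : M.ι →₀ ℕ}
    (h : M.dg m = M.deg i + 1 ∧ 2 ≤ wt (fun _ => 1) m) (hj : m j ≠ 0) : M.deg j < M.deg i := by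
  have h1 : m = single j 1 + (m - single j 1) := by
    rw [add_tsub_cancel_of_le]
    rw [Finsupp.single_le_iff]; omega
  rw [h1, dg, wt_add, wt_single, wt_add, wt_single] at h
  have h2 : m - single j 1 ≠ 0 := by
    intro h0
    simp only [h0, wt_zero] at h
    omega
  obtain ⟨k, hk⟩ := Finsupp.ne_iff.1 h2
  have h3 := le_wt M.deg hk
  have h4 := M.two_le_deg k
  omega

theorem exists_of_d_gen {i : M.ι} {m : M.ι →₀ ℕ}
    (h : M.dg m = M.deg i + 1 ∧ 2 ≤ wt (fun _ => 1) m) : ∃ j, m j ≠ 0 := by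
  have : m ≠ 0 := by
    rintro rfl
    simp only [wt_zero] at h
    omega
  exact Finsupp.ne_iff.1 this

/-- The generators outside `U` generate a differential ideal: the differential of such a generator
involves only generators of smaller degree, which lie outside `U` too. So the differential descends
to the quotient. -/
theorem UpClosed.proj_d {U : Set M.ι} (hU : M.UpClosed U) (a : M.carrier) :
    M.proj (M.In U) (M.d (M.proj (M.In U) a)) = M.proj (M.In U) (M.d a) := by
  refine LinearMap.congr_fun (f := M.proj (M.In U) ∘ₗ M.d ∘ₗ M.proj (M.In U))
    (g := M.proj (M.In U) ∘ₗ M.d) (M.linearMap_ext fun m _ => ?_) a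
  simp only [LinearMap.comp_apply]
  by_cases h : M.In U m
  · rw [M.proj_mono_of h]
  · rw [M.proj_mono_of_not h, map_zero, map_zero, eq_comm]
    simp only [In, not_forall] at h
    obtain ⟨i, hi, hiU⟩ := h
    obtain ⟨c, -, hc⟩ := M.exists_gen_mul hi
    have h1 : M.proj (M.In U) (M.gen i) = 0 := by
      rw [← mono_single]
      exact M.proj_mono_of_not fun h => hiU (h i (by simp))
    have h2 : M.proj (M.In U) (M.d (M.gen i)) = 0 := by
      refine proj_eq_zero_iff.2 (coordSpan_mono (fun m' hm' hin => ?_) (M.d_gen_mem i))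
      obtain ⟨j, hj⟩ := exists_of_d_gen hm'
      exact hiU (hU j i (hin j hj) (deg_lt_of_d_gen hm' hj))
    rw [hc, map_smul, map_smul, M.leibniz _ _ _ (M.gen_mem i), map_add, proj_in_mul, h2, zero_mul,
      zero_add, map_smul, proj_in_mul, h1, zero_mul, smul_zero, smul_zero]

theorem proj_comm (T T' : (M.ι →₀ ℕ) → Prop) (a : M.carrier) :
    M.proj T (M.proj T' a) = M.proj T' (M.proj T a) := by
  rw [proj_proj, proj_proj]
  congr 2
  funext m
  exact propext and_comm

theorem proj_dg_d (i : ℕ) (a : M.carrier) :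
    M.proj (fun m => M.dg m = i + 1) (M.d a) = M.d (M.proj (fun m => M.dg m = i) a) := by
  refine LinearMap.congr_fun (f := M.proj (fun m => M.dg m = i + 1) ∘ₗ M.d)
    (g := M.d ∘ₗ M.proj (fun m => M.dg m = i)) (M.linearMap_ext fun m _ => ?_) a
  simp only [LinearMap.comp_apply]
  by_cases h : M.dg m = i
  · rw [M.proj_mono_of (T := fun m => M.dg m = i) h]
    exact mem_coordSpan_iff.1 (coordSpan_mono (fun m' hm' => by rw [hm', h]) (M.d_mono_mem_gr m))
  · rw [M.proj_mono_of_not (T := fun m => M.dg m = i) h, map_zero]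
    exact proj_eq_zero_iff.2 (coordSpan_mono (fun m' hm' => by omega) (M.d_mono_mem_gr m))

theorem proj_dg_zero_d (a : M.carrier) : M.proj (fun m => M.dg m = 0) (M.d a) = 0 := by
  have h : M.proj (fun m => M.dg m = 0) ∘ₗ M.d = 0 := M.linearMap_ext fun m _ => by
    rw [LinearMap.comp_apply, LinearMap.zero_apply]
    exact proj_eq_zero_iff.2 (coordSpan_mono (fun m' hm' => by omega) (M.d_mono_mem_gr m))
  rw [← LinearMap.comp_apply, h, LinearMap.zero_apply]

theorem proj_dg_mul {i : ℕ} (j : ℕ) {a : M.carrier} (ha : M.proj (fun m => M.dg m = i) a = a)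
    (b : M.carrier) :
    M.proj (fun m => M.dg m = i + j) (a * b) = a * M.proj (fun m => M.dg m = j) b := by
  rw [← mem_coordSpan_iff] at ha
  refine LinearMap.congr_fun (f := M.proj (fun m => M.dg m = i + j) ∘ₗ LinearMap.mulLeft ℚ a)
    (g := LinearMap.mulLeft ℚ a ∘ₗ M.proj (fun m => M.dg m = j)) (M.linearMap_ext fun m _ => ?_) b
  simp only [LinearMap.comp_apply, LinearMap.mulLeft_apply]
  have h1 : a * M.mono m ∈ M.coordSpan fun m' => M.dg m' = i + M.dg m :=
    mul_mem_coordSpan (fun m₁ m₂ h₁ h₂ => by rw [dg_add, h₁, h₂]) ha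
      (mono_mem (T := fun m' => M.dg m' = M.dg m) rfl)
  by_cases h : M.dg m = j
  · rw [M.proj_mono_of (T := fun m => M.dg m = j) h]
    exact mem_coordSpan_iff.1 (coordSpan_mono (fun m' hm' => by rw [hm', h]) h1)
  · rw [M.proj_mono_of_not (T := fun m => M.dg m = j) h, mul_zero]
    exact proj_eq_zero_iff.2 (coordSpan_mono (fun m' hm' => by omega) h1)

theorem proj_dg_mul_lt {i j : ℕ} {a : M.carrier} (ha : M.proj (fun m => M.dg m = i) a = a)
    (b : M.carrier) (hij : j < i) : M.proj (fun m => M.dg m = j) (a * b) = 0 := by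
  rw [← mem_coordSpan_iff] at ha
  refine proj_eq_zero_iff.2 (mul_mem_coordSpan (T' := fun _ => True)
    (fun m₁ m₂ h₁ _ => by rw [dg_add]; omega) ha ?_)
  exact mem_coordSpan_iff.2 (LinearMap.congr_fun (g := LinearMap.id)
    (M.linearMap_ext fun m _ => M.proj_mono_of (T := fun _ => True) trivial) b)

/-- The quotient of the algebra by the generators outside `U`. -/
noncomputable def quot {U : Set M.ι} (hU : M.UpClosed U) : SuperCDGA.{u} where
  carrier := M.sub U
  d := (M.ret U).toLinearMap ∘ₗ M.d ∘ₗ (M.sub U).val.toLinearMap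
  ε := AlgHom.codRestrict (M.par.comp (M.sub U).val) (M.sub U) fun a => M.par_mem a.2
  d_d a := Subtype.ext <| by
    change M.proj (M.In U) (M.d (M.proj (M.In U) (M.d a))) = 0
    rw [hU.proj_d, M.d_d, map_zero]
  ε_ε a := Subtype.ext (M.par_par a)
  d_ε a := Subtype.ext <| by
    change M.proj (M.In U) (M.d (M.par a)) = -M.par (M.proj (M.In U) (M.d a))
    rw [d_par, map_neg]
    congr 1
    refine LinearMap.congr_fun (f := M.proj (M.In U) ∘ₗ M.par.toLinearMap)
      (g := M.par.toLinearMap ∘ₗ M.proj (M.In U)) (M.linearMap_ext fun m _ => ?_) _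
    simp only [LinearMap.comp_apply, AlgHom.toLinearMap_apply]
    by_cases h : M.In U m
    · rw [par_mono, map_smul, M.proj_mono_of h, par_mono]
    · rw [par_mono, map_smul, M.proj_mono_of_not h, map_zero, smul_zero]
  leibniz a b := Subtype.ext <| by
    change M.proj (M.In U) (M.d (a * b)) = M.proj (M.In U) (M.d a) * b +
      M.par a * M.proj (M.In U) (M.d b)
    rw [leibniz_par, map_add, proj_in_mul, proj_in_mul, proj_of_mem_sub b.2,
      proj_of_mem_sub (M.par_mem a.2)]
  even_comm a b h := Subtype.ext (M.even_mul_comm (congrArg Subtype.val h) b)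
  odd_comm a b h := Subtype.ext (M.odd_mul_comm (congrArg Subtype.val h) b)

/-- The restriction of a linear map to the subalgebras generated by sets of generators. -/
def restr {U U' : Set M.ι} (f : M.carrier →ₗ[ℚ] M.carrier) (h : ∀ a ∈ M.sub U, f a ∈ M.sub U') :
    M.sub U →ₗ[ℚ] M.sub U' where
  toFun a := ⟨f a, h a a.2⟩
  map_add' _ _ := Subtype.ext (map_add f _ _)
  map_smul' _ _ := Subtype.ext (map_smul f _ _)

/-- The grading of the quotient. -/
noncomputable def quotGrading {U : Set M.ι} (hU : M.UpClosed U) : (M.quot hU).Grading where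
  pr j := restr (M.proj fun m => M.dg m = j) fun _ h => proj_mem_sub _ h
  pr_pr i a := Subtype.ext (mem_coordSpan_iff.1 (proj_mem _ _))
  pr_d i a := Subtype.ext <|
    (proj_comm (fun m => M.dg m = i + 1) (M.In U) (M.d a.1)).trans
      (congrArg (M.proj (M.In U)) (proj_dg_d i a.1))
  pr_zero_d a := Subtype.ext <|
    (proj_comm (fun m => M.dg m = 0) (M.In U) (M.d a.1)).trans
      ((congrArg (M.proj (M.In U)) (proj_dg_zero_d a.1)).trans (map_zero _))
  pr_mul i j a b h := Subtype.ext (proj_dg_mul j (congrArg Subtype.val h) b.1)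
  pr_mul_lt i j a b h hij := Subtype.ext (proj_dg_mul_lt (congrArg Subtype.val h) b.1 hij)

/-- The inclusion of the quotient as a subalgebra. -/
noncomputable def quotVal {U : Set M.ι} (hU : M.UpClosed U) : (M.quot hU).carrier →ₗ[ℚ] M.carrier :=
  (M.sub U).val.toLinearMap

/-- The intersection of the quotient with a subspace. -/
noncomputable def quotSub {U : Set M.ι} (hU : M.UpClosed U) (S : Submodule ℚ M.carrier) :
    Submodule ℚ (M.quot hU).carrier := S.comap (quotVal hU)

/-- The filtration of the quotient by the even weight. -/
noncomputable def quotFil {U : Set M.ι} (hU : M.UpClosed U) (p : ℕ) :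
    Submodule ℚ (M.quot hU).carrier := quotSub hU (M.coordSpan fun m => p ≤ wt M.ew m)

/-- The augmentation ideal of the quotient. -/
noncomputable def quotAug {U : Set M.ι} (hU : M.UpClosed U) : Submodule ℚ (M.quot hU).carrier :=
  quotSub hU (M.coordSpan fun m => m ≠ 0)

end MinimalSullivanAlgebra

/-! ### Removing one generator of lowest degree -/

namespace MinimalSullivanAlgebra

open Finsupp

variable {M : MinimalSullivanAlgebra.{u}} {U : Set M.ι} {v : M.ι}

theorem proj_add_gen_mul_coeffGen (v : M.ι) (a : M.carrier) :
    M.proj (fun m => m v = 0) a + M.gen v * M.coeffGen v a = a := by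
  refine LinearMap.congr_fun (f := M.proj (fun m => m v = 0) +
    LinearMap.mulLeft ℚ (M.gen v) ∘ₗ M.coeffGen v) (g := LinearMap.id)
    (M.linearMap_ext fun m hm => ?_) a
  simp only [LinearMap.add_apply, LinearMap.comp_apply, LinearMap.mulLeft_apply, LinearMap.id_apply]
  by_cases h : m v = 0
  · rw [M.proj_mono_of (T := fun m => m v = 0) h, M.coeffGen_mono_of_eq_zero h, mul_zero, add_zero]
  · obtain ⟨c, -, hc⟩ := M.exists_gen_mul h
    rw [M.proj_mono_of_not (T := fun m => m v = 0) h, zero_add]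
    conv_lhs => rw [hc]
    rw [map_smul, coeffGen_gen_mul_mono, mul_smul_comm, ← hc]
    rcases Nat.even_or_odd (M.deg v) with he | ho
    · exact Or.inl he
    · right
      have := hm v ho
      simp only [Finsupp.coe_tsub, Pi.sub_apply, Finsupp.single_eq_same]
      omega

theorem coeffGen_mem {T T' : (M.ι →₀ ℕ) → Prop} {v : M.ι} (h : ∀ m, T (m + single v 1) → T' m)
    {a : M.carrier} (ha : a ∈ M.coordSpan T) : M.coeffGen v a ∈ M.coordSpan T' := by
  have : M.coordSpan T ≤ (M.coordSpan T').comap (M.coeffGen v) := coordSpan_le fun m hm =>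
    coordSpan_mono (fun m' hm' => h m' (by rwa [hm'])) (M.coeffGen_mono_mem v m)
  exact this ha

theorem coeffGen_mem_sub {a : M.carrier} (ha : a ∈ M.sub U) : M.coeffGen v a ∈ M.sub U :=
  coeffGen_mem (fun _ h => (M.in_add.1 h).1) ha

theorem coeffGen_eq_zero (hv : v ∉ U) {a : M.carrier} (ha : a ∈ M.sub U) : M.coeffGen v a = 0 := by
  have : M.coordSpan (M.In U) ≤ LinearMap.ker (M.coeffGen v) := coordSpan_le fun m hm =>
    M.coeffGen_mono_of_eq_zero (not_not.1 fun h => hv (hm v h))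
  exact this ha

theorem coeffGen_gen_mul_of_even (he : Even (M.deg v)) (a : M.carrier) :
    M.coeffGen v (M.gen v * a) = a :=
  LinearMap.congr_fun (f := M.coeffGen v ∘ₗ LinearMap.mulLeft ℚ (M.gen v)) (g := LinearMap.id)
    (M.linearMap_ext fun m _ => by
      rw [LinearMap.comp_apply, LinearMap.mulLeft_apply, LinearMap.id_apply]
      exact M.coeffGen_gen_mul_mono (Or.inl he)) a

theorem coeffGen_gen_mul (hv : v ∉ U) {a : M.carrier} (ha : a ∈ M.sub U) :
    M.coeffGen v (M.gen v * a) = a := by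
  have : M.coordSpan (M.In U) ≤
      LinearMap.eqLocus (M.coeffGen v ∘ₗ LinearMap.mulLeft ℚ (M.gen v)) LinearMap.id :=
    coordSpan_le fun m hm => by
      rw [LinearMap.mem_eqLocus, LinearMap.comp_apply, LinearMap.mulLeft_apply, LinearMap.id_apply]
      exact M.coeffGen_gen_mul_mono (Or.inr (not_not.1 fun h => hv (hm v h)))
  exact this ha

theorem proj_in_eq (hv : v ∉ U) {a : M.carrier} (ha : a ∈ M.sub (insert v U)) :
    M.proj (M.In U) a = M.proj (fun m => m v = 0) a := by
  have : M.coordSpan (M.In (insert v U)) ≤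
      LinearMap.eqLocus (M.proj (M.In U)) (M.proj fun m => m v = 0) := coordSpan_le fun m hm => by
    rw [LinearMap.mem_eqLocus]
    by_cases h : m v = 0
    · rw [M.proj_mono_of (T := fun m => m v = 0) h, M.proj_mono_of]
      intro i hi
      refine (hm i hi).resolve_left ?_
      rintro rfl
      exact hi h
    · rw [M.proj_mono_of_not (T := fun m => m v = 0) h, M.proj_mono_of_not]
      exact fun h' => hv (h' v h)
  exact this ha

theorem coeffGen_mem_sub_of_odd (ho : Odd (M.deg v)) {a : M.carrier}
    (ha : a ∈ M.sub (insert v U)) : M.coeffGen v a ∈ M.sub U := by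
  have : M.coordSpan (M.In (insert v U)) ≤ (M.coordSpan (M.In U)).comap (M.coeffGen v) :=
    coordSpan_le fun m hm => by
      rw [Submodule.mem_comap]
      by_cases hval : M.Valid m
      · refine coordSpan_mono (fun m' hm' i hi => ?_) (M.coeffGen_mono_mem v m)
        subst hm'
        refine ((M.in_add.1 hm).1 i hi).resolve_left ?_
        rintro rfl
        have := hval i ho
        rw [Finsupp.add_apply, Finsupp.single_eq_same] at this
        omega
      · rw [M.mono_of_not_valid hval, map_zero]
        exact Submodule.zero_mem _
  exact this ha

theorem UpClosed.deg_le (hU : M.UpClosed U) (hv : v ∉ U) {i : M.ι} (hi : i ∈ U) :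
    M.deg v ≤ M.deg i := not_lt.1 fun h => hv (hU i v hi h)

/-- The generators occurring in the differential of `v` have smaller degree than `v`, and none of
them is left in the quotient. -/
theorem UpClosed.proj_d_gen (hU : M.UpClosed U) (hv : v ∉ U) :
    M.proj (M.In (insert v U)) (M.d (M.gen v)) = 0 := by
  refine proj_eq_zero_iff.2 (coordSpan_mono (fun m hm hin => ?_) (M.d_gen_mem v))
  obtain ⟨j, hj⟩ := exists_of_d_gen hm
  have h1 := deg_lt_of_d_gen hm hj
  rcases hin j hj with rfl | h
  · exact lt_irrefl _ h1
  · exact absurd (hU.deg_le hv h) (not_le.2 h1)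

theorem gen_mem_sub (h : v ∈ U) : M.gen v ∈ M.sub U := by
  refine gen_mem_coordSpan fun i hi => ?_
  rw [Finsupp.single_apply] at hi
  rcases eq_or_ne v i with rfl | h'
  · exact h
  · rw [if_neg h'] at hi; exact absurd rfl hi

theorem proj_gen (hv : v ∉ U) : M.proj (M.In U) (M.gen v) = 0 := by
  rw [← mono_single]
  exact M.proj_mono_of_not fun h => hv (h v (by simp))

theorem par_gen (v : M.ι) : M.par (M.gen v) = (-1 : ℚ) ^ M.deg v • M.gen v := by
  rw [← mono_single, par_mono, dg, wt_single, one_mul]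

/-- The quotient map. -/
noncomputable def quotMap {U U' : Set M.ι} (hU : M.UpClosed U) (hU' : M.UpClosed U') (h : U ⊆ U') :
    SuperCDGA.Hom (M.quot hU') (M.quot hU) where
  toAlgHom := (M.ret U).comp (M.sub U').val
  map_d a := Subtype.ext <| by
    change M.proj (M.In U) (M.proj (M.In U') (M.d a.1)) = M.proj (M.In U) (M.d (M.proj (M.In U) a.1))
    rw [hU.proj_d, proj_proj]
    congr 2
    funext m
    exact propext ⟨fun hm => hm.1, fun hm => ⟨hm, fun i hi => h (hm i hi)⟩⟩
  map_ε a := Subtype.ext <| by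
    change M.proj (M.In U) (M.par a.1) = M.par (M.proj (M.In U) a.1)
    refine LinearMap.congr_fun (f := M.proj (M.In U) ∘ₗ M.par.toLinearMap)
      (g := M.par.toLinearMap ∘ₗ M.proj (M.In U)) (M.linearMap_ext fun m _ => ?_) _
    simp only [LinearMap.comp_apply, AlgHom.toLinearMap_apply]
    by_cases h : M.In U m
    · rw [par_mono, map_smul, M.proj_mono_of h, par_mono]
    · rw [par_mono, map_smul, M.proj_mono_of_not h, map_zero, smul_zero]

/-- Removing a generator of even degree. -/
noncomputable def evenStep (hU : M.UpClosed U) (hU' : M.UpClosed (insert v U)) (hv : v ∉ U)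
    (he : Even (M.deg v)) : SuperCDGA.EvenStep (M.quot hU') (M.quot hU) where
  σ := Subalgebra.inclusion (sub_mono (Set.subset_insert v U))
  ρ := quotMap hU hU' (Set.subset_insert v U)
  x := ⟨M.gen v, gen_mem_sub (Set.mem_insert v U)⟩
  γ := restr (M.coeffGen v) fun _ h => coeffGen_mem_sub h
  d_x := Subtype.ext (hU.proj_d_gen hv)
  ε_x := Subtype.ext <| by
    change M.par (M.gen v) = M.gen v
    rw [par_gen, he.neg_one_pow, one_smul]
  ρ_σ q := Subtype.ext (proj_of_mem_sub q.2)
  ρ_x := Subtype.ext (proj_gen hv)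
  σ_ε q := rfl
  γ_σ q := Subtype.ext (coeffGen_eq_zero hv q.2)
  γ_x a := Subtype.ext (coeffGen_gen_mul_of_even he a.1)
  decomp a := Subtype.ext <| by
    change M.proj (M.In U) a.1 + M.gen v * M.coeffGen v a.1 = a.1
    rw [proj_in_eq hv a.2, proj_add_gen_mul_coeffGen]

/-- Removing a generator of odd degree. -/
noncomputable def oddStep (hU : M.UpClosed U) (hU' : M.UpClosed (insert v U)) (hv : v ∉ U)
    (ho : Odd (M.deg v)) : SuperCDGA.OddStep (M.quot hU') (M.quot hU) where
  σ := Subalgebra.inclusion (sub_mono (Set.subset_insert v U))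
  ρ := quotMap hU hU' (Set.subset_insert v U)
  y := ⟨M.gen v, gen_mem_sub (Set.mem_insert v U)⟩
  γ := restr (M.coeffGen v) fun _ h => coeffGen_mem_sub_of_odd ho h
  d_y := Subtype.ext (hU.proj_d_gen hv)
  ε_y := Subtype.ext <| by
    change M.par (M.gen v) = -M.gen v
    rw [par_gen, ho.neg_one_pow, neg_one_smul]
  ρ_σ q := Subtype.ext (proj_of_mem_sub q.2)
  ρ_y := Subtype.ext (proj_gen hv)
  σ_ε q := rfl
  γ_σ q := Subtype.ext (coeffGen_eq_zero hv q.2)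
  γ_y q := Subtype.ext (coeffGen_gen_mul hv q.2)
  decomp a := Subtype.ext <| by
    change M.proj (M.In U) a.1 + M.gen v * M.coeffGen v a.1 = a.1
    rw [proj_in_eq hv a.2, proj_add_gen_mul_coeffGen]

/-! ### Behaviour of the differential on filtrations -/

theorem d_mem_ew {p : ℕ} {a : M.carrier} (h : a ∈ M.coordSpan fun m => p ≤ wt M.ew m) :
    M.d a ∈ M.coordSpan fun m => p ≤ wt M.ew m := by
  have : M.coordSpan (fun m => p ≤ wt M.ew m) ≤
      (M.coordSpan fun m => p ≤ wt M.ew m).comap M.d :=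
    coordSpan_le fun m hm => coordSpan_mono (fun _ h' => hm.trans h') (M.d_mono_mem_ew m)
  exact this h

theorem d_mem_length {a : M.carrier} (h : a ∈ M.coordSpan fun m => m ≠ 0) :
    M.d a ∈ M.coordSpan fun m => 2 ≤ wt (fun _ => 1) m := by
  have : M.coordSpan (fun m => m ≠ 0) ≤
      (M.coordSpan fun m => 2 ≤ wt (fun _ => 1) m).comap M.d :=
    coordSpan_le fun m hm => coordSpan_mono (fun _ h' => le_trans (by
      obtain ⟨j, hj⟩ := Finsupp.ne_iff.1 hm
      have := le_wt (fun _ => 1) hj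
      omega) h') (M.d_mono_mem_length m)
  exact this h

theorem d_mem_dg {j : ℕ} {a : M.carrier} (h : a ∈ M.coordSpan fun m => M.dg m < j) :
    M.d a ∈ M.coordSpan fun m => M.dg m < j + 1 := by
  have : M.coordSpan (fun m => M.dg m < j) ≤
      (M.coordSpan fun m => M.dg m < j + 1).comap M.d :=
    coordSpan_le fun m hm => coordSpan_mono (fun _ h' => by omega) (M.d_mono_mem_gr m)
  exact this h

theorem exists_dg_lt (a : M.carrier) : ∃ N, a ∈ M.coordSpan fun m => M.dg m < N := by
  induction a using M.mono_induction with
  | hm m _ => exact ⟨M.dg m + 1, mono_mem (T := fun m' => M.dg m' < M.dg m + 1) (Nat.lt_succ_self _)⟩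
  | h0 => exact ⟨0, Submodule.zero_mem _⟩
  | hadd a b ha hb =>
    obtain ⟨N, hN⟩ := ha
    obtain ⟨N', hN'⟩ := hb
    exact ⟨max N N', Submodule.add_mem _ (coordSpan_mono (fun m hm => by omega) hN)
      (coordSpan_mono (fun m hm => by omega) hN')⟩
  | hsmul c a ha =>
    obtain ⟨N, hN⟩ := ha
    exact ⟨N, Submodule.smul_mem _ _ hN⟩

theorem coeffGen_d_mem (hv2 : 2 ≤ M.deg v) {j : ℕ} {a : M.carrier}
    (h : a ∈ M.coordSpan fun m => M.dg m < j + 1) :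
    M.coeffGen v (M.proj (M.In U) (M.d a)) ∈ M.coordSpan fun m => M.dg m < j := by
  refine coeffGen_mem (fun m hm => ?_) (coordSpan_mono (fun m hm => hm.2)
    (proj_mem_of_mem (d_mem_dg h)))
  rw [dg_add, dg, dg, wt_single] at hm
  change wt M.deg m < j
  omega

/-- The differential raises the degree by one and division by `v` lowers it by at least two, so `θ`
lowers a bound on the degree. -/
theorem oddStep_θ_nilpotent (hU : M.UpClosed U) (hU' : M.UpClosed (insert v U)) (hv : v ∉ U)
    (ho : Odd (M.deg v)) (q : (M.quot hU).carrier) :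
    ∃ N, ((oddStep hU hU' hv ho).θ ^ N) q = 0 := by
  have key : ∀ N : ℕ, ∀ q : (M.quot hU).carrier, q.1 ∈ M.coordSpan (fun m => M.dg m < N) →
      ((oddStep hU hU' hv ho).θ ^ N) q = 0 := by
    intro N
    induction N with
    | zero =>
      intro q hq
      rw [pow_zero]
      refine Subtype.ext ?_
      change q.1 = 0
      have := coordSpan_le (S := ⊥) (fun m hm => absurd hm (Nat.not_lt_zero _)) hq
      exact this
    | succ N ih =>
      intro q hq
      rw [pow_succ]
      exact ih _ (coeffGen_d_mem (U := insert v U) (M.two_le_deg v) hq)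
  obtain ⟨N, hN⟩ := exists_dg_lt q.1
  exact ⟨N, key N q hN⟩

/-- Minimality enters the mapping theorem here: the differential produces word length at least two,
and one letter remains after division by `v`. -/
theorem coeffGen_d_mem_aug {a : M.carrier} (h : a ∈ M.coordSpan fun m => m ≠ 0) :
    M.coeffGen v (M.proj (M.In U) (M.d a)) ∈ M.coordSpan fun m => m ≠ 0 := by
  refine coeffGen_mem (fun m hm => ?_) (coordSpan_mono (fun m hm => hm.2)
    (proj_mem_of_mem (d_mem_length h)))
  rintro rfl
  simp at hm

/-! ### Nilpotence -/

theorem hasNilModel_of_insert (hU : M.UpClosed U) (hU' : M.UpClosed (insert v U)) (hv : v ∉ U)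
    {n : ℕ} (h : (M.quot hU').HasNilModel (quotAug hU') n) :
    (M.quot hU).HasNilModel (quotAug hU) n := by
  rcases Nat.even_or_odd (M.deg v) with he | ho
  · exact (evenStep hU hU' hv he).hasNilModel h (fun q hq => hq)
      fun q hq => coeffGen_d_mem_aug (U := insert v U) hq
  · exact (oddStep hU hU' hv ho).hasNilModel (oddStep_θ_nilpotent hU hU' hv ho) h (fun q hq => hq)
      fun q hq => coeffGen_d_mem_aug (U := insert v U) hq

theorem UpClosed.exists_insert [Finite M.ι] (hU : M.UpClosed U) (h : U ≠ Set.univ) :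
    ∃ v, v ∉ U ∧ M.UpClosed (insert v U) := by
  obtain ⟨v, hv, hmax⟩ := Set.exists_max_image Uᶜ M.deg (Set.toFinite _)
    (Set.nonempty_compl.2 h)
  refine ⟨v, hv, ?_⟩
  rintro i j (rfl | hi) hij
  · right
    by_contra hj
    exact absurd (hmax j hj) (not_le.2 hij)
  · exact Or.inr (hU i j hi hij)

theorem upClosed_univ : M.UpClosed Set.univ := fun _ _ _ _ => trivial

theorem hasNilModel [Finite M.ι] {n : ℕ}
    (h : (M.quot (upClosed_univ (M := M))).HasNilModel (quotAug upClosed_univ) n) :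
    ∀ (U : Set M.ι) (hU : M.UpClosed U), (M.quot hU).HasNilModel (quotAug hU) n := by
  have key : ∀ k : ℕ, ∀ (U : Set M.ι) (hU : M.UpClosed U), Uᶜ.ncard = k →
      (M.quot hU).HasNilModel (quotAug hU) n := by
    intro k
    induction k with
    | zero =>
      intro U hU hk
      rw [Set.ncard_eq_zero (Set.toFinite _), Set.compl_empty_iff] at hk
      subst hk
      exact h
    | succ k ih =>
      intro U hU hk
      obtain ⟨v, hv, hU'⟩ := hU.exists_insert (by rintro rfl; simp at hk)
      refine hasNilModel_of_insert hU hU' hv (ih _ hU' ?_)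
      have h1 : (insert v U)ᶜ = Uᶜ \ {v} := by
        ext i; simp [not_or, and_comm]
      have h2 := Set.ncard_sdiff_singleton_add_one (s := Uᶜ) hv (Set.toFinite _)
      rw [h1]
      omega
  exact fun U hU => key _ U hU rfl

theorem proj_univ (a : M.carrier) : M.proj (M.In Set.univ) a = a :=
  LinearMap.congr_fun (g := LinearMap.id)
    (M.linearMap_ext fun _ _ => M.proj_mono_of fun _ _ => trivial) a

/-- The cocycles of degree greater than `n` are exact. -/
def ExactAbove (M : MinimalSullivanAlgebra.{u}) (n : ℕ) : Prop :=
  ∀ j, n < j → ∀ a ∈ M.coordSpan (fun m => M.dg m = j), M.d a = 0 → a ∈ LinearMap.range M.d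

theorem mem_span_dg_zero {a : M.carrier} : ∃ c : ℚ,
    a - algebraMap ℚ M.carrier c ∈ M.coordSpan fun m => 0 < M.dg m := by
  induction a using M.mono_induction with
  | hm m _ =>
    by_cases h : m = 0
    · refine ⟨1, ?_⟩
      rw [h, mono_zero, map_one, sub_self]
      exact Submodule.zero_mem _
    · refine ⟨0, ?_⟩
      rw [map_zero, sub_zero]
      refine mono_mem (T := fun m => 0 < M.dg m) ?_
      obtain ⟨i, hi⟩ := Finsupp.ne_iff.1 h
      have := le_wt M.deg hi
      have := M.two_le_deg i
      change 0 < wt M.deg m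
      omega
  | h0 => exact ⟨0, by simp⟩
  | hadd a b ha hb =>
    obtain ⟨c, hc⟩ := ha
    obtain ⟨c', hc'⟩ := hb
    refine ⟨c + c', ?_⟩
    rw [map_add, add_sub_add_comm]
    exact Submodule.add_mem _ hc hc'
  | hsmul r a ha =>
    obtain ⟨c, hc⟩ := ha
    refine ⟨r * c, ?_⟩
    rw [map_mul, ← Algebra.smul_def, ← smul_sub]
    exact Submodule.smul_mem _ _ hc

/-- Take everything above degree `n` together with a complement `C` of the cocycles in degree `n`.
It is an ideal because elements of positive degree push it above `n`. It is acyclic because `d` is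
injective on `C` with the same image as on all of degree `n`, and higher cocycles are exact. -/
theorem exists_acyclic_ideal {n : ℕ} (h : M.ExactAbove n) :
    ∃ I : Submodule ℚ M.carrier, M.coordSpan (fun m => n < M.dg m) ≤ I ∧ (∀ i ∈ I, M.par i ∈ I) ∧
      (∀ i ∈ I, M.d i ∈ I) ∧ (∀ i ∈ I, ∀ b, i * b ∈ I) ∧
      ∀ i ∈ I, M.d i = 0 → ∃ i' ∈ I, M.d i' = i := by
  obtain ⟨C, hC1, hC2⟩ := IsModularLattice.exists_disjoint_and_sup_eq
    (a := M.coordSpan (fun m => M.dg m = n) ⊓ LinearMap.ker M.d)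
    (b := M.coordSpan (fun m => M.dg m = n)) inf_le_left
  have hCn : C ≤ M.coordSpan (fun m => M.dg m = n) := hC2 ▸ le_sup_right
  have hCd : ∀ c ∈ C, M.d c = 0 → c = 0 := fun c hc hdc => by
    have := (Submodule.disjoint_def.1 hC1) c ⟨hCn hc, hdc⟩ hc
    exact this
  have hdn : ∀ c ∈ M.coordSpan (fun m => M.dg m = n), ∃ c' ∈ C, M.d c' = M.d c := by
    intro c hc
    rw [← hC2] at hc
    obtain ⟨z, hz, c', hc', rfl⟩ := Submodule.mem_sup.1 hc
    refine ⟨c', hc', ?_⟩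
    rw [map_add, show M.d z = 0 from hz.2, zero_add]
  set L := M.coordSpan (fun m => n < M.dg m) with hL
  have hdL : ∀ a ∈ M.coordSpan (fun m => n ≤ M.dg m), M.d a ∈ L := by
    intro a ha
    have : M.coordSpan (fun m => n ≤ M.dg m) ≤ L.comap M.d := coordSpan_le fun m hm =>
      coordSpan_mono (fun m' hm' => by omega) (M.d_mono_mem_gr m)
    exact this ha
  refine ⟨L ⊔ C, le_sup_left, ?_, ?_, ?_, ?_⟩
  · intro i hi
    obtain ⟨a, ha, c, hc, rfl⟩ := Submodule.mem_sup.1 hi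
    rw [map_add, M.par_of_mem_gr (hCn hc)]
    exact Submodule.add_mem_sup (M.par_mem ha) (Submodule.smul_mem _ _ hc)
  · intro i hi
    refine Submodule.mem_sup_left (hdL _ ?_)
    exact (sup_le (coordSpan_mono fun m hm => le_of_lt hm)
      (hCn.trans (coordSpan_mono fun m hm => hm.ge))) hi
  · intro i hi b
    obtain ⟨a, ha, c, hc, rfl⟩ := Submodule.mem_sup.1 hi
    obtain ⟨r, hr⟩ := mem_span_dg_zero (a := b)
    have hb : b = algebraMap ℚ M.carrier r + (b - algebraMap ℚ M.carrier r) := by abel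
    have h1 : (a + c) * b = (r • a + (a + c) * (b - algebraMap ℚ M.carrier r)) + r • c := by
      conv_lhs => rw [hb, mul_add, ← Algebra.commutes, ← Algebra.smul_def, smul_add]
      abel
    rw [h1]
    refine Submodule.add_mem_sup (Submodule.add_mem _ (Submodule.smul_mem _ _ ha) ?_)
      (Submodule.smul_mem _ _ hc)
    refine mul_mem_coordSpan (T := fun m => n ≤ M.dg m) (T' := fun m => 0 < M.dg m)
      (fun m m' hm hm' => by rw [dg_add]; omega) ?_ hr
    exact Submodule.add_mem _ (coordSpan_mono (fun m hm => le_of_lt hm) ha)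
      (coordSpan_mono (fun m hm => hm.ge) (hCn hc))
  -- A cocycle is treated one degree at a time. In degree `n + 1` the primitive has degree `n` and
  -- must be replaced by one in `C`.
  · have key : ∀ N : ℕ, ∀ a ∈ M.coordSpan (fun m => n < M.dg m ∧ M.dg m < N), M.d a = 0 →
        ∃ i' ∈ L ⊔ C, M.d i' = a := by
      intro N
      induction N with
      | zero =>
        intro a ha _
        have : a = 0 := coordSpan_le (S := ⊥) (fun m hm => absurd hm.2 (Nat.not_lt_zero _)) ha
        exact ⟨0, Submodule.zero_mem _, by rw [this, map_zero]⟩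
      | succ N ih =>
        intro a ha hda
        have h1 : M.d (M.proj (fun m => M.dg m = N) a) = 0 := by
          rw [← proj_dg_d, hda, map_zero]
        have h2 := M.proj_add_proj_not (fun m => M.dg m = N) a
        obtain ⟨i₁, hi₁, hdi₁⟩ := ih (M.proj (fun m => ¬M.dg m = N) a)
          (coordSpan_mono (fun m hm => by omega) (proj_mem_of_mem ha)) (by
            have h3 := congrArg M.d h2
            rwa [map_add, h1, zero_add, hda] at h3)
        obtain ⟨i₂, hi₂, hdi₂⟩ : ∃ i' ∈ L ⊔ C, M.d i' = M.proj (fun m => M.dg m = N) a := by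
          by_cases hN : n < N
          · obtain ⟨b, hb⟩ := h N hN _ (proj_mem _ a) h1
            obtain ⟨k, rfl⟩ : ∃ k, N = k + 1 := ⟨N - 1, by omega⟩
            have h4 : M.d (M.proj (fun m => M.dg m = k) b) = M.proj (fun m => M.dg m = k + 1) a := by
              rw [← proj_dg_d, hb]
              exact mem_coordSpan_iff.1 (proj_mem _ a)
            by_cases hk : n < k
            · exact ⟨_, Submodule.mem_sup_left (coordSpan_mono (fun m hm => by omega)
                (proj_mem (fun m => M.dg m = k) b)), h4⟩
            · have hnk : k = n := by omega
              subst hnk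
              obtain ⟨c', hc', hdc'⟩ := hdn _ (proj_mem _ b)
              exact ⟨c', Submodule.mem_sup_right hc', by rw [hdc', h4]⟩
          · refine ⟨0, Submodule.zero_mem _, ?_⟩
            rw [map_zero, eq_comm]
            exact proj_eq_zero_iff.2 (coordSpan_mono (fun m hm => by omega) ha)
        exact ⟨i₂ + i₁, Submodule.add_mem _ hi₂ hi₁, by rw [map_add, hdi₁, hdi₂, h2]⟩
    intro i hi hdi
    obtain ⟨a, ha, c, hc, rfl⟩ := Submodule.mem_sup.1 hi
    have h1 : M.proj (fun m => M.dg m = n) (a + c) = c := by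
      rw [map_add, mem_coordSpan_iff.1 (hCn hc), add_eq_right]
      exact proj_eq_zero_iff.2 (coordSpan_mono (fun m hm => by omega) ha)
    have h2 : c = 0 := by
      refine hCd c hc ?_
      rw [← h1, ← proj_dg_d, hdi, map_zero]
    subst h2
    rw [add_zero] at hdi ⊢
    obtain ⟨N, hN⟩ := exists_dg_lt a
    exact key N a (mem_coordSpan_and ha hN) hdi

/-- `M` serves as its own model: a product of `n + 1` elements of positive degree lies above degree
`n`, hence in the acyclic ideal. -/
theorem ExactAbove.hasNilModel {n : ℕ} (h : M.ExactAbove n) :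
    (M.quot (upClosed_univ (M := M))).HasNilModel (quotAug upClosed_univ) n := by
  obtain ⟨I, hI1, hI2, hI3, hI4, hI5⟩ := exists_acyclic_ideal h
  refine ⟨M.quot upClosed_univ, SuperCDGA.Hom.id _, quotAug upClosed_univ,
    quotSub upClosed_univ I, SuperCDGA.Hom.coneAcyclic_id _, fun a ha => ha,
    fun j hj => M.par_mem hj, ?_, fun i hi => hI2 _ hi, ?_, fun i hi b => hI4 _ hi b.1, ?_⟩
  · have key : ∀ k : ℕ, (quotAug (upClosed_univ (M := M))) ^ k ≤
        quotSub upClosed_univ (M.coordSpan fun m => k ≤ M.dg m) := by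
      intro k
      induction k with
      | zero =>
        rw [pow_zero, Submodule.one_le]
        exact one_mem_coordSpan (Nat.zero_le _)
      | succ k ih =>
        rw [pow_succ, Submodule.mul_le]
        intro a ha b hb
        refine mul_mem_coordSpan (fun m m' hm hm' => ?_) (ih ha) hb
        rw [dg_add]
        obtain ⟨i, hi⟩ := Finsupp.ne_iff.1 hm'
        have := le_wt M.deg hi
        have := M.two_le_deg i
        change k + 1 ≤ M.dg m + wt M.deg m'
        omega
    exact (key (n + 1)).trans (Submodule.comap_mono hI1)
  · intro i hi
    change M.proj (M.In Set.univ) (M.d i.1) ∈ I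
    rw [proj_univ]
    exact hI3 _ hi
  · intro i hi hdi
    have hdi' : M.proj (M.In Set.univ) (M.d i.1) = 0 := congrArg Subtype.val hdi
    rw [proj_univ] at hdi'
    obtain ⟨i', hi', h'⟩ := hI5 _ hi hdi'
    refine ⟨⟨i', ?_⟩, hi', Subtype.ext ?_⟩
    · rw [mem_sub, mem_coordSpan_iff, proj_univ]
    · change M.proj (M.In Set.univ) (M.d i') = i.1
      rw [proj_univ]
      exact h'

end MinimalSullivanAlgebra

/-! ### Finiteness and Poincaré duality for elliptic minimal Sullivan algebras -/

theorem SuperCDGA.finiteDimensional_H {A : SuperCDGA.{u}} {N : Type*} [AddCommGroup N] [Module ℚ N]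
    [FiniteDimensional ℚ N] (f : A.carrier →ₗ[ℚ] N)
    (h : ∀ a, A.d a = 0 → f a = 0 → a ∈ LinearMap.range A.d) : FiniteDimensional ℚ A.H := by
  let g : LinearMap.ker A.d →ₗ[ℚ] N := f ∘ₗ (LinearMap.ker A.d).subtype
  have h1 : LinearMap.ker g ≤ (LinearMap.range A.d).submoduleOf (LinearMap.ker A.d) :=
    fun a ha => h a.1 a.2 ha
  have h2 : FiniteDimensional ℚ (LinearMap.ker A.d ⧸ LinearMap.ker g) :=
    Module.Finite.equiv g.quotKerEquivRange.symm
  exact Module.Finite.of_surjective _ (Submodule.factor_surjective h1)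

namespace MinimalSullivanAlgebra

open Finsupp

variable {M : MinimalSullivanAlgebra.{u}} {U : Set M.ι} {v : M.ι}

theorem finite_wt_lt [Finite M.ι] {w : M.ι → ℕ} (hw : ∀ i, 0 < w i) (p : ℕ) :
    {m : M.ι →₀ ℕ | wt w m < p}.Finite := by
  refine (Set.finite_Iic (Finsupp.equivFunOnFinite.symm fun _ : M.ι => p)).subset fun m hm i => ?_
  by_cases h : m i = 0
  · rw [h]; exact Nat.zero_le _
  · have h1 : m i * w i ≤ wt w m :=
      Finset.single_le_sum (f := fun i => m i * w i) (fun _ _ => Nat.zero_le _)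
        (Finsupp.mem_support_iff.2 h)
    have h2 := Nat.le_mul_of_pos_right (m i) (hw i)
    exact (h2.trans h1).trans (le_of_lt hm)

theorem finiteDimensional_coordSpan {T : (M.ι →₀ ℕ) → Prop} (h : {m | T m}.Finite) :
    FiniteDimensional ℚ (M.coordSpan T) := by
  rw [coordSpan]
  exact FiniteDimensional.span_of_finite ℚ (h.image _)

theorem ew_pos (i : M.ι) : 0 < M.ew i :=
  lt_of_lt_of_le (by have := M.two_le_deg i; omega) (M.deg_le_ew i)

/-- A cocycle without monomials of weight below `p₀` is exact, so a class is determined by its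
finitely many light coordinates. -/
theorem finiteDimensional_of_acyclicFrom [Finite M.ι] (hU : M.UpClosed U) {p₀ : ℕ}
    (h : (M.quot hU).AcyclicFrom (quotFil hU) p₀) : FiniteDimensional ℚ (M.quot hU).H := by
  have := finiteDimensional_coordSpan (finite_wt_lt (M := M) ew_pos p₀)
  refine SuperCDGA.finiteDimensional_H (N := M.coordSpan fun m => wt M.ew m < p₀)
    (LinearMap.codRestrict _ (M.proj (fun m => wt M.ew m < p₀) ∘ₗ quotVal hU)
      fun a => proj_mem _ _) fun a ha hfa => ?_
  have h1 : M.proj (fun m => wt M.ew m < p₀) a.1 = 0 := congrArg Subtype.val hfa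
  obtain ⟨u, -, hu⟩ := h p₀ le_rfl a
    (coordSpan_mono (fun m hm => not_lt.1 hm) (proj_eq_zero_iff.1 h1)) ha
  exact ⟨u, hu⟩

theorem proj_dg_coeffGen (v : M.ι) (j : ℕ) (a : M.carrier) :
    M.proj (fun m => M.dg m = j) (M.coeffGen v a) =
      M.coeffGen v (M.proj (fun m => M.dg m = j + M.deg v) a) := by
  refine LinearMap.congr_fun (f := M.proj (fun m => M.dg m = j) ∘ₗ M.coeffGen v)
    (g := M.coeffGen v ∘ₗ M.proj (fun m => M.dg m = j + M.deg v))
    (M.linearMap_ext fun m _ => ?_) a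
  simp only [LinearMap.comp_apply]
  have h1 : ∀ m', m' + single v 1 = m → M.dg m' + M.deg v = M.dg m := by
    rintro m' rfl
    rw [dg_add, dg, dg, wt_single, one_mul]
  by_cases h : M.dg m = j + M.deg v
  · rw [M.proj_mono_of (T := fun m => M.dg m = j + M.deg v) h]
    exact mem_coordSpan_iff.1 (coordSpan_mono (fun m' hm' => by have := h1 m' hm'; omega)
      (M.coeffGen_mono_mem v m))
  · rw [M.proj_mono_of_not (T := fun m => M.dg m = j + M.deg v) h, map_zero]
    exact proj_eq_zero_iff.2 (coordSpan_mono (fun m' hm' => by have := h1 m' hm'; omega)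
      (M.coeffGen_mono_mem v m))

theorem proj_dg_gen_mul (v : M.ι) (j : ℕ) (a : M.carrier) :
    M.proj (fun m => M.dg m = j + M.deg v) (M.gen v * a) =
      M.gen v * M.proj (fun m => M.dg m = j) a := by
  rw [add_comm]
  refine proj_dg_mul j (mem_coordSpan_iff.1 (gen_mem_coordSpan ?_)) a
  rw [dg, wt_single, one_mul]

/-- Acyclicity of the even weight filtration in high weights and Poincaré duality. -/
def DualityHolds (hU : M.UpClosed U) : Prop :=
  (∃ p₀, (M.quot hU).AcyclicFrom (quotFil hU) p₀) ∧ ∃ n, (M.quot hU).IsPoincare (quotGrading hU) n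

theorem one_ne_zero' : (1 : M.carrier) ≠ 0 := by
  rw [← mono_zero, ← basis_apply M ⟨0, fun i _ => Nat.zero_le _⟩]
  exact M.basis.ne_zero _

/-- The nil model supplies some primitive of the power. The filtered argument for an even generator
also needs it in the filtration level of the power itself, which a parity argument gives. -/
theorem exists_pow_exact (hU' : M.UpClosed U) (hv : v ∈ U) (hdv : M.proj (M.In U) (M.d (M.gen v)) = 0)
    (he : Even (M.deg v)) {n : ℕ} (h : (M.quot hU').HasNilModel (quotAug hU') n) :
    ∃ w ∈ quotFil hU' ((n + 1) * M.deg v),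
      (M.quot hU').d w = (⟨M.gen v, gen_mem_sub hv⟩ : M.sub U) ^ (n + 1) := by
  set x : (M.quot hU').carrier := (⟨M.gen v, gen_mem_sub hv⟩ : M.sub U) with hx
  have hdx : (M.quot hU').d x = 0 := Subtype.ext hdv
  have hxε : (M.quot hU').ε x = x := Subtype.ext <| by
    change M.par (M.gen v) = M.gen v
    rw [par_gen, he.neg_one_pow, one_smul]
  have hpow : ∀ k, (M.quot hU').d (x ^ k) = 0 := by
    intro k
    induction k with
    | zero =>
      rw [pow_zero]
      have := (M.quot hU').leibniz 1 1
      simpa using this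
    | succ k ih => rw [pow_succ, (M.quot hU').leibniz, ih, hdx, zero_mul, mul_zero, add_zero]
  have hxaug : x ∈ quotAug hU' := gen_mem_coordSpan (T := fun m => m ≠ 0) (by simp)
  obtain ⟨w, hw⟩ := h.pow_exact hxaug (hpow _)
  set D := (n + 1) * M.deg v with hD
  have hD1 : 1 ≤ D := by
    have := M.two_le_deg v
    rw [hD]; exact Nat.mul_pos (Nat.succ_pos _) (by omega)
  have hdeg : ∀ k, (quotGrading hU').pr (k * M.deg v) (x ^ k) = x ^ k := by
    intro k
    induction k with
    | zero =>
      rw [pow_zero, zero_mul]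
      exact Subtype.ext (mem_coordSpan_iff.1 (one_mem_coordSpan (T := fun m => M.dg m = 0) (by simp)))
    | succ k ih =>
      have hx1 : (quotGrading hU').pr (M.deg v) x = x := Subtype.ext (mem_coordSpan_iff.1
        (gen_mem_coordSpan (T := fun m => M.dg m = M.deg v) (by rw [dg, wt_single, one_mul])))
      rw [pow_succ, add_mul, one_mul, (quotGrading hU').pr_mul _ _ _ _ ih, hx1]
  refine ⟨(quotGrading hU').pr (D - 1) w, ?_, ?_⟩
  -- Monomials of degree `D - 1` have weight at least `D - 1`. Weights are even and so is `D`, hence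
  -- the weight is at least `D`.
  · have h1 : ((quotGrading hU').pr (D - 1) w).1 ∈ M.coordSpan fun m => M.dg m = D - 1 :=
      proj_mem _ _
    refine coordSpan_mono (fun m hm => ?_) h1
    have h2 : M.dg m ≤ wt M.ew m := wt_mono M.deg_le_ew m
    obtain ⟨r, hr⟩ := M.even_wt_ew m
    obtain ⟨s, hs⟩ : Even D := he.mul_left _
    omega
  · have h2 := (quotGrading hU').pr_d (D - 1) w
    rw [← h2, hw, show D - 1 + 1 = D by omega]
    exact hdeg _

/-- The two halves travel together: acyclicity of the filtration gives the finite-dimensional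
cohomology that the Gysin and Wang arguments require. -/
theorem DualityHolds.insert [Finite M.ι] (hU : M.UpClosed U) (hU' : M.UpClosed (insert v U))
    (hv : v ∉ U) {n : ℕ} (hnil : (M.quot hU').HasNilModel (quotAug hU') n)
    (h : DualityHolds hU) : DualityHolds hU' := by
  obtain ⟨⟨p₀, hp₀⟩, m, hm⟩ := h
  have hfin := finiteDimensional_of_acyclicFrom hU hp₀
  have hproj : ∀ j (a : M.carrier), M.proj (M.In U) (M.proj (fun m => M.dg m = j) a) =
      M.proj (fun m => M.dg m = j) (M.proj (M.In U) a) := fun j a => proj_comm _ _ _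
  have hx1 : M.gen v ∈ M.coordSpan fun m => M.ew v ≤ wt M.ew m :=
    gen_mem_coordSpan (by rw [wt_single, one_mul])
  rcases Nat.even_or_odd (M.deg v) with he | ho
  · have hew : M.ew v = M.deg v := if_pos he
    obtain ⟨w, hw, hdw⟩ := exists_pow_exact hU' (Set.mem_insert v U) (hU.proj_d_gen hv) he hnil
    have hac : (M.quot hU').AcyclicFrom (quotFil hU') p₀ := by
      refine (evenStep hU hU' hv he).acyclicFrom (F := quotFil hU') (G := quotFil hU)
        (a := M.deg v) (N := n + 1) (fun p q hq => hq) ?_ ?_ ?_ ?_ ?_ ⟨w, hw, hdw⟩ hp₀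
      · exact fun p u hu => coordSpan_mono (fun m hm => hm.2) (proj_mem_of_mem hu)
      · exact fun p u hu => coordSpan_mono (fun m hm => hm.2) (proj_mem_of_mem (d_mem_ew hu))
      · exact fun p u hu => mul_mem_coordSpan (fun m m' h h' => by rw [wt_add]; omega) hx1 hu
      · refine fun p u hu => coeffGen_mem (fun m hm => ?_) hu
        rw [wt_add, wt_single, hew] at hm
        omega
      · exact fun p r u hu v hv => mul_mem_coordSpan (fun m m' h h' => by rw [wt_add]; omega) hu hv
    have hfin' := finiteDimensional_of_acyclicFrom hU' hac
    have hnt : Nontrivial (M.quot hU').carrier :=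
      ⟨⟨1, 0, fun h => one_ne_zero' (congrArg Subtype.val h)⟩⟩
    refine ⟨⟨p₀, hac⟩, (evenStep hU hU' hv he).isPoincare (G := quotGrading hU')
      (K := quotGrading hU) (a := M.deg v) (n := m) (N := n + 1) (M.two_le_deg v) ?_ ?_ ?_ ?_ ?_
      ⟨w, hdw⟩ hm⟩
    · exact Subtype.ext (mem_coordSpan_iff.1
        (one_mem_coordSpan (T := fun m => M.dg m = 0) (by simp)))
    · exact fun j u => Subtype.ext (proj_dg_gen_mul v j u.1)
    · exact fun j q => rfl
    · exact fun j u => Subtype.ext (hproj j u.1)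
    · exact fun j u => Subtype.ext (proj_dg_coeffGen v j u.1)
  · have hew : M.ew v = M.deg v + 1 := if_neg (Nat.not_even_iff_odd.2 ho)
    -- For an odd generator the filtration shifts by the weight `deg v + 1`, whereas the formal
    -- dimension below shifts by `deg v`.
    have hac : (M.quot hU').AcyclicFrom (quotFil hU') (p₀ + M.ew v) := by
      refine (oddStep hU hU' hv ho).acyclicFrom (F := quotFil hU') (G := quotFil hU)
        (b := M.ew v) (fun p q hq => hq) ?_ ?_ ?_ ?_ hp₀
      · exact fun p u hu => coordSpan_mono (fun m hm => hm.2) (proj_mem_of_mem hu)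
      · exact fun p u hu => coordSpan_mono (fun m hm => hm.2) (proj_mem_of_mem (d_mem_ew hu))
      · exact fun p u hu => mul_mem_coordSpan (fun m m' h h' => by rw [wt_add]; omega) hx1 hu
      · refine fun p u hu => coeffGen_mem (fun m hm => ?_) hu
        rw [wt_add, wt_single] at hm
        omega
    have hfin' := finiteDimensional_of_acyclicFrom hU' hac
    refine ⟨⟨_, hac⟩, (oddStep hU hU' hv ho).isPoincare (G := quotGrading hU')
      (K := quotGrading hU) (b := M.deg v) (n := m) (M.two_le_deg v) ?_ ?_ ?_ hm⟩
    · exact fun j u => Subtype.ext (proj_dg_gen_mul v j u.1)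
    · exact fun j q => rfl
    · exact fun j u => Subtype.ext (proj_dg_coeffGen v j u.1)

theorem in_empty {m : M.ι →₀ ℕ} (h : M.In ∅ m) : m = 0 := by
  ext i
  exact not_not.1 fun hi => h i hi

theorem dualityHolds_empty (hU : M.UpClosed ∅) : DualityHolds hU := by
  have hval : M.Valid 0 := fun i _ => Nat.zero_le _
  have key : ∀ a : (M.quot hU).carrier, ∃ c : ℚ, a.1 = c • (1 : M.carrier) := by
    intro a
    have : M.coordSpan (M.In ∅) ≤ Submodule.span ℚ {(1 : M.carrier)} := coordSpan_le fun m hm => by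
      rw [in_empty hm, mono_zero]
      exact Submodule.mem_span_singleton_self _
    obtain ⟨c, hc⟩ := Submodule.mem_span_singleton.1 (this a.2)
    exact ⟨c, hc.symm⟩
  have hd : ∀ a : (M.quot hU).carrier, (M.quot hU).d a = 0 := by
    intro a
    obtain ⟨c, hc⟩ := key a
    refine Subtype.ext ?_
    change M.proj (M.In ∅) (M.d a.1) = 0
    rw [hc, map_smul, d_one, smul_zero, map_zero]
  refine ⟨⟨1, fun p hp z hz _ => ?_⟩, 0, (M.basis.coord ⟨0, hval⟩) ∘ₗ quotVal hU, ?_, ?_, ?_⟩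
  · have hz0 : z = 0 := Subtype.ext <| by
      refine coordSpan_le (S := ⊥) (fun m hm => ?_) (mem_coordSpan_and (mem_sub.1 z.2) hz)
      exfalso
      have := hm.2
      rw [in_empty hm.1, wt_zero] at this
      omega
    exact ⟨0, Submodule.zero_mem _, by rw [hz0, map_zero]⟩
  · intro a
    rw [hd, map_zero]
  · intro a
    obtain ⟨c, hc⟩ := key a
    have h1 : M.proj (fun m => M.dg m = 0) a.1 = a.1 := by
      rw [hc, map_smul, mem_coordSpan_iff.1 (one_mem_coordSpan (by simp))]
    exact congrArg (M.basis.coord ⟨0, hval⟩) h1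
  · intro a _ hab
    have h1 := hab 1 (hd 1)
    rw [mul_one] at h1
    obtain ⟨c, hc⟩ := key a
    have h2 : M.basis.coord ⟨0, hval⟩ a.1 = c := by
      rw [hc, ← mono_zero, ← basis_apply M ⟨0, hval⟩, map_smul, Module.Basis.coord_apply,
        Module.Basis.repr_self, Finsupp.single_eq_same, smul_eq_mul, mul_one]
    have h3 : c = 0 := h2.symm.trans h1
    refine ⟨0, ?_⟩
    rw [map_zero]
    refine Subtype.ext ?_
    rw [hc, h3, zero_smul]
    rfl

/-- Induction on the number of generators, splitting off one of least degree. Two inductions in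
opposite directions meet: nilpotence descends from `M` to the quotients, duality ascends from `ℚ`.
-/
theorem dualityHolds [Finite M.ι] {n : ℕ} (h : M.ExactAbove n) :
    ∀ (U : Set M.ι) (hU : M.UpClosed U), DualityHolds hU := by
  have key : ∀ k : ℕ, ∀ (U : Set M.ι) (hU : M.UpClosed U), U.ncard = k → DualityHolds hU := by
    intro k
    induction k with
    | zero =>
      intro U hU hk
      rw [Set.ncard_eq_zero (Set.toFinite _)] at hk
      subst hk
      exact dualityHolds_empty hU
    | succ k ih =>
      intro U hU hk
      obtain ⟨v, hv, hmin⟩ := Set.exists_min_image U M.deg (Set.toFinite _)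
        (Set.nonempty_of_ncard_ne_zero (by omega))
      have hU0 : M.UpClosed (U \ {v}) := by
        rintro i j ⟨hi, -⟩ hij
        refine ⟨hU i j hi hij, ?_⟩
        rintro rfl
        exact absurd (hmin i hi) (not_le.2 hij)
      have hc := Set.ncard_sdiff_singleton_add_one hv (Set.toFinite _)
      have hins : Insert.insert v (U \ {v}) = U := Set.insert_sdiff_self_of_mem hv
      have hv0 : v ∉ U \ {v} := fun h' => h'.2 rfl
      have hd := ih _ hU0 (by omega)
      generalize U \ {v} = U₀ at *
      subst hins
      exact hd.insert hU0 hU hv0 (hasNilModel h.hasNilModel _ hU)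
  exact fun U hU => key _ U hU rfl

theorem mem_sub_univ (a : M.carrier) : a ∈ M.sub Set.univ := by
  rw [mem_sub, mem_coordSpan_iff, proj_univ]

theorem ExactAbove.acyclic_ew [Finite M.ι] {n : ℕ} (h : M.ExactAbove n) :
    ∃ p₀, ∀ p, p₀ ≤ p → ∀ z ∈ M.coordSpan (fun m => p ≤ wt M.ew m), M.d z = 0 →
      ∃ u ∈ M.coordSpan (fun m => p ≤ wt M.ew m), M.d u = z := by
  obtain ⟨⟨p₀, hp₀⟩, -⟩ := dualityHolds h _ upClosed_univ
  refine ⟨p₀, fun p hp z hz hdz => ?_⟩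
  obtain ⟨u, hu, hdu⟩ := hp₀ p hp (⟨z, mem_sub_univ z⟩ : M.sub Set.univ) hz
    (Subtype.ext ((proj_univ _).trans hdz))
  exact ⟨u.1, hu, (proj_univ _).symm.trans (congrArg Subtype.val hdu)⟩

theorem ExactAbove.duality [Finite M.ι] {n : ℕ} (h : M.ExactAbove n) :
    ∃ (m : ℕ) (ω : M.carrier →ₗ[ℚ] ℚ), (∀ a, ω (M.d a) = 0) ∧
      (∀ a, ω (M.proj (fun e => M.dg e = m) a) = ω a) ∧
      ∀ a, M.d a = 0 → (∀ b, M.d b = 0 → ω (a * b) = 0) → a ∈ LinearMap.range M.d := by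
  obtain ⟨-, m, ω, h1, h2, h3⟩ := dualityHolds h _ (upClosed_univ (M := M))
  refine ⟨m, ω ∘ₗ (M.ret Set.univ).toLinearMap, fun a => ?_, fun a => ?_, fun a ha hab => ?_⟩
  · rw [← h1 (M.ret Set.univ a)]
    refine congrArg ω (Subtype.ext ?_)
    change M.proj _ (M.d a) = M.proj _ (M.d (M.proj _ a))
    rw [proj_univ, proj_univ, proj_univ]
  · refine Eq.trans (congrArg ω (Subtype.ext ?_)) (h2 (M.ret Set.univ a))
    change M.proj _ (M.proj _ a) = M.proj _ (M.proj _ a)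
    rw [proj_univ, proj_univ]
  · obtain ⟨b, hb⟩ := h3 (⟨a, mem_sub_univ a⟩ : M.sub Set.univ)
      (Subtype.ext ((proj_univ _).trans ha)) fun b hb => by
        refine Eq.trans (congrArg ω (Subtype.ext ?_)) (hab b.1 ((proj_univ _).symm.trans
          (congrArg Subtype.val hb)))
        change a * b.1 = M.proj _ (a * b.1)
        rw [proj_univ]
    exact ⟨b.1, (proj_univ _).symm.trans (congrArg Subtype.val hb)⟩

end MinimalSullivanAlgebra

/-! ### Betti numbers -/

namespace CochainAlgebra

variable {A : CochainAlgebra.{u}}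

/-- The class of a cocycle. -/
def cohomologyMk (A : CochainAlgebra.{u}) (j : ℕ) : A.cocycles j →ₗ[ℚ] A.cohomology j :=
  Submodule.mkQ _

theorem cohomologyMk_surjective (j : ℕ) : Function.Surjective (A.cohomologyMk j) :=
  Submodule.mkQ_surjective _

theorem cohomologyMk_eq_zero {j : ℕ} {a : A.cocycles j} :
    A.cohomologyMk j a = 0 ↔ a.1 ∈ LinearMap.range A.d :=
  (Submodule.Quotient.mk_eq_zero _)

/-- Descends a linear map to cohomology. -/
def cohomologyLift {j : ℕ} {N : Type*} [AddCommGroup N] [Module ℚ N] (f : A.cocycles j →ₗ[ℚ] N)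
    (h : ∀ a : A.cocycles j, a.1 ∈ LinearMap.range A.d → f a = 0) : A.cohomology j →ₗ[ℚ] N :=
  Submodule.liftQ _ f h

theorem cohomologyLift_mk {j : ℕ} {N : Type*} [AddCommGroup N] [Module ℚ N]
    (f : A.cocycles j →ₗ[ℚ] N) (h : ∀ a : A.cocycles j, a.1 ∈ LinearMap.range A.d → f a = 0)
    (a : A.cocycles j) : cohomologyLift f h (A.cohomologyMk j a) = f a := rfl

theorem subsingleton_cohomology_iff {j : ℕ} :
    Subsingleton (A.cohomology j) ↔ ∀ a ∈ A.gr j, A.d a = 0 → a ∈ LinearMap.range A.d := by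
  constructor
  · intro h a ha hda
    exact cohomologyMk_eq_zero (a := (⟨a, ha, hda⟩ : A.cocycles j)).1 (Subsingleton.elim _ _)
  · intro h
    refine ⟨fun x y => ?_⟩
    obtain ⟨a, rfl⟩ := cohomologyMk_surjective j x
    obtain ⟨b, rfl⟩ := cohomologyMk_surjective j y
    rw [cohomologyMk_eq_zero.2 (h _ a.2.1 a.2.2), cohomologyMk_eq_zero.2 (h _ b.2.1 b.2.2)]

end CochainAlgebra

namespace MinimalSullivanAlgebra

open CochainAlgebra

variable {M : MinimalSullivanAlgebra.{u}}

theorem finiteDimensional_gr [Finite M.ι] (j : ℕ) : FiniteDimensional ℚ (M.gr j) := by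
  rw [gr_eq]
  refine finiteDimensional_coordSpan ((finite_wt_lt (w := M.deg) (fun i => ?_) (j + 1)).subset
    fun m hm => ?_)
  · have := M.two_le_deg i; omega
  · exact Nat.lt_succ_of_le (le_of_eq hm)

theorem finiteDimensional_cohomology [Finite M.ι] (j : ℕ) :
    FiniteDimensional ℚ (M.cohomology j) := by
  have := finiteDimensional_gr (M := M) j
  have : FiniteDimensional ℚ (M.cocycles j) := Submodule.finiteDimensional_of_le inf_le_left
  exact Module.Finite.of_surjective _ (cohomologyMk_surjective j)

theorem exactAbove_of_isFormalDimension {n : ℕ} (h : M.IsFormalDimension n) : M.ExactAbove n := by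
  intro j hj a ha hda
  rw [← gr_eq] at ha
  refine subsingleton_cohomology_iff.1 ?_ a ha hda
  rw [← not_nontrivial_iff_subsingleton]
  exact fun hnt => absurd (h.2 hnt) (not_le.2 hj)

/-- The pairing on cohomology given by a functional. -/
noncomputable def cohomologyPairing (M : MinimalSullivanAlgebra.{u}) (ω : M.carrier →ₗ[ℚ] ℚ)
    (hω : ∀ a, ω (M.d a) = 0) (i j : ℕ) :
    M.cohomology i →ₗ[ℚ] Module.Dual ℚ (M.cohomology j) :=
  cohomologyLift
    { toFun := fun a => cohomologyLift (ω ∘ₗ LinearMap.mulLeft ℚ a.1 ∘ₗ (M.cocycles j).subtype) (by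
        rintro ⟨_, hb⟩ ⟨b, rfl⟩
        change ω (a.1 * M.d b) = 0
        have h := M.leibniz i a.1 b a.2.1
        rw [LinearMap.mem_ker.1 a.2.2, zero_mul, zero_add] at h
        have h2 := hω (a.1 * b)
        rw [h, map_smul] at h2
        exact (smul_eq_zero.1 h2).resolve_left (pow_ne_zero _ (by norm_num)))
      map_add' := fun a a' => by
        refine LinearMap.ext fun h => ?_
        obtain ⟨b, rfl⟩ := cohomologyMk_surjective j h
        simp [cohomologyLift_mk, add_mul]
      map_smul' := fun c a => by
        refine LinearMap.ext fun h => ?_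
        obtain ⟨b, rfl⟩ := cohomologyMk_surjective j h
        simp [cohomologyLift_mk] }
    (by
      rintro ⟨_, ha⟩ ⟨a, rfl⟩
      refine LinearMap.ext fun h => ?_
      obtain ⟨b, rfl⟩ := cohomologyMk_surjective j h
      change ω (M.d a * b.1) = 0
      have h := M.leibniz_par a b.1
      rw [LinearMap.mem_ker.1 b.2.2, mul_zero, add_zero] at h
      rw [← h, hω])

theorem cohomologyPairing_injective {ω : M.carrier →ₗ[ℚ] ℚ} (hω : ∀ a, ω (M.d a) = 0) {m : ℕ}
    (hm : ∀ a, ω (M.proj (fun e => M.dg e = m) a) = ω a)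
    (hnd : ∀ a, M.d a = 0 → (∀ b, M.d b = 0 → ω (a * b) = 0) → a ∈ LinearMap.range M.d)
    {i j : ℕ} (hij : i + j = m) : Function.Injective (M.cohomologyPairing ω hω i j) := by
  rw [← LinearMap.ker_eq_bot, LinearMap.ker_eq_bot']
  intro x hx
  obtain ⟨a, rfl⟩ := cohomologyMk_surjective i x
  refine cohomologyMk_eq_zero.2 (hnd _ a.2.2 fun b hb => ?_)
  have ha : M.proj (fun e => M.dg e = i) a.1 = a.1 := mem_coordSpan_iff.1 (gr_eq M i ▸ a.2.1)
  have hb' : M.proj (fun e => M.dg e = j) b ∈ M.cocycles j := by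
    refine ⟨gr_eq M j ▸ proj_mem _ _, ?_⟩
    change M.d _ = 0
    rw [← proj_dg_d, hb, map_zero]
  rw [← hm, ← hij, proj_dg_mul j ha]
  exact LinearMap.congr_fun hx (M.cohomologyMk j ⟨_, hb'⟩)

theorem one_not_exact : (1 : M.carrier) ∉ LinearMap.range M.d := by
  rintro ⟨b, hb⟩
  have h := proj_dg_zero_d b
  rw [hb, mem_coordSpan_iff.1 (one_mem_coordSpan (by simp))] at h
  exact one_ne_zero' h

theorem nontrivial_cohomology_zero : Nontrivial (M.cohomology 0) := by
  rw [← not_subsingleton_iff_nontrivial, subsingleton_cohomology_iff]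
  exact fun h => one_not_exact (h 1 SetLike.GradedOne.one_mem M.d_one)

/-- Poincaré duality for the cohomology of an elliptic minimal Sullivan algebra. -/
theorem finrank_cohomology_eq [Finite M.ι] {n : ℕ} (h : M.IsFormalDimension n) {i j : ℕ}
    (hij : i + j = n) :
    Module.finrank ℚ (M.cohomology i) = Module.finrank ℚ (M.cohomology j) := by
  obtain ⟨m, ω, hω, hm, hnd⟩ := (exactAbove_of_isFormalDimension h).duality
  have hfin := finiteDimensional_cohomology (M := M)
  have hle : ∀ i j, i + j = m →
      Module.finrank ℚ (M.cohomology i) ≤ Module.finrank ℚ (M.cohomology j) := fun i j hij => by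
    rw [← Subspace.dual_finrank_eq (V := M.cohomology j)]
    exact LinearMap.finrank_le_finrank_of_injective (cohomologyPairing_injective hω hm hnd hij)
  -- The degree `m` of the functional is the formal dimension: degree `m` is paired injectively with
  -- degree zero, and nothing above `m` pairs nontrivially.
  have hmn : m = n := by
    apply le_antisymm
    · refine h.2 ?_
      have h0 := nontrivial_cohomology_zero (M := M)
      have h1 := hle 0 m (zero_add m)
      have h2 := Module.finrank_pos (R := ℚ) (M := M.cohomology 0)
      exact Module.nontrivial_of_finrank_pos (R := ℚ) (h2.trans_le h1)
    · by_contra hlt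
      obtain ⟨x, hx⟩ := @exists_ne _ h.1 (0 : M.cohomology n)
      obtain ⟨a, rfl⟩ := cohomologyMk_surjective n x
      refine hx (cohomologyMk_eq_zero.2 (hnd _ a.2.2 fun b _ => ?_))
      rw [← hm, proj_dg_mul_lt (i := n) (mem_coordSpan_iff.1 (gr_eq M n ▸ a.2.1)) b (by omega),
        map_zero]
  subst hmn
  exact le_antisymm (hle i j hij) (hle j i (by omega))

end MinimalSullivanAlgebra

/-! ### The Euler characteristic as a signed count of monomials -/

theorem Submodule.finrank_map_add_finrank_inf_ker {V W : Type*} [AddCommGroup V] [Module ℚ V]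
    [AddCommGroup W] [Module ℚ W] (f : V →ₗ[ℚ] W) (S : Submodule ℚ V) [FiniteDimensional ℚ S] :
    Module.finrank ℚ (S.map f) + Module.finrank ℚ (S ⊓ LinearMap.ker f : Submodule ℚ V) =
      Module.finrank ℚ S := by
  rw [← (f.domRestrict S).finrank_range_add_finrank_ker, LinearMap.range_domRestrict,
    LinearMap.ker_domRestrict, ← Submodule.map_comap_subtype, Submodule.finrank_map_subtype_eq]

namespace MinimalSullivanAlgebra

open CochainAlgebra

variable {M : MinimalSullivanAlgebra.{u}}

theorem finrank_coordSpan {T : (M.ι →₀ ℕ) → Prop} (h : {m | M.Valid m ∧ T m}.Finite) :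
    Module.finrank ℚ (M.coordSpan T) = h.toFinset.card := by
  have h1 : M.coordSpan T =
      Submodule.span ℚ (Set.range fun m : h.toFinset => M.mono m.1) := by
    apply le_antisymm
    · refine coordSpan_le fun m hm => ?_
      by_cases hv : M.Valid m
      · exact Submodule.subset_span ⟨⟨m, h.mem_toFinset.2 ⟨hv, hm⟩⟩, rfl⟩
      · rw [M.mono_of_not_valid hv]; exact Submodule.zero_mem _
    · rw [Submodule.span_le]
      rintro _ ⟨m, rfl⟩
      exact mono_mem (h.mem_toFinset.1 m.2).2
  have h2 : LinearIndependent ℚ fun m : h.toFinset => M.mono m.1 := by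
    have := M.linearIndependent.comp
      (fun m : h.toFinset => (⟨m.1, (h.mem_toFinset.1 m.2).1⟩ : {m // M.Valid m})) fun a b hab =>
        Subtype.ext (congrArg (fun x : {m // M.Valid m} => x.1) hab)
    exact this
  rw [h1, finrank_span_eq_card h2, Fintype.card_coe]

theorem cocycles_inf_range_zero : M.cocycles 0 ⊓ LinearMap.range M.d = ⊥ := by
  rw [eq_bot_iff]
  rintro _ ⟨hz, b, rfl⟩
  have h1 : M.proj (fun m => M.dg m = 0) (M.d b) = M.d b :=
    mem_coordSpan_iff.1 (gr_eq M 0 ▸ hz.1)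
  rw [proj_dg_zero_d] at h1
  exact h1.symm

theorem cocycles_inf_range_succ (j : ℕ) :
    M.cocycles (j + 1) ⊓ LinearMap.range M.d = (M.gr j).map M.d := by
  apply le_antisymm
  · rintro _ ⟨hz, b, rfl⟩
    have h1 : M.proj (fun m => M.dg m = j + 1) (M.d b) = M.d b :=
      mem_coordSpan_iff.1 (gr_eq M (j + 1) ▸ hz.1)
    rw [proj_dg_d] at h1
    exact ⟨_, gr_eq M j ▸ proj_mem _ b, h1⟩
  · rintro _ ⟨b, hb, rfl⟩
    exact ⟨⟨M.d_mem _ _ hb, M.d_d b⟩, b, rfl⟩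

theorem finrank_cohomology_add [Finite M.ι] (j : ℕ) :
    Module.finrank ℚ (M.cohomology j) +
      Module.finrank ℚ (M.cocycles j ⊓ LinearMap.range M.d : Submodule ℚ M.carrier) =
      Module.finrank ℚ (M.cocycles j) := by
  have := finiteDimensional_gr (M := M) j
  have : FiniteDimensional ℚ (M.cocycles j) := Submodule.finiteDimensional_of_le inf_le_left
  rw [← Submodule.finrank_quotient_add_finrank
    ((LinearMap.range M.d).submoduleOf (M.cocycles j))]
  congr 1
  rw [← Submodule.map_comap_subtype, Submodule.finrank_map_subtype_eq]
  rfl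

theorem finrank_gr_zero [Finite M.ι] : Module.finrank ℚ (M.gr 0) =
    Module.finrank ℚ (M.cohomology 0) + Module.finrank ℚ ((M.gr 0).map M.d) := by
  have := finiteDimensional_gr (M := M) 0
  have h := finrank_cohomology_add (M := M) 0
  rw [cocycles_inf_range_zero, finrank_bot, add_zero] at h
  rw [← Submodule.finrank_map_add_finrank_inf_ker M.d, h, add_comm]
  rfl

theorem finrank_gr_succ [Finite M.ι] (j : ℕ) : Module.finrank ℚ (M.gr (j + 1)) =
    Module.finrank ℚ (M.cohomology (j + 1)) + Module.finrank ℚ ((M.gr j).map M.d) +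
      Module.finrank ℚ ((M.gr (j + 1)).map M.d) := by
  have := finiteDimensional_gr (M := M) (j + 1)
  have h := finrank_cohomology_add (M := M) (j + 1)
  rw [cocycles_inf_range_succ] at h
  rw [← Submodule.finrank_map_add_finrank_inf_ker M.d, h, add_comm]
  rfl

/-- The elements of degree `j` and even weight at least `p`. -/
def heavy (M : MinimalSullivanAlgebra.{u}) (p j : ℕ) : Submodule ℚ M.carrier :=
  M.coordSpan fun m => p ≤ wt M.ew m ∧ M.dg m = j

theorem heavy_le_gr (p j : ℕ) : M.heavy p j ≤ M.gr j := by
  rw [gr_eq]; exact coordSpan_mono fun m hm => hm.2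

theorem heavy_eq_gr {p j : ℕ} (h : p ≤ j) : M.heavy p j = M.gr j := by
  rw [gr_eq]
  refine le_antisymm (coordSpan_mono fun m hm => hm.2) (coordSpan_mono fun m hm => ⟨?_, hm⟩)
  have : M.dg m ≤ wt M.ew m := wt_mono M.deg_le_ew m
  omega

theorem finrank_heavy_zero [Finite M.ι] {p : ℕ}
    (h : ∀ z ∈ M.coordSpan (fun m => p ≤ wt M.ew m), M.d z = 0 →
      ∃ u ∈ M.coordSpan (fun m => p ≤ wt M.ew m), M.d u = z) :
    Module.finrank ℚ (M.heavy p 0) = Module.finrank ℚ ((M.heavy p 0).map M.d) := by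
  have := finiteDimensional_gr (M := M) 0
  have : FiniteDimensional ℚ (M.heavy p 0) := Submodule.finiteDimensional_of_le (heavy_le_gr p 0)
  have h0 : M.heavy p 0 ⊓ LinearMap.ker M.d = ⊥ := by
    rw [eq_bot_iff]
    rintro z ⟨hz, hdz⟩
    obtain ⟨u, -, rfl⟩ := h z (coordSpan_mono (fun m hm => hm.1) hz) hdz
    exact (cocycles_inf_range_zero (M := M)).le ⟨⟨heavy_le_gr p 0 hz, hdz⟩, u, rfl⟩
  rw [← Submodule.finrank_map_add_finrank_inf_ker M.d, h0, finrank_bot, add_zero]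

/-- Rank-nullity in the acyclic subcomplex of weight at least `p`: its cocycles are the boundaries
of its own elements, with no cohomology term. -/
theorem finrank_heavy_succ [Finite M.ι] {p : ℕ}
    (h : ∀ z ∈ M.coordSpan (fun m => p ≤ wt M.ew m), M.d z = 0 →
      ∃ u ∈ M.coordSpan (fun m => p ≤ wt M.ew m), M.d u = z) (j : ℕ) :
    Module.finrank ℚ (M.heavy p (j + 1)) = Module.finrank ℚ ((M.heavy p j).map M.d) +
      Module.finrank ℚ ((M.heavy p (j + 1)).map M.d) := by
  have := finiteDimensional_gr (M := M) (j + 1)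
  have : FiniteDimensional ℚ (M.heavy p (j + 1)) :=
    Submodule.finiteDimensional_of_le (heavy_le_gr p _)
  have h0 : M.heavy p (j + 1) ⊓ LinearMap.ker M.d = (M.heavy p j).map M.d := by
    apply le_antisymm
    · rintro z ⟨hz, hdz⟩
      obtain ⟨u, hu, rfl⟩ := h z (coordSpan_mono (fun m hm => hm.1) hz) hdz
      refine ⟨M.proj (fun m => M.dg m = j) u,
        coordSpan_mono (fun m hm => ⟨hm.2, hm.1⟩) (proj_mem_of_mem hu), ?_⟩
      rw [← proj_dg_d]
      exact mem_coordSpan_iff.1 (coordSpan_mono (fun m hm => hm.2) hz)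
    · rintro _ ⟨b, hb, rfl⟩
      refine ⟨mem_coordSpan_and (d_mem_ew (coordSpan_mono (fun m hm => hm.1) hb)) ?_, M.d_d b⟩
      rw [← gr_eq]
      exact M.d_mem _ _ (heavy_le_gr p j hb)
  rw [← Submodule.finrank_map_add_finrank_inf_ker M.d, h0, add_comm]

theorem finite_valid_dg [Finite M.ι] (T : (M.ι →₀ ℕ) → Prop) (j : ℕ) :
    {m | M.Valid m ∧ T m ∧ M.dg m = j}.Finite := by
  refine (finite_wt_lt (w := M.deg) (fun i => ?_) (j + 1)).subset fun m hm => ?_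
  · have := M.two_le_deg i; omega
  · exact Nat.lt_succ_of_le (le_of_eq hm.2.2)

theorem finite_light [Finite M.ι] (p : ℕ) : {m | M.Valid m ∧ wt M.ew m < p}.Finite :=
  (finite_wt_lt ew_pos p).subset fun _ hm => hm.2

theorem finrank_gr_eq [Finite M.ι] (p j : ℕ) : Module.finrank ℚ (M.gr j) =
    Module.finrank ℚ (M.heavy p j) +
      ((finite_light p).toFinset.filter fun m => M.dg m = j).card := by
  classical
  have h1 : {m | M.Valid m ∧ M.dg m = j}.Finite :=
    (finite_valid_dg (fun _ => True) j).subset fun m hm => ⟨hm.1, trivial, hm.2⟩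
  rw [gr_eq, heavy, finrank_coordSpan h1, finrank_coordSpan (finite_valid_dg _ j),
    ← Finset.card_filter_add_card_filter_not (s := h1.toFinset) (p := fun m => p ≤ wt M.ew m)]
  congr 2
  · ext m
    simp only [Finset.mem_filter, Set.Finite.mem_toFinset, Set.mem_ofPred_eq]
    tauto
  · ext m
    simp only [Finset.mem_filter, Set.Finite.mem_toFinset, Set.mem_ofPred_eq, not_le]
    tauto

/-- Dividing out the acyclic subcomplex of weight at least `p` does not change cohomology and leaves
a finite complex with the light monomials as basis. Its Euler characteristic is a signed count of
basis elements. -/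
theorem ExactAbove.euler_char [Finite M.ι] {n : ℕ} (h : M.ExactAbove n) :
    ∃ p₀, ∀ p, p₀ ≤ p → ∀ J, p ≤ J →
      ∑ j ∈ Finset.range (J + 1), (-1 : ℤ) ^ j * (Module.finrank ℚ (M.cohomology j) : ℤ) =
        ∑ m ∈ (finite_light (M := M) p).toFinset, (-1 : ℤ) ^ M.dg m := by
  classical
  obtain ⟨p₀, hp₀⟩ := h.acyclic_ew
  refine ⟨p₀, fun p hp J hJ => ?_⟩
  have hac := hp₀ p hp
  set F := (finite_light (M := M) p).toFinset with hF
  have h1 : ∑ m ∈ F, (-1 : ℤ) ^ M.dg m =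
      ∑ j ∈ Finset.range (J + 1), (-1 : ℤ) ^ j * ((F.filter fun m => M.dg m = j).card : ℤ) := by
    rw [← Finset.sum_fiberwise_of_maps_to (s := F) (t := Finset.range (J + 1)) (g := M.dg)]
    · refine Finset.sum_congr rfl fun j _ => ?_
      rw [Finset.sum_congr rfl (g := fun _ => (-1 : ℤ) ^ j)
        fun m hm => by rw [(Finset.mem_filter.1 hm).2], Finset.sum_const, nsmul_eq_mul, mul_comm]
    · intro m hm
      have h2 := ((finite_light (M := M) p).mem_toFinset.1 hm).2
      have h3 : M.dg m ≤ wt M.ew m := wt_mono M.deg_le_ew m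
      rw [Finset.mem_range]; omega
  -- The alternating sums telescope. The boundary term compares the ranks of `d` on all elements and
  -- on heavy elements of degree `J`; it vanishes for `J ≥ p`, since every monomial of such degree
  -- is heavy.
  have key : ∀ J, ∑ j ∈ Finset.range (J + 1), (-1 : ℤ) ^ j * ((F.filter fun m => M.dg m = j).card : ℤ) =
      ∑ j ∈ Finset.range (J + 1), (-1 : ℤ) ^ j * (Module.finrank ℚ (M.cohomology j) : ℤ) +
        (-1 : ℤ) ^ J * ((Module.finrank ℚ ((M.gr J).map M.d) : ℤ) -
          (Module.finrank ℚ ((M.heavy p J).map M.d) : ℤ)) := by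
    intro J
    induction J with
    | zero =>
      have e1 := finrank_gr_eq (M := M) p 0
      rw [finrank_gr_zero, finrank_heavy_zero hac, ← hF] at e1
      simp only [zero_add, Finset.sum_range_one, pow_zero, one_mul]
      omega
    | succ J ih =>
      have e1 := finrank_gr_eq (M := M) p (J + 1)
      rw [finrank_gr_succ, finrank_heavy_succ hac, ← hF] at e1
      rw [Finset.sum_range_succ, ih, Finset.sum_range_succ _ (J + 1), pow_succ]
      have e2 := congrArg (Nat.cast : ℕ → ℤ) e1
      simp only [Nat.cast_add] at e2
      linear_combination (-1 : ℤ) ^ J * e2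
  rw [h1, key J, heavy_eq_gr hJ, sub_self, mul_zero, add_zero]

end MinimalSullivanAlgebra

/-! ### The generating function of the signed number of monomials -/

/-- A comparison of orders of vanishing at `1`: each factor on the left has a simple zero, each
factor on the right at least one, and there are more factors on the right. -/
theorem Polynomial.eval_one_eq_zero_of_mul_prod {α β : Type*} (s : Finset α) (t : Finset β)
    (a : α → ℕ) (b : β → ℕ) (ha : ∀ i ∈ s, 0 < a i) (hst : s.card < t.card) {P : Polynomial ℤ}
    (h : P * ∏ i ∈ s, (1 - Polynomial.X ^ a i) = ∏ i ∈ t, (1 - Polynomial.X ^ b i)) :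
    P.eval 1 = 0 := by
  have hg : ∀ e : ℕ, (1 - Polynomial.X ^ e : Polynomial ℤ) =
      (1 - Polynomial.X) * ∑ i ∈ Finset.range e, Polynomial.X ^ i := fun e =>
    (mul_neg_geom_sum Polynomial.X e).symm
  simp only [hg, Finset.prod_mul_distrib, Finset.prod_const] at h
  obtain ⟨k, hk⟩ : ∃ k, t.card = s.card + (k + 1) := ⟨t.card - s.card - 1, by omega⟩
  have h0 : (1 - Polynomial.X : Polynomial ℤ) ≠ 0 := fun h0 => by
    have := congrArg (Polynomial.eval 0) h0
    simp at this
  rw [hk, pow_add, mul_left_comm, mul_assoc] at h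
  -- After cancelling, the right side still has a factor `1 - X`, while the remaining geometric sums
  -- on the left take the nonzero values `a i` at `1`.
  have h1 := congrArg (Polynomial.eval 1) (mul_left_cancel₀ (pow_ne_zero _ h0) h)
  simp only [Polynomial.eval_mul, Polynomial.eval_prod, Polynomial.eval_pow, Polynomial.eval_sub,
    Polynomial.eval_one, Polynomial.eval_X, sub_self, Polynomial.eval_finsetSum, one_pow,
    Finset.sum_const, Finset.card_range, zero_pow (Nat.succ_ne_zero k), zero_mul] at h1
  refine (mul_eq_zero.1 h1).resolve_right (Finset.prod_ne_zero_iff.2 fun i hi => ?_)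
  have := ha i hi
  simp only [nsmul_eq_mul, mul_one, ne_eq, Nat.cast_eq_zero]
  omega

namespace MinimalSullivanAlgebra

open Finsupp

variable {M : MinimalSullivanAlgebra.{u}} {U : Set M.ι} {v : M.ι}

/-- The monomials of even weight `r` in the generators from `U`. -/
def weightSet (M : MinimalSullivanAlgebra.{u}) (U : Set M.ι) (r : ℕ) : Set (M.ι →₀ ℕ) :=
  {m | M.Valid m ∧ M.In U m ∧ wt M.ew m = r}

/-- The number of monomials of even degree minus the number of monomials of odd degree. -/
noncomputable def signCount (M : MinimalSullivanAlgebra.{u}) (S : Set (M.ι →₀ ℕ)) : ℤ :=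
  ∑ᶠ m ∈ S, (-1 : ℤ) ^ M.dg m

theorem finite_weightSet [Finite M.ι] (U : Set M.ι) (r : ℕ) : (M.weightSet U r).Finite :=
  (finite_wt_lt ew_pos (r + 1)).subset fun _ hm => Nat.lt_succ_of_le (le_of_eq hm.2.2)

theorem in_insert_iff (hv : v ∉ U) {m : M.ι →₀ ℕ} :
    M.In U m ↔ M.In (insert v U) m ∧ m v = 0 := by
  constructor
  · intro h
    exact ⟨fun i hi => Or.inr (h i hi), not_not.1 fun h0 => hv (h v h0)⟩
  · rintro ⟨h, h0⟩ i hi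
    refine (h i hi).resolve_left ?_
    rintro rfl
    exact hi h0

theorem valid_add_single {m : M.ι →₀ ℕ} :
    M.Valid (m + single v 1) ↔ M.Valid m ∧ (Even (M.deg v) ∨ m v = 0) := by
  constructor
  · intro h
    refine ⟨fun i hi => le_trans (by rw [Finsupp.add_apply]; omega) (h i hi), ?_⟩
    rcases Nat.even_or_odd (M.deg v) with he | ho
    · exact Or.inl he
    · have := h v ho
      rw [Finsupp.add_apply, Finsupp.single_eq_same] at this
      exact Or.inr (by omega)
  · rintro ⟨h, h'⟩ i hi
    rw [Finsupp.add_apply, Finsupp.single_apply]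
    split_ifs with hiv
    · subst hiv
      rw [h'.resolve_left (Nat.not_even_iff_odd.2 hi)]
    · exact h i hi

theorem in_insert_add_single {m : M.ι →₀ ℕ} :
    M.In (insert v U) (m + single v 1) ↔ M.In (insert v U) m := by
  rw [in_add, and_iff_left_iff_imp]
  intro _ i hi
  rw [Finsupp.single_apply] at hi
  split_ifs at hi with h
  · exact Or.inl h.symm
  · exact absurd rfl hi

/-- Monomials are split by whether `v` occurs; in those containing it one factor `v` is removed. -/
theorem signCount_insert [Finite M.ι] (hv : v ∉ U) (r : ℕ) :
    M.signCount (M.weightSet (insert v U) r) = M.signCount (M.weightSet U r) +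
      (-1 : ℤ) ^ M.deg v * M.signCount {m | m + single v 1 ∈ M.weightSet (insert v U) r} := by
  have h1 : M.weightSet (insert v U) r = M.weightSet U r ∪
      (· + single v 1) '' {m | m + single v 1 ∈ M.weightSet (insert v U) r} := by
    ext m
    constructor
    · intro hm
      by_cases h0 : m v = 0
      · exact Or.inl ⟨hm.1, (in_insert_iff hv).2 ⟨hm.2.1, h0⟩, hm.2.2⟩
      · have h2 : m - single v 1 + single v 1 = m :=
          tsub_add_cancel_of_le (by rw [Finsupp.single_le_iff]; omega)
        exact Or.inr ⟨m - single v 1, by rwa [Set.mem_ofPred_eq, h2], h2⟩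
    · rintro (hm | ⟨m', hm', rfl⟩)
      · exact ⟨hm.1, ((in_insert_iff hv).1 hm.2.1).1, hm.2.2⟩
      · exact hm'
  have hfin := finite_weightSet (insert v U) r
  have hinj : Function.Injective fun m : M.ι →₀ ℕ => m + single v 1 := add_left_injective _
  have hfin2 : {m | m + single v 1 ∈ M.weightSet (insert v U) r}.Finite :=
    hfin.preimage hinj.injOn
  have hdisj : Disjoint (M.weightSet U r)
      ((· + single v 1) '' {m | m + single v 1 ∈ M.weightSet (insert v U) r}) := by
    rw [Set.disjoint_left]
    rintro _ hm ⟨m', -, rfl⟩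
    have := ((in_insert_iff hv).1 hm.2.1).2
    rw [Finsupp.add_apply, Finsupp.single_eq_same] at this
    omega
  have h3 : ∀ m, (-1 : ℤ) ^ M.dg (m + single v 1) = (-1 : ℤ) ^ M.deg v * (-1 : ℤ) ^ M.dg m := by
    intro m
    rw [dg_add, dg, dg, wt_single, one_mul, pow_add, mul_comm]
  conv_lhs => rw [h1]
  rw [signCount, finsum_mem_union hdisj (finite_weightSet U r) (hfin2.image _),
    finsum_mem_image hinj.injOn]
  simp only [h3]
  rw [signCount, signCount, mul_finsum_mem' _ _ hfin2]

/-- The generating function of the signed numbers of monomials. -/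
noncomputable def signSeries (M : MinimalSullivanAlgebra.{u}) (U : Set M.ι) : PowerSeries ℤ :=
  PowerSeries.mk fun r => M.signCount (M.weightSet U r)

/-- An even generator occurs with every exponent and contributes a geometric series. An odd one,
below, occurs at most once and with a sign, contributing `1 - X ^ ew v`. -/
theorem signSeries_insert_even [Finite M.ι] (hv : v ∉ U) (he : Even (M.deg v)) :
    M.signSeries (insert v U) * (1 - PowerSeries.X ^ M.ew v) = M.signSeries U := by
  ext r
  rw [mul_sub, mul_one, map_sub, PowerSeries.coeff_mul_X_pow', sub_eq_iff_eq_add]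
  simp only [signSeries, PowerSeries.coeff_mk]
  rw [signCount_insert hv, he.neg_one_pow, one_mul]
  congr 1
  split_ifs with h
  · congr 1
    ext m
    simp only [weightSet, Set.mem_ofPred_eq, valid_add_single, in_insert_add_single, wt_add,
      wt_single, he, true_or, and_true]
    refine and_congr_right fun _ => and_congr_right fun _ => ?_
    omega
  · rw [signCount, finsum_mem_eq_zero_of_forall_eq_zero]
    intro m hm
    have := hm.2.2
    rw [wt_add, wt_single] at this
    omega

theorem signSeries_insert_odd [Finite M.ι] (hv : v ∉ U) (ho : Odd (M.deg v)) :
    M.signSeries (insert v U) = M.signSeries U * (1 - PowerSeries.X ^ M.ew v) := by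
  ext r
  rw [mul_sub, mul_one, map_sub, PowerSeries.coeff_mul_X_pow', sub_eq_add_neg]
  simp only [signSeries, PowerSeries.coeff_mk]
  rw [signCount_insert hv, ho.neg_one_pow, neg_one_mul]
  congr 2
  split_ifs with h
  · congr 1
    ext m
    simp only [weightSet, Set.mem_ofPred_eq, valid_add_single, in_insert_add_single, wt_add,
      wt_single, Nat.not_even_iff_odd.2 ho, false_or, in_insert_iff hv]
    constructor
    · rintro ⟨⟨h1, h2⟩, h3, h4⟩
      exact ⟨h1, ⟨h3, h2⟩, by omega⟩
    · rintro ⟨h1, ⟨h3, h2⟩, h4⟩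
      exact ⟨⟨h1, h2⟩, h3, by omega⟩
  · rw [signCount, finsum_mem_eq_zero_of_forall_eq_zero]
    intro m hm
    have := hm.2.2
    rw [wt_add, wt_single] at this
    omega

theorem signSeries_empty : M.signSeries ∅ = 1 := by
  ext r
  rw [signSeries, PowerSeries.coeff_mk, PowerSeries.coeff_one]
  split_ifs with h
  · have h1 : M.weightSet ∅ r = {0} := by
      ext m
      constructor
      · exact fun hm => in_empty hm.2.1
      · rintro rfl
        exact ⟨fun i _ => Nat.zero_le _, fun i hi => absurd rfl hi, by rw [wt_zero, h]⟩
    rw [signCount, h1, finsum_mem_singleton, dg, wt_zero, pow_zero]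
  · rw [signCount, finsum_mem_eq_zero_of_forall_eq_zero]
    intro m hm
    have := hm.2.2
    rw [in_empty hm.2.1, wt_zero] at this
    omega

theorem signSeries_mul_prod [Finite M.ι] (s : Finset M.ι) :
    M.signSeries s * ∏ i ∈ s.filter (fun i => Even (M.deg i)), (1 - PowerSeries.X ^ M.ew i) =
      ∏ i ∈ s.filter (fun i => ¬Even (M.deg i)), (1 - PowerSeries.X ^ M.ew i) := by
  classical
  induction s using Finset.induction_on with
  | empty => simp [signSeries_empty]
  | insert v s hv ih =>
    have hv' : v ∉ (s : Set M.ι) := hv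
    rw [Finset.filter_insert, Finset.filter_insert, Finset.coe_insert]
    by_cases he : Even (M.deg v)
    · rw [if_pos he, if_neg (not_not.2 he), Finset.prod_insert (by simp [hv]), ← mul_assoc,
        signSeries_insert_even hv' he, ih]
    · rw [if_neg he, if_pos he, Finset.prod_insert (by simp [hv]),
        signSeries_insert_odd hv' (Nat.not_even_iff_odd.1 he), mul_right_comm, ih, mul_comm]

theorem sum_signCount [Finite M.ι] (p : ℕ) :
    ∑ r ∈ Finset.range p, M.signCount (M.weightSet Set.univ r) =
      ∑ m ∈ (finite_light (M := M) p).toFinset, (-1 : ℤ) ^ M.dg m := by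
  classical
  rw [← Finset.sum_fiberwise_of_maps_to (t := Finset.range p) (g := wt M.ew)]
  · refine Finset.sum_congr rfl fun r hr => ?_
    rw [signCount, finsum_mem_eq_finite_toFinset_sum _ (finite_weightSet Set.univ r)]
    refine Finset.sum_congr ?_ fun _ _ => rfl
    ext m
    simp only [Set.Finite.mem_toFinset, Finset.mem_filter, weightSet, Set.mem_ofPred_eq, In,
      Set.mem_univ, implies_true, true_and]
    have := Finset.mem_range.1 hr
    constructor
    · rintro ⟨h1, h2⟩; exact ⟨⟨h1, by omega⟩, h2⟩
    · rintro ⟨⟨h1, -⟩, h2⟩; exact ⟨h1, h2⟩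
  · intro m hm
    exact Finset.mem_range.2 ((finite_light (M := M) p).mem_toFinset.1 hm).2

/-- The Euler characteristic vanishes if there are more generators of odd than of even degree. -/
theorem ExactAbove.euler_char_eq_zero [Fintype M.ι] {n : ℕ} (h : M.ExactAbove n)
    (hodd : (Finset.univ.filter fun i => Even (M.deg i)).card <
      (Finset.univ.filter fun i => ¬Even (M.deg i)).card) :
    ∑ j ∈ Finset.range (n + 1), (-1 : ℤ) ^ j * (Module.finrank ℚ (M.cohomology j) : ℤ) = 0 := by
  obtain ⟨p₀, hp₀⟩ := h.euler_char
  have hvan : ∀ j, n < j → Module.finrank ℚ (M.cohomology j) = 0 := fun j hj => by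
    have : Subsingleton (M.cohomology j) := CochainAlgebra.subsingleton_cohomology_iff.2
      fun a ha hda => h j hj a (gr_eq M j ▸ ha) hda
    exact Module.finrank_zero_of_subsingleton
  have hconst : ∀ J, n ≤ J →
      ∑ j ∈ Finset.range (J + 1), (-1 : ℤ) ^ j * (Module.finrank ℚ (M.cohomology j) : ℤ) =
      ∑ j ∈ Finset.range (n + 1), (-1 : ℤ) ^ j * (Module.finrank ℚ (M.cohomology j) : ℤ) := by
    intro J hJ
    refine (Finset.sum_subset (Finset.range_mono (by omega)) fun j _ hj => ?_).symm
    rw [hvan j (by rw [Finset.mem_range] at hj; omega), Nat.cast_zero, mul_zero]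
  set χ := ∑ j ∈ Finset.range (n + 1), (-1 : ℤ) ^ j * (Module.finrank ℚ (M.cohomology j) : ℤ)
  have hχ : ∀ p, p₀ ≤ p → ∑ r ∈ Finset.range p, M.signCount (M.weightSet Set.univ r) = χ := by
    intro p hp
    rw [sum_signCount, ← hp₀ p hp (max p n) (le_max_left _ _), hconst _ (le_max_right _ _)]
  -- The partial sums equal the Euler characteristic from `p₀` on, so later coefficients vanish: the
  -- series is a polynomial with value `χ` at `1`.
  have hzero : ∀ r, p₀ ≤ r → M.signCount (M.weightSet Set.univ r) = 0 := by
    intro r hr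
    have h1 := hχ (r + 1) (by omega)
    rw [Finset.sum_range_succ, hχ r hr] at h1
    omega
  have hP : ((PowerSeries.trunc p₀ (M.signSeries Set.univ) : Polynomial ℤ) : PowerSeries ℤ) =
      M.signSeries Set.univ := by
    ext r
    rw [Polynomial.coeff_coe, PowerSeries.coeff_trunc]
    split_ifs with hr
    · rfl
    · rw [signSeries, PowerSeries.coeff_mk, hzero r (by omega)]
  have heval : (PowerSeries.trunc p₀ (M.signSeries Set.univ)).eval 1 = χ := by
    rw [← hχ p₀ le_rfl, PowerSeries.trunc_apply, Polynomial.eval_finsetSum,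
      Nat.Ico_zero_eq_range]
    refine Finset.sum_congr rfl fun r _ => ?_
    rw [Polynomial.eval_monomial, one_pow, mul_one, signSeries, PowerSeries.coeff_mk]
  rw [← heval]
  refine Polynomial.eval_one_eq_zero_of_mul_prod _ _ M.ew M.ew (fun i _ => ew_pos i) hodd
    (Polynomial.coe_injective ℤ ?_)
  have h2 := signSeries_mul_prod (M := M) Finset.univ
  rw [Finset.coe_univ] at h2
  have hcoe : ∀ s : Finset M.ι, (((∏ i ∈ s, (1 - Polynomial.X ^ M.ew i) : Polynomial ℤ)) :
      PowerSeries ℤ) = ∏ i ∈ s, (1 - PowerSeries.X ^ M.ew i) := by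
    intro s
    rw [← Polynomial.coeToPowerSeries.ringHom_apply, map_prod]
    refine Finset.prod_congr rfl fun i _ => ?_
    rw [map_sub, map_one, map_pow, Polynomial.coeToPowerSeries.ringHom_apply, Polynomial.coe_X]
  rw [Polynomial.coe_mul, hP, hcoe, hcoe, h2]

end MinimalSullivanAlgebra

/-! ### Generators -/

namespace MinimalSullivanAlgebra

open Finsupp

variable {M : MinimalSullivanAlgebra.{u}}

/-- The number of generators of degree `j`. -/
noncomputable def numGen (M : MinimalSullivanAlgebra.{u}) [Fintype M.ι] (j : ℕ) : ℕ :=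
  (Finset.univ.filter fun i => M.deg i = j).card

theorem single_one_injective {ι : Type u} : Function.Injective fun i : ι => single i 1 :=
  Finsupp.single_left_injective one_ne_zero

theorem valid_single (i : M.ι) : M.Valid (single i 1) := fun j _ => by
  rw [Finsupp.single_apply]; split_ifs <;> omega

theorem finrank_V [Fintype M.ι] (j : ℕ) : Module.finrank ℚ (M.V j) = M.numGen j := by
  classical
  have h1 : M.V j = M.coordSpan fun m => ∃ i, M.deg i = j ∧ m = single i 1 := by
    apply le_antisymm
    · rw [V, Submodule.span_le]
      rintro _ ⟨i, hi, rfl⟩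
      exact gen_mem_coordSpan ⟨i, hi, rfl⟩
    · refine coordSpan_le ?_
      rintro _ ⟨i, hi, rfl⟩
      rw [mono_single]
      exact Submodule.subset_span ⟨i, hi, rfl⟩
  have h2 : {m | M.Valid m ∧ ∃ i, M.deg i = j ∧ m = single i 1} =
      (((Finset.univ.filter fun i => M.deg i = j).image fun i => single i 1 : Finset (M.ι →₀ ℕ)) :
        Set (M.ι →₀ ℕ)) := by
    ext m
    simp only [Set.mem_ofPred_eq, Finset.coe_image, Finset.coe_filter, Finset.mem_univ, true_and,
      Set.mem_image]
    constructor
    · rintro ⟨-, i, hi, rfl⟩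
      exact ⟨i, hi, rfl⟩
    · rintro ⟨i, hi, rfl⟩
      exact ⟨valid_single i, i, hi, rfl⟩
  rw [h1, finrank_coordSpan (h2 ▸ Finset.finite_toSet _), numGen,
    ← Finset.card_image_of_injective _ (single_one_injective (ι := M.ι))]
  congr 1
  ext m
  rw [Set.Finite.mem_toFinset, h2, Finset.mem_coe]

theorem gen_ne_zero (i : M.ι) : M.gen i ≠ 0 := by
  rw [← mono_single, ← basis_apply M ⟨_, valid_single i⟩]
  exact M.basis.ne_zero _

theorem V_ne_bot_of_gen (i : M.ι) : M.V (M.deg i) ≠ ⊥ := fun h =>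
  gen_ne_zero i ((Submodule.eq_bot_iff _).1 h _ (Submodule.subset_span ⟨i, rfl, rfl⟩))

theorem exists_gen_of_V_ne_bot {j : ℕ} (h : M.V j ≠ ⊥) : ∃ i, M.deg i = j := by
  by_contra! hne
  refine h ?_
  rw [V, show {i | M.deg i = j} = ∅ from Set.eq_empty_of_forall_notMem hne, Set.image_empty,
    Submodule.span_empty]

theorem homotopyEulerChar_eq [Fintype M.ι] :
    M.homotopyEulerChar = ((Finset.univ.filter fun i => Even (M.deg i)).card : ℤ) -
      (Finset.univ.filter fun i => ¬Even (M.deg i)).card := by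
  classical
  have h1 : ∑ i, (-1 : ℤ) ^ M.deg i = M.homotopyEulerChar := by
    rw [homotopyEulerChar, finsum_eq_sum_of_support_subset (s := Finset.univ.image M.deg),
      ← Finset.sum_fiberwise_of_maps_to (g := M.deg) (t := Finset.univ.image M.deg)
      (fun i _ => Finset.mem_image_of_mem _ (Finset.mem_univ i))]
    · refine Finset.sum_congr rfl fun j _ => ?_
      rw [finrank_V, numGen, Finset.sum_congr rfl (g := fun _ => (-1 : ℤ) ^ j)
        fun i hi => by rw [(Finset.mem_filter.1 hi).2], Finset.sum_const, nsmul_eq_mul, mul_comm]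
    · intro j hj
      rw [Function.mem_support, finrank_V] at hj
      have h2 : (Finset.univ.filter fun i => M.deg i = j).card ≠ 0 := fun h0 => hj (by
        rw [numGen, h0, Nat.cast_zero, mul_zero])
      obtain ⟨i, hi⟩ := Finset.card_ne_zero.1 h2
      exact Finset.mem_coe.2 (Finset.mem_image.2 ⟨i, Finset.mem_univ i, (Finset.mem_filter.1 hi).2⟩)
  rw [← h1, ← Finset.sum_filter_add_sum_filter_not Finset.univ (fun i => Even (M.deg i)),
    Finset.sum_congr rfl (g := fun _ => (1 : ℤ)) fun i hi =>
      (Finset.mem_filter.1 hi).2.neg_one_pow,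
    Finset.sum_congr (s₁ := Finset.univ.filter fun i => ¬Even (M.deg i)) rfl
      (g := fun _ => (-1 : ℤ)) fun i hi =>
      (Nat.not_even_iff_odd.1 (Finset.mem_filter.1 hi).2).neg_one_pow]
  simp only [Finset.sum_const, nsmul_eq_mul]
  ring

/-! ### Cohomology in low degrees -/

theorem exists_single_add {m : M.ι →₀ ℕ} (h : m ≠ 0) : ∃ i m', m = single i 1 + m' := by
  obtain ⟨i, hi⟩ := Finsupp.ne_iff.1 h
  refine ⟨i, m - single i 1, (add_tsub_cancel_of_le ?_).symm⟩
  rw [Finsupp.single_le_iff]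
  exact Nat.one_le_iff_ne_zero.2 hi

theorem ne_zero_of_length {m : M.ι →₀ ℕ} (h : 1 ≤ wt (fun _ => 1) m) : m ≠ 0 := by
  rintro rfl
  rw [wt_zero] at h
  omega

theorem length_pos {m : M.ι →₀ ℕ} (h : m ≠ 0) : 1 ≤ wt (fun _ => 1) m := by
  obtain ⟨i, hi⟩ := Finsupp.ne_iff.1 h
  exact le_wt (fun _ => 1) hi

theorem mul_length_le_dg {d : ℕ} (hd : ∀ i, d ≤ M.deg i) (m : M.ι →₀ ℕ) :
    d * wt (fun _ => 1) m ≤ M.dg m := by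
  refine le_trans (le_of_eq ?_) (wt_mono hd m)
  rw [wt, wt, Finsupp.sum, Finsupp.sum, Finset.mul_sum]
  exact Finset.sum_congr rfl fun i _ => by ring

theorem exists_single_of_dg_lt {d : ℕ} (hd : ∀ i, d ≤ M.deg i) {m : M.ι →₀ ℕ} (h0 : m ≠ 0)
    (h : M.dg m < 2 * d) : ∃ i, m = single i 1 := by
  obtain ⟨i, m', rfl⟩ := exists_single_add h0
  refine ⟨i, ?_⟩
  by_contra hne
  have h1 : m' ≠ 0 := fun h' => hne (by rw [h', add_zero])
  have h2 := length_pos h1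
  have h3 := mul_length_le_dg hd (single i 1 + m')
  rw [wt_add, wt_single] at h3
  have h4 : d * 2 ≤ d * (1 * 1 + wt (fun _ => 1) m') := Nat.mul_le_mul_left d (by omega)
  omega

theorem exists_pair_of_dg {d : ℕ} (hd : ∀ i, d ≤ M.deg i) (hd0 : 0 < d) {m : M.ι →₀ ℕ}
    (h2 : 2 ≤ wt (fun _ => 1) m) (h : M.dg m = 2 * d) :
    ∃ i j, M.deg i = d ∧ M.deg j = d ∧ m = single i 1 + single j 1 := by
  obtain ⟨i, m', rfl⟩ := exists_single_add (ne_zero_of_length (by omega : 1 ≤ wt (fun _ => 1) m))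
  rw [wt_add, wt_single] at h2
  rw [dg_add, dg, dg, wt_single, one_mul] at h
  have hi := hd i
  obtain ⟨j, rfl⟩ := exists_single_of_dg_lt hd
    (ne_zero_of_length (by omega : 1 ≤ wt (fun _ => 1) m')) (by change wt M.deg m' < _; omega)
  rw [wt_single, one_mul] at h
  have hj := hd j
  exact ⟨i, j, by omega, by omega, rfl⟩

theorem finrank_gr_of_lt [Fintype M.ι] {d j : ℕ} (hd : ∀ i, d ≤ M.deg i) (h0 : 0 < j)
    (hj : j < 2 * d) : Module.finrank ℚ (M.gr j) = M.numGen j := by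
  rw [← finrank_V]
  have : M.gr j = M.V j := by
    rw [gr_eq]
    apply le_antisymm
    · refine coordSpan_le fun m hm => ?_
      obtain ⟨i, rfl⟩ := exists_single_of_dg_lt hd (m := m)
        (by rintro rfl; rw [dg, wt_zero] at hm; omega) (by omega)
      rw [dg, wt_single, one_mul] at hm
      rw [mono_single]
      exact Submodule.subset_span ⟨i, hm, rfl⟩
    · rw [V, Submodule.span_le]
      rintro _ ⟨i, hi, rfl⟩
      refine gen_mem_coordSpan ?_
      rw [dg, wt_single, one_mul]
      exact hi
  rw [this]

/-- The decomposable elements of degree `j`. -/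
def decomposables (M : MinimalSullivanAlgebra.{u}) (j : ℕ) : Submodule ℚ M.carrier :=
  M.coordSpan fun m => 2 ≤ wt (fun _ => 1) m ∧ M.dg m = j

theorem map_d_gr_le {j : ℕ} (h0 : 0 < j) : (M.gr j).map M.d ≤ M.decomposables (j + 1) := by
  rintro _ ⟨a, ha, rfl⟩
  refine mem_coordSpan_and (d_mem_length ?_) (gr_eq M (j + 1) ▸ M.d_mem _ _ ha)
  rw [SetLike.mem_coe, gr_eq] at ha
  refine coordSpan_mono (fun m hm => ?_) ha
  rintro rfl
  rw [dg, wt_zero] at hm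
  omega

theorem decomposables_eq_bot {d j : ℕ} (hd : ∀ i, d ≤ M.deg i) (hj : j < 2 * d) :
    M.decomposables j = ⊥ := by
  rw [eq_bot_iff]
  refine coordSpan_le fun m hm => ?_
  exfalso
  have h3 := mul_length_le_dg hd m
  have h4 : d * 2 ≤ d * wt (fun _ => 1) m := Nat.mul_le_mul_left d hm.1
  omega

/-- By minimality the image consists of decomposables, and these begin in degree `2 * d`. -/
theorem d_eq_zero_of_lt {d j : ℕ} (hd : ∀ i, d ≤ M.deg i) (h0 : 0 < j) (hj : j + 1 < 2 * d) :
    (M.gr j).map M.d = ⊥ :=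
  le_bot_iff.1 ((map_d_gr_le h0).trans (decomposables_eq_bot hd hj).le)

theorem decomposables_le_cocycles {d : ℕ} (hd : ∀ i, d ≤ M.deg i) (hd2 : 2 ≤ d) :
    M.decomposables (2 * d) ≤ M.cocycles (2 * d) := by
  refine le_inf (gr_eq M (2 * d) ▸ coordSpan_mono fun m hm => hm.2) (coordSpan_le fun m hm => ?_)
  obtain ⟨i, j, hi, hj, rfl⟩ := exists_pair_of_dg hd (by omega) hm.1 hm.2
  have hz : ∀ i, M.deg i = d → M.d (M.gen i) = 0 := fun i hi => by
    have h1 : M.d (M.gen i) ∈ (M.gr d).map M.d := ⟨_, hi ▸ M.gen_mem i, rfl⟩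
    rw [d_eq_zero_of_lt hd (by omega) (by omega)] at h1
    exact h1
  obtain ⟨c, hc, hcm⟩ := M.mono_mul_mono (single i 1) (single j 1)
  rw [mono_single, mono_single] at hcm
  have h2 : M.d (M.gen i * M.gen j) = 0 := by
    rw [M.leibniz_par, hz i hi, hz j hj, zero_mul, mul_zero, add_zero]
  rw [hcm, map_smul] at h2
  exact (smul_eq_zero.1 h2).resolve_left hc

/-- The monomials are the unordered pairs of generators of degree `d`. Repeated pairs count because
`d` is even and squares do not vanish. -/
theorem finrank_decomposables [Fintype M.ι] {d : ℕ} (hd : ∀ i, d ≤ M.deg i) (hd0 : 0 < d)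
    (he : Even d) : Module.finrank ℚ (M.decomposables (2 * d)) = (M.numGen d + 1).choose 2 := by
  classical
  set S := (Finset.univ.filter fun i => M.deg i = d)
  let f : Sym2 S → (M.ι →₀ ℕ) := Sym2.lift ⟨fun a b => single a.1 1 + single b.1 1,
    fun a b => add_comm _ _⟩
  have hf : Function.Injective f := by
    intro x y
    induction x using Sym2.ind with | _ a b =>
    induction y using Sym2.ind with | _ a' b' =>
    intro h
    change single a.1 1 + single b.1 1 = single a'.1 1 + single b'.1 1 at h
    rw [← Multiset.toFinsupp_singleton, ← Multiset.toFinsupp_singleton,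
      ← Multiset.toFinsupp_singleton, ← Multiset.toFinsupp_singleton, ← map_add, ← map_add] at h
    have h1 := Multiset.toFinsupp.injective h
    rw [Multiset.singleton_add, Multiset.singleton_add] at h1
    rw [Sym2.eq_iff]
    rcases Multiset.cons_eq_cons.1 h1 with ⟨h2, h3⟩ | ⟨-, cs, h2, h3⟩
    · exact Or.inl ⟨Subtype.ext h2, Subtype.ext (Multiset.singleton_inj.1 h3)⟩
    · have h4 : cs = 0 := by
        have := congrArg Multiset.card h2
        simpa using this
      subst h4
      exact Or.inr ⟨Subtype.ext (Multiset.singleton_inj.1 h3).symm,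
        Subtype.ext (Multiset.singleton_inj.1 h2)⟩
  have himg : {m | M.Valid m ∧ 2 ≤ wt (fun _ => 1) m ∧ M.dg m = 2 * d} = Set.range f := by
    ext m
    constructor
    · rintro ⟨-, h2, h⟩
      obtain ⟨i, j, hi, hj, rfl⟩ := exists_pair_of_dg hd hd0 h2 h
      exact ⟨s(⟨i, by simp [S, hi]⟩, ⟨j, by simp [S, hj]⟩), rfl⟩
    · rintro ⟨x, rfl⟩
      induction x using Sym2.ind with | _ a b =>
      have ha : M.deg a.1 = d := (Finset.mem_filter.1 a.2).2
      have hb : M.deg b.1 = d := (Finset.mem_filter.1 b.2).2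
      change M.Valid (single a.1 1 + single b.1 1) ∧ 2 ≤ wt (fun _ => 1) (single a.1 1 + single b.1 1) ∧
        M.dg (single a.1 1 + single b.1 1) = 2 * d
      rw [dg_add, dg, dg, wt_add, wt_single, wt_single, wt_single, wt_single, ha, hb]
      refine ⟨valid_add_single.2 ⟨valid_single _, Or.inl (hb ▸ he)⟩, le_rfl, by omega⟩
  rw [decomposables, finrank_coordSpan (himg ▸ Set.finite_range f)]
  have : (himg ▸ Set.finite_range f :
      {m | M.Valid m ∧ 2 ≤ wt (fun _ => 1) m ∧ M.dg m = 2 * d}.Finite).toFinset =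
      Finset.univ.image f := by
    ext m
    rw [Set.Finite.mem_toFinset, himg]
    simp
  rw [this, Finset.card_image_of_injective _ hf, Finset.card_univ, Sym2.card, Fintype.card_coe]
  rfl

theorem numGen_le_finrank_cohomology [Fintype M.ι] {d : ℕ} (hd : ∀ i, d ≤ M.deg i) (hd2 : 2 ≤ d) :
    M.numGen d ≤ Module.finrank ℚ (M.cohomology d) := by
  obtain ⟨e, rfl⟩ : ∃ e, d = e + 1 := ⟨d - 1, by omega⟩
  have h := finrank_gr_succ (M := M) e
  rw [finrank_gr_of_lt hd (by omega) (by omega), d_eq_zero_of_lt hd (by omega) (by omega),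
    d_eq_zero_of_lt hd (by omega) (by omega), finrank_bot] at h
  omega

/-- Both inequalities bound the rank of `d` on degree `2 * d - 1`: by the number of generators
there, and by the dimension of the decomposables that receive its image. Other cocycles of degree `2
* d` may exist, so the first is only an inequality. -/
theorem finrank_cohomology_two_mul [Fintype M.ι] {d : ℕ} (hd : ∀ i, d ≤ M.deg i) (hd2 : 2 ≤ d)
    (he : Even d) :
    (M.numGen d + 1).choose 2 ≤ Module.finrank ℚ (M.cohomology (2 * d)) + M.numGen (2 * d - 1) ∧
    M.numGen (2 * d - 1) ≤
      Module.finrank ℚ (M.cohomology (2 * d - 1)) + (M.numGen d + 1).choose 2 := by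
  obtain ⟨e, he'⟩ : ∃ e, 2 * d = e + 2 := ⟨2 * d - 2, by omega⟩
  have hfin := finiteDimensional_gr (M := M)
  have : FiniteDimensional ℚ (M.cocycles (2 * d)) := Submodule.finiteDimensional_of_le inf_le_left
  have : FiniteDimensional ℚ (M.decomposables (2 * d)) :=
    Submodule.finiteDimensional_of_le (decomposables_le_cocycles hd hd2)
  have h1 := finrank_cohomology_add (M := M) (2 * d)
  have h2 := Submodule.finrank_mono (decomposables_le_cocycles hd hd2)
  have h3 := Submodule.finrank_map_le M.d (M.gr (e + 1))
  have h4 := Submodule.finrank_mono (t := M.decomposables (2 * d))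
    ((map_d_gr_le (M := M) (j := e + 1) (by omega)).trans (by rw [he']))
  have h5 := finrank_gr_succ (M := M) e
  rw [finrank_decomposables hd (by omega) he] at h2 h4
  rw [he', cocycles_inf_range_succ] at h1
  rw [d_eq_zero_of_lt hd (by omega) (by omega), finrank_bot] at h5
  rw [finrank_gr_of_lt hd (by omega) (by omega)] at h3 h5
  rw [show 2 * d - 1 = e + 1 by omega, he']
  rw [he'] at h2
  omega

end MinimalSullivanAlgebra

/-! ### Invariance of cohomology under weak equivalence -/

namespace CochainAlgebra

/-- The map on cohomology induced by a quasi-isomorphism. -/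
noncomputable def QuasiIso.cohomologyMap {A B : CochainAlgebra.{u}} (f : QuasiIso A B) (n : ℕ) :
    A.cohomology n →ₗ[ℚ] B.cohomology n :=
  cohomologyLift
    ((B.cohomologyMk n).comp (f.toAlgHom.toLinearMap.restrict fun a (ha : a ∈ A.cocycles n) =>
      (⟨f.map_gr n a ha.1, by
        change B.d (f.toAlgHom a) = 0
        rw [← f.map_d, show A.d a = 0 from ha.2, map_zero]⟩ : f.toAlgHom a ∈ B.cocycles n)))
    (by
      rintro ⟨_, ha⟩ ⟨a, rfl⟩
      exact cohomologyMk_eq_zero.2 ⟨f.toAlgHom a, (f.map_d a).symm⟩)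

theorem QuasiIso.cohomologyMap_bijective {A B : CochainAlgebra.{u}} (f : QuasiIso A B) (n : ℕ) :
    Function.Bijective (f.cohomologyMap n) := by
  constructor
  · rw [← LinearMap.ker_eq_bot, LinearMap.ker_eq_bot']
    intro x hx
    obtain ⟨a, rfl⟩ := cohomologyMk_surjective n x
    exact cohomologyMk_eq_zero.2 (f.injective n a.1 a.2 (cohomologyMk_eq_zero.1 hx))
  · intro y
    obtain ⟨b, rfl⟩ := cohomologyMk_surjective n y
    obtain ⟨a, ha, hab⟩ := f.surjective n b.1 b.2
    refine ⟨A.cohomologyMk n ⟨a, ha⟩, ?_⟩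
    rw [← sub_eq_zero]
    change B.cohomologyMk n _ - B.cohomologyMk n b = 0
    rw [← map_sub]
    exact cohomologyMk_eq_zero.2 hab

theorem WeaklyEquivalent.cohomology_equiv {A B : CochainAlgebra.{u}} (h : A.WeaklyEquivalent B) :
    Nonempty (∀ n, A.cohomology n ≃ₗ[ℚ] B.cohomology n) := by
  induction h with
  | rel _ _ h =>
    obtain ⟨f⟩ := h
    exact ⟨fun n => LinearEquiv.ofBijective _ (f.cohomologyMap_bijective n)⟩
  | refl A => exact ⟨fun n => LinearEquiv.refl ℚ _⟩
  | symm _ _ _ ih =>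
    obtain ⟨e⟩ := ih
    exact ⟨fun n => (e n).symm⟩
  | trans _ _ _ _ _ ih₁ ih₂ =>
    obtain ⟨e₁⟩ := ih₁
    obtain ⟨e₂⟩ := ih₂
    exact ⟨fun n => (e₁ n).trans (e₂ n)⟩

theorem sum_finrank_le {A : CochainAlgebra.{u}} [FiniteDimensional ℚ A.totalCohomology] (n : ℕ) :
    ∑ j ∈ Finset.range n, Module.finrank ℚ (A.cohomology j) ≤
      Module.finrank ℚ A.totalCohomology := by
  classical
  have hsurj : ∀ j, Function.Surjective (DirectSum.component ℚ ℕ A.cohomology j) := fun j x =>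
    ⟨DirectSum.lof ℚ ℕ A.cohomology j x, DirectSum.component.lof_self ℚ j x⟩
  have hfin : ∀ j, FiniteDimensional ℚ (A.cohomology j) := fun j =>
    Module.Finite.of_surjective _ (hsurj j)
  rw [← Finset.sum_coe_sort, ← Module.finrank_pi_fintype ℚ]
  refine LinearMap.finrank_le_finrank_of_surjective
    (f := LinearMap.pi fun j : Finset.range n => DirectSum.component ℚ ℕ A.cohomology j) fun y => ?_
  refine ⟨DirectSum.mk A.cohomology (Finset.range n) y, funext fun j => ?_⟩
  exact DirectSum.mk_apply_of_mem j.2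

end CochainAlgebra

/-! ### Adding up the Betti numbers -/

namespace MinimalSullivanAlgebra

/-- The bounds for the Betti numbers of an elliptic minimal Sullivan algebra. -/
theorem sum_betti_bounds {M : MinimalSullivanAlgebra.{u}} [Fintype M.ι] {d n : ℕ}
    (hn : M.IsFormalDimension n)
    (hodd : (Finset.univ.filter fun i => Even (M.deg i)).card <
      (Finset.univ.filter fun i => ¬Even (M.deg i)).card)
    (hd : ∀ i, d ≤ M.deg i) (hd2 : 2 ≤ d) (he : Even d) (hdn : 4 * d < n) {S : ℤ}
    (hS : S = ∑ j ∈ Finset.range (n + 1), (Module.finrank ℚ (M.cohomology j) : ℤ)) :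
    2 * (1 + (M.numGen d : ℤ) +
        |(M.numGen (2 * d - 1) : ℤ) - ((M.numGen d + 1).choose 2 : ℤ)|) ≤ S ∧
      (Even n →
        4 * (1 + (M.numGen d : ℤ) +
          ((M.numGen d + 1).choose 2 : ℤ) - (M.numGen (2 * d - 1) : ℤ)) ≤ S ∧
        4 * ((M.numGen (2 * d - 1) : ℤ) - ((M.numGen d + 1).choose 2 : ℤ)) ≤ S ∧
        4 * (1 + (M.numGen d : ℤ)) ≤ S) := by
  obtain ⟨b, hb⟩ : ∃ b : ℕ → ℤ, ∀ j, b j = (Module.finrank ℚ (M.cohomology j) : ℤ) :=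
    ⟨_, fun _ => rfl⟩
  have hnn : ∀ j, 0 ≤ b j := fun j => by rw [hb]; exact Nat.cast_nonneg _
  have hfin := finiteDimensional_cohomology (M := M)
  have h0 : 1 ≤ b 0 := by
    have := nontrivial_cohomology_zero (M := M)
    have := Module.finrank_pos (R := ℚ) (M := M.cohomology 0)
    rw [hb]
    omega
  have h1 : (M.numGen d : ℤ) ≤ b d := by
    rw [hb]
    exact_mod_cast numGen_le_finrank_cohomology hd hd2
  obtain ⟨h2, h3⟩ := finrank_cohomology_two_mul hd hd2 he
  have h2' : ((M.numGen d + 1).choose 2 : ℤ) ≤ b (2 * d) + M.numGen (2 * d - 1) := by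
    rw [hb]
    exact_mod_cast h2
  have h3' : (M.numGen (2 * d - 1) : ℤ) ≤ b (2 * d - 1) + ((M.numGen d + 1).choose 2 : ℤ) := by
    rw [hb]
    exact_mod_cast h3
  have hpd : ∀ i j, i + j = n → b i = b j := fun i j hij => by
    rw [hb, hb, finrank_cohomology_eq hn hij]
  have p0 := hpd 0 n (by omega)
  have p1 := hpd d (n - d) (by omega)
  have p2 := hpd (2 * d) (n - 2 * d) (by omega)
  have p3 := hpd (2 * d - 1) (n - (2 * d - 1)) (by omega)
  simp only [← hb] at hS
  constructor
  -- The eight degrees are distinct because `d ≥ 2` and `4 * d < n`. According to the sign of the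
  -- difference, degree `2 * d - 1` or `2 * d` supplies the absolute value.
  · have h4 : ∑ j ∈ {0, d, 2 * d - 1, 2 * d, n - 2 * d, n - (2 * d - 1), n - d, n}, b j ≤ S := by
      rw [hS]
      refine Finset.sum_le_sum_of_subset_of_nonneg (fun j hj => ?_) fun j _ _ => hnn j
      simp only [Finset.mem_insert, Finset.mem_singleton] at hj
      rw [Finset.mem_range]
      omega
    repeat rw [Finset.sum_insert (by
      simp only [Finset.mem_insert, Finset.mem_singleton]; omega)] at h4
    rw [Finset.sum_singleton] at h4
    have h5 := hnn (2 * d)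
    have h6 := hnn (2 * d - 1)
    rcases abs_cases ((M.numGen (2 * d - 1) : ℤ) - ((M.numGen d + 1).choose 2 : ℤ)) with
      ⟨h, -⟩ | ⟨h, -⟩ <;> rw [h] <;> linarith
  · intro hne
    have hχ := (exactAbove_of_isFormalDimension hn).euler_char_eq_zero hodd
    simp only [← hb] at hχ
    -- The Euler characteristic vanishes, so the even and the odd degrees each contribute `S / 2`.
    -- As `n` is even, duality preserves parity and the listed degrees fall entirely into one half.
    rw [← Finset.sum_filter_add_sum_filter_not _ (fun j => Even j)] at hχ hS
    rw [Finset.sum_congr rfl (g := b) fun j hj => by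
        rw [(Finset.mem_filter.1 hj).2.neg_one_pow, one_mul],
      Finset.sum_congr (s₁ := (Finset.range (n + 1)).filter fun j => ¬Even j) rfl
        (g := fun j => -b j) fun j hj => by
        rw [(Nat.not_even_iff_odd.1 (Finset.mem_filter.1 hj).2).neg_one_pow, neg_one_mul],
      Finset.sum_neg_distrib] at hχ
    have h4 : ∑ j ∈ {0, d, 2 * d, n - 2 * d, n - d, n}, b j ≤
        ∑ j ∈ (Finset.range (n + 1)).filter fun j => Even j, b j := by
      refine Finset.sum_le_sum_of_subset_of_nonneg (fun j hj => ?_) fun j _ _ => hnn j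
      simp only [Finset.mem_insert, Finset.mem_singleton] at hj
      rw [Finset.mem_filter, Finset.mem_range, Nat.even_iff]
      rw [Nat.even_iff] at hne he
      omega
    have h5 : ∑ j ∈ {2 * d - 1, n - (2 * d - 1)}, b j ≤
        ∑ j ∈ (Finset.range (n + 1)).filter fun j => ¬Even j, b j := by
      refine Finset.sum_le_sum_of_subset_of_nonneg (fun j hj => ?_) fun j _ _ => hnn j
      simp only [Finset.mem_insert, Finset.mem_singleton] at hj
      rw [Finset.mem_filter, Finset.mem_range, Nat.even_iff]
      rw [Nat.even_iff] at hne he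
      omega
    repeat rw [Finset.sum_insert (by
      simp only [Finset.mem_insert, Finset.mem_singleton]; omega)] at h4
    rw [Finset.sum_singleton] at h4
    rw [Finset.sum_insert (by rw [Finset.mem_singleton]; omega), Finset.sum_singleton] at h5
    have h6 := hnn (2 * d)
    refine ⟨?_, ?_, ?_⟩ <;> linarith

end MinimalSullivanAlgebra

/-- `X` is a simply connected rationally elliptic space with minimal model `M = (ΛV, d)`, so that
`dim πᵢ(X) ⊗ ℚ = dim Vⁱ`, the integer `p = -∑ᵢ (-1)ⁱ dim Vⁱ` is positive, and `n = fd(X)`. -/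
theorem lemma2p4 (X : Type u) [TopologicalSpace X] [SimplyConnectedSpace X]
    (M : MinimalSullivanAlgebra.{u}) (hMX : M.Models X) (hell : M.IsElliptic)
    (hp : 0 < -M.homotopyEulerChar)
    (d k l n : ℕ)
    (hd : IsLeast {i : ℕ | M.V i ≠ ⊥} d) (hdeven : Even d)
    (hk : Module.finrank ℚ (M.V d) = k)
    (hd' : IsLeast {i : ℕ | d < i ∧ M.V i ≠ ⊥} (2 * d - 1))
    (hl : Module.finrank ℚ (M.V (2 * d - 1)) = l)
    (hn : (singularCochainAlgebra X).IsFormalDimension n)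
    (hdn : 2 * (d : ℝ) - 1 < (n : ℝ) / 2 - 1) :
    (Even n →
      (l ≤ (k + 1).choose 2 →
        4 * (1 + (k : ℤ) + ((k + 1).choose 2 : ℤ) - (l : ℤ)) ≤
          (Module.finrank ℚ (singularCochainAlgebra X).totalCohomology : ℤ)) ∧
      ((k + 1).choose 2 < l →
        4 * max ((l : ℤ) - ((k + 1).choose 2 : ℤ)) (1 + (k : ℤ)) ≤
          (Module.finrank ℚ (singularCochainAlgebra X).totalCohomology : ℤ))) ∧
    (Odd n →
      2 * (1 + (k : ℤ) + |(l : ℤ) - ((k + 1).choose 2 : ℤ)|) ≤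
        (Module.finrank ℚ (singularCochainAlgebra X).totalCohomology : ℤ)) := by
  obtain ⟨hfin, hH⟩ := hell
  have := Fintype.ofFinite M.ι
  obtain ⟨e⟩ := hMX.cohomology_equiv
  have hnM : M.IsFormalDimension n := by
    have : {m : ℕ | Nontrivial (M.cohomology m)} =
        {m : ℕ | Nontrivial ((singularCochainAlgebra X).cohomology m)} :=
      Set.ext fun m => (e m).toEquiv.nontrivial_congr
    rw [CochainAlgebra.IsFormalDimension, this]
    exact hn
  have htot : Module.finrank ℚ (singularCochainAlgebra X).totalCohomology =
      Module.finrank ℚ M.totalCohomology :=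
    (DFinsupp.mapRange.linearEquiv e).symm.finrank_eq
  have hsum := CochainAlgebra.sum_finrank_le (A := M.toCochainAlgebra) (n + 1)
  have hdeg : ∀ i, d ≤ M.deg i := fun i => hd.2 (M.V_ne_bot_of_gen i)
  have hd2 : 2 ≤ d := by
    obtain ⟨i, rfl⟩ := M.exists_gen_of_V_ne_bot hd.1
    exact M.two_le_deg i
  have hdn' : 4 * d < n := by
    have h : (4 * d : ℝ) < n := by linarith
    exact_mod_cast h
  have hodd : (Finset.univ.filter fun i => Even (M.deg i)).card <
      (Finset.univ.filter fun i => ¬Even (M.deg i)).card := by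
    rw [MinimalSullivanAlgebra.homotopyEulerChar_eq] at hp
    omega
  rw [MinimalSullivanAlgebra.finrank_V] at hk hl
  obtain ⟨h1, h2⟩ := M.sum_betti_bounds hnM hodd hdeg hd2 hdeven hdn' rfl
  rw [hk, hl] at h1 h2
  zify at hsum
  rw [htot]
  refine ⟨fun hne => ⟨fun _ => ?_, fun _ => ?_⟩, fun _ => ?_⟩
  · exact (h2 hne).1.trans hsum
  · obtain ⟨-, h3, h4⟩ := h2 hne
    rw [mul_max_of_nonneg _ _ (by norm_num)]
    exact (max_le h3 h4).trans hsum
  · exact h1.trans hsum
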